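/- Let $\mathbb{E}^3_1$ be $\mathbb{R}^3$ with the scalar product $\langle x,y\rangle=-x_1y_1+x_2y_2+x_3y_3$. Let $M$ be a connected orientable smooth 2-manifold, $\varphi\colon M\to\mathbb{E}^3_1$ a smooth timelike immersion (i.e. the induced metric $I=\langle d\varphi,d\varphi\rangle$ is Lorentzian), and $N$ a smooth unit normal vector field along $\varphi$. Let $II=-\langle d\varphi,dN\rangle$ be the second fundamental form and $H=\frac12\operatorname{tr}_I II$ the mean curvature. Assume that $H$ is constant and that $\varphi$ is not totally umbilic (i.e. $II$ is not pointwise a multiple of $I$ on all of $M$). A null coordinate region $(\mathbb{D};u,v)$ is an open set $\mathbb{D}\subset M$ with smooth coordinates $(u,v)$ on it in which $I=e^{\omega}\,du\,dv$ for a smooth function $\omega$; put $Q=\langle\varphi_{uu},N\rangle$ and $R=\langle\varphi_{vv},N\rangle$. Then $\varphi$ has a local one-parameter family of isometric deformations preserving the mean curvature. Precisely: 1. Every point of $M$ lies in a simply connected null coordinate region. 2. For every simply connected null coordinate region $(\mathbb{D};u,v)$ there is a family of smooth timelike immersions $\varphi_\lambda\colon\mathbb{D}\to\mathbb{E}^3_1$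 with unit normals $N_\lambda$, $\lambda\in\mathbb{R}^\times=\mathbb{R}\setminus\{0\}$, where $\varphi_\lambda(q)$ and $N_\lambda(q)$ depend smoothly on $(\lambda,q)\in\mathbb{R}^\times\times\mathbb{D}$, such that $\varphi_1=\varphi|_{\mathbb{D}}$ and $N_1=N|_{\mathbb{D}}$, and such that for every $\lambda\in\mathbb{R}^\times$: $\varphi_\lambda$ induces on $\mathbb{D}$ the same metric $I$ as $\varphi$; $N_\lambda$ is the unit normal belonging to the same orientation, i.e. $\det(d\varphi_\lambda X,d\varphi_\lambda Y,N_\lambda)=\det(d\varphi X,d\varphi Y,N)$ for all tangent vectors $X,Y$ at the same point of $\mathbb{D}$; the mean curvature of $\varphi_\lambda$ with respect to $N_\lambda$ equals that of $\varphi$, the constant $H$; and $$Q_\lambda:=\langle(\varphi_\lambda)_{uu},N_\lambda\rangle=\lambda Q,\qquad R_\lambda:=\langle(\varphi_\lambda)_{vv},N_\lambda\rangle=\lambda^{-1}R .$$ Moreover the family can be chosen so that it is also nontrivial whenever $\mathbb{D}$ contains a non-umbilic point of $\varphi$: in that case, if $\lambda\ne\mu$ and $\varphi_\lambda,\varphi_\mu$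 differ by an isometry of $\mathbb{E}^3_1$, then $H=0$ and $\mu=-\lambda$. -/

import Mathlib

open scoped Manifold ContDiff

noncomputable section

namespace TimelikeSurface

/-- The vector space underlying Minkowski 3-space `E³₁`, as a smooth manifold. -/
abbrev E31 : Type := Fin 3 → ℝ

/-- The Lorentzian scalar product `-x₀y₀ + x₁y₁ + x₂y₂` of `E³₁`. -/
def lor (x y : E31) : ℝ := -(x 0 * y 0) + x 1 * y 1 + x 2 * y 2

/-- The standard volume form `det (a, b, c)` of `E³₁`; it equals `⟨a × b, c⟩` for the
Lorentzian vector product. -/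
def vol (a b c : E31) : ℝ := Matrix.det (Matrix.of ![a, b, c])

/-- The plane on which 2-manifolds are modelled. -/
abbrev Plane : Type := EuclideanSpace ℝ (Fin 2)

/-- The `i`-th standard basis vector of the model plane. -/
def stdVec (i : Fin 2) : Plane := EuclideanSpace.single i 1

section Surface

variable {M : Type*} [TopologicalSpace M] [ChartedSpace Plane M]

/-- The differential of a map `f : M → E³₁` at `p`. -/
def diff (f : M → E31) (p : M) : TangentSpace (𝓡 2) p →L[ℝ] E31 :=
  mfderiv (𝓡 2) 𝓘(ℝ, E31) f p

/-- First fundamental form `I = ⟨dφ, dφ⟩`. -/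
def firstForm (φ : M → E31) (p : M) (X Y : TangentSpace (𝓡 2) p) : ℝ :=
  lor (diff φ p X) (diff φ p Y)

/-- Second fundamental form `II = -⟨dφ, dN⟩` with respect to the normal field `N`. -/
def secondForm (φ N : M → E31) (p : M) (X Y : TangentSpace (𝓡 2) p) : ℝ :=
  -lor (diff φ p X) (diff N p Y)

/-- `φ` restricted to the set `D` (open, in all uses) is a smooth timelike immersion into `E³₁`
and `N` is a smooth unit normal vector field along it. -/
structure IsTimelikeOn (φ N : M → E31) (D : Set M) : Prop where
  smooth : ContMDiffOn (𝓡 2) 𝓘(ℝ, E31) ∞ φ D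
  immersion : ∀ p ∈ D, Function.Injective (diff φ p)
  /-- The induced metric is Lorentzian: there is an orthonormal basis of signature `(-, +)`. -/
  lorentzian : ∀ p ∈ D, ∃ X Y : TangentSpace (𝓡 2) p,
    firstForm φ p X X = -1 ∧ firstForm φ p Y Y = 1 ∧ firstForm φ p X Y = 0
  smooth_normal : ContMDiffOn (𝓡 2) 𝓘(ℝ, E31) ∞ N D
  unit_normal : ∀ p ∈ D, lor (N p) (N p) = 1
  normal : ∀ p ∈ D, ∀ X : TangentSpace (𝓡 2) p, lor (diff φ p X) (N p) = 0

/-- Matrix of the first fundamental form in the standard basis of the tangent space. -/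
def firstMatrix (φ : M → E31) (p : M) : Matrix (Fin 2) (Fin 2) ℝ :=
  Matrix.of fun i j => firstForm φ p (stdVec i) (stdVec j)

/-- Matrix of the second fundamental form in the standard basis of the tangent space. -/
def secondMatrix (φ N : M → E31) (p : M) : Matrix (Fin 2) (Fin 2) ℝ :=
  Matrix.of fun i j => secondForm φ N p (stdVec i) (stdVec j)

/-- Mean curvature: half the trace of the second fundamental form with respect to the first,
`H = ½ tr (I⁻¹ II)`. -/
def meanCurvature (φ N : M → E31) (p : M) : ℝ :=
  (1 / 2) * Matrix.trace ((firstMatrix φ p)⁻¹ * secondMatrix φ N p)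

/-- `p` is an umbilic point: `II` is a multiple of `I` at `p`. -/
def IsUmbilicAt (φ N : M → E31) (p : M) : Prop :=
  ∃ c : ℝ, ∀ X Y : TangentSpace (𝓡 2) p, secondForm φ N p X Y = c * firstForm φ p X Y

/-- Every point is umbilic. -/
def IsTotallyUmbilic (φ N : M → E31) : Prop := ∀ p : M, IsUmbilicAt φ N p

/-- Partial derivative of `f` with respect to the `i`-th coordinate of the chart `e`
(meaningful on `e.source`). -/
def coordDeriv (e : OpenPartialHomeomorph M Plane) (i : Fin 2) (f : M → E31) (q : M) : E31 :=
  fderiv ℝ (f ∘ e.symm) (e q) (stdVec i)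

/-- The smooth chart `e = (u, v)`, with domain `e.source`, is a null coordinate system for the
metric induced by `φ`: `I = e^ω du dv`, that is,
`⟨φ_u, φ_u⟩ = ⟨φ_v, φ_v⟩ = 0` and `⟨φ_u, φ_v⟩ = e^ω / 2 > 0`. -/
structure IsNullChart (φ : M → E31) (e : OpenPartialHomeomorph M Plane) : Prop where
  mem_atlas : e ∈ IsManifold.maximalAtlas (𝓡 2) ∞ M
  null_u : ∀ q ∈ e.source, lor (coordDeriv e 0 φ q) (coordDeriv e 0 φ q) = 0
  null_v : ∀ q ∈ e.source, lor (coordDeriv e 1 φ q) (coordDeriv e 1 φ q) = 0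
  pos : ∀ q ∈ e.source, 0 < lor (coordDeriv e 0 φ q) (coordDeriv e 1 φ q)

/-- The coefficient `Q = ⟨φ_uu, N⟩` of the Hopf differential `Q du² + R dv²`. -/
def hopfQ (e : OpenPartialHomeomorph M Plane) (φ N : M → E31) (q : M) : ℝ :=
  lor (coordDeriv e 0 (coordDeriv e 0 φ) q) (N q)

/-- The coefficient `R = ⟨φ_vv, N⟩` of the Hopf differential `Q du² + R dv²`. -/
def hopfR (e : OpenPartialHomeomorph M Plane) (φ N : M → E31) (q : M) : ℝ :=
  lor (coordDeriv e 1 (coordDeriv e 1 φ) q) (N q)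

/-- `(Φ l, ν l)`, for real `l ≠ 0`, is a smooth one-parameter family of isometric deformations,
over the domain of the null chart `e = (u, v)`, of the surface `φ` with unit normal `N`; it
preserves the mean curvature and scales the Hopf differential by `Q ↦ l Q`, `R ↦ l⁻¹ R`. -/
structure IsAssociatedFamily (φ N : M → E31) (e : OpenPartialHomeomorph M Plane)
    (Φ ν : ℝ → M → E31) : Prop where
  smooth : ContMDiffOn (𝓘(ℝ, ℝ).prod (𝓡 2)) 𝓘(ℝ, E31) ∞
    (fun x : ℝ × M => Φ x.1 x.2) ({0}ᶜ ×ˢ e.source)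
  smooth_normal : ContMDiffOn (𝓘(ℝ, ℝ).prod (𝓡 2)) 𝓘(ℝ, E31) ∞
    (fun x : ℝ × M => ν x.1 x.2) ({0}ᶜ ×ˢ e.source)
  one : ∀ q ∈ e.source, Φ 1 q = φ q
  normal_one : ∀ q ∈ e.source, ν 1 q = N q
  timelike : ∀ l : ℝ, l ≠ 0 → IsTimelikeOn (Φ l) (ν l) e.source
  isometric : ∀ l : ℝ, l ≠ 0 → ∀ q ∈ e.source, ∀ X Y : TangentSpace (𝓡 2) q,
    firstForm (Φ l) q X Y = firstForm φ q X Y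
  /-- `ν l` is the unit normal of `Φ l` that belongs to the same orientation of the domain
  as the unit normal `N` of `φ`. -/
  oriented : ∀ l : ℝ, l ≠ 0 → ∀ q ∈ e.source, ∀ X Y : TangentSpace (𝓡 2) q,
    vol (diff (Φ l) q X) (diff (Φ l) q Y) (ν l q) = vol (diff φ q X) (diff φ q Y) (N q)
  meanCurvature_eq : ∀ l : ℝ, l ≠ 0 → ∀ q ∈ e.source,
    meanCurvature (Φ l) (ν l) q = meanCurvature φ N q
  hopfQ_eq : ∀ l : ℝ, l ≠ 0 → ∀ q ∈ e.source, hopfQ e (Φ l) (ν l) q = l * hopfQ e φ N q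
  hopfR_eq : ∀ l : ℝ, l ≠ 0 → ∀ q ∈ e.source, hopfR e (Φ l) (ν l) q = l⁻¹ * hopfR e φ N q

end Surface

/-- `f` and `g` are congruent on `D`: they differ by an isometry `x ↦ A x + b` of `E³₁`
(of either orientation). -/
def CongruentOn {M : Type*} (f g : M → E31) (D : Set M) : Prop :=
  ∃ (A : E31 →ₗ[ℝ] E31) (b : E31), (∀ x y, lor (A x) (A y) = lor x y) ∧
    ∀ q ∈ D, g q = A (f q) + b

end TimelikeSurface

end

/-! In null coordinates with ρ = ⟨ψ_u, ψ_v⟩, the tuple (ψ, ψ_u, ψ_v, N) solves a linear total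
differential equation, the equations of Gauss and Weingarten, whose coefficients depend on ρ, H, Q
and R. For constant H its integrability conditions are the Gauss equation (ρ_u/ρ)_v = QR/ρ - H²ρ =
(ρ_v/ρ)_u and the Codazzi equations Q_v = 0 and R_u = 0. The Gauss equation sees Q and R only
through their product and the Codazzi equations are homogeneous, so all of them survive the
replacement of (Q, R) by (λQ, λ⁻¹R) (`IsNullSurface.isFlatOn`). On a simply connected domain the
modified system can be integrated from the same initial frame for every λ ≠ 0
(`exists_solution_of_flat`). The Gram matrix of the solution and the expected one solve the same
linear system, hence agree (`IsGaussFrame.isNullFrame`); this gives the surface with the same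
metric, the same H and the scaled Hopf differential. The orientation persists because det² = ρ²
never vanishes and the domain is connected.

For nontriviality, a congruence carries one unit normal to c = ±1 times the other, so (μQ, μ⁻¹R, H)
= c (λQ, λ⁻¹R, H) (`IsNullSurface.hopf_of_congruent`). At a non-umbilic point Q and R are not both
zero, which forces μ = cλ; if μ ≠ λ, then c = -1 and H = 0.

Null coordinates are first integrals of the two null direction fields ∂ₓ + s ∂_y, where s is a root
of E + 2Fs + Gs² (`exists_null_coordinates`).

The analytic inputs are smooth dependence statements, derived from calculus in the Banach space of
continuous paths. Superposition operators are smooth there. For linear equations the solution is the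
inverse of 1 - T applied to a constant, with T a Volterra operator, and inversion is smooth
(`contDiff_evolution`). For the nonlinear flow of a plane field the inverse function theorem is
applied to the integral equation (`exists_first_integral`). -/

noncomputable section

namespace TimelikeSurface

open scoped Topology unitInterval
open Set Filter

/-! ### Superposition operators on spaces of continuous maps -/

section Superposition

variable {K : Type*} [TopologicalSpace K] [CompactSpace K]
  {E F : Type*} [NormedAddCommGroup E] [NormedSpace ℝ E] [NormedAddCommGroup F] [NormedSpace ℝ F]

/-- The set of continuous maps `K → E` with values in `U`. -/
def mapsInto (K : Type*) [TopologicalSpace K] {E : Type*} [TopologicalSpace E] (U : Set E) :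
    Set C(K, E) := {Z | ∀ t, Z t ∈ U}

open Classical in
/-- The superposition operator `Z ↦ h ∘ Z`, with value `0` where `h ∘ Z` is not continuous. -/
def superpose (K : Type*) [TopologicalSpace K] {E F : Type*} [TopologicalSpace E]
    [TopologicalSpace F] [Zero F] (h : E → F) (Z : C(K, E)) : C(K, F) :=
  if hc : Continuous (h ∘ Z) then ⟨h ∘ Z, hc⟩ else 0

omit [CompactSpace K] [NormedSpace ℝ E] [NormedSpace ℝ F] in
theorem superpose_apply {h : E → F} {U : Set E} (hh : ContinuousOn h U) {Z : C(K, E)}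
    (hZ : Z ∈ mapsInto K U) (t : K) : superpose K h Z t = h (Z t) := by
  have hc : Continuous (h ∘ Z) := hh.comp_continuous Z.continuous hZ
  simp [superpose, hc]

omit [NormedSpace ℝ E] [NormedSpace ℝ F] in
-- A compact image has a uniform neighbourhood inside U, and continuity at the points of a compact
-- set is uniform even when compared with points off the set. This turns pointwise estimates into
-- estimates in the sup norm.
theorem uniform_near_range {g : E → F} {U : Set E} (hU : IsOpen U) (hg : ContinuousOn g U)
    {Z : C(K, E)} (hZ : Z ∈ mapsInto K U) {ε : ℝ} (hε : 0 < ε) :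
    ∃ δ > 0, ∀ t w, dist w (Z t) < δ → w ∈ U ∧ dist (g w) (g (Z t)) < ε := by
  have hK : IsCompact (range Z) := isCompact_range Z.continuous
  have hKU : range Z ⊆ U := by rintro _ ⟨t, rfl⟩; exact hZ t
  obtain ⟨δ₁, h₁, hδ₁⟩ := hK.exists_thickening_subset_open hU hKU
  have h2 := hK.uniformContinuousAt_of_continuousAt g
    (fun a ha => hg.continuousAt (hU.mem_nhds (hKU ha))) (Metric.dist_mem_uniformity hε)
  obtain ⟨δ₂, h₂, hδ₂⟩ := Metric.mem_uniformity_dist.1 h2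
  refine ⟨min δ₁ δ₂, lt_min h₁ h₂, fun t w hw => ⟨hδ₁ ?_, ?_⟩⟩
  · exact Metric.mem_thickening_iff.2 ⟨Z t, mem_range_self t, hw.trans_le (min_le_left _ _)⟩
  · rw [dist_comm]
    refine hδ₂ ?_ (mem_range_self t)
    rw [dist_comm]
    exact hw.trans_le (min_le_right _ _)

omit [NormedSpace ℝ E] in
theorem isOpen_mapsInto {U : Set E} (hU : IsOpen U) : IsOpen (mapsInto K U) := by
  refine Metric.isOpen_iff.2 fun Z hZ => ?_
  obtain ⟨δ, hδ, h⟩ := uniform_near_range (g := id) hU continuousOn_id hZ one_pos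
  exact ⟨δ, hδ, fun Y hY t => (h t (Y t) ((ContinuousMap.dist_apply_le_dist t).trans_lt hY)).1⟩

omit [NormedSpace ℝ E] [NormedSpace ℝ F] in
theorem continuousOn_superpose {h : E → F} {U : Set E} (hU : IsOpen U) (hh : ContinuousOn h U) :
    ContinuousOn (superpose K h) (mapsInto K U) := by
  intro Z hZ
  refine ContinuousAt.continuousWithinAt (Metric.continuousAt_iff.2 fun ε hε => ?_)
  obtain ⟨δ, hδ, H⟩ := uniform_near_range hU hh hZ (half_pos hε)
  refine ⟨δ, hδ, fun {Y} hY => ?_⟩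
  have hY' : ∀ t, dist (Y t) (Z t) < δ := fun t => (ContinuousMap.dist_apply_le_dist t).trans_lt hY
  refine lt_of_le_of_lt ((ContinuousMap.dist_le (half_pos hε).le).2 fun t => ?_) (half_lt_self hε)
  rw [superpose_apply hh (fun t => (H t _ (hY' t)).1), superpose_apply hh hZ]
  exact (H t _ (hY' t)).2.le

/-- Pointwise application of a family of operators to a family of vectors. -/
def pointwiseApply (K : Type*) [TopologicalSpace K] [CompactSpace K]
    (E F : Type*) [NormedAddCommGroup E] [NormedSpace ℝ E] [NormedAddCommGroup F]
    [NormedSpace ℝ F] : C(K, E →L[ℝ] F) →L[ℝ] C(K, E) →L[ℝ] C(K, F) :=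
  LinearMap.mkContinuous₂
    (LinearMap.mk₂ ℝ
      (fun (A : C(K, E →L[ℝ] F)) (Z : C(K, E)) => (⟨fun t => A t (Z t), by fun_prop⟩ : C(K, F)))
      (by intros; ext; simp) (by intros; ext; simp) (by intros; ext; simp) (by intros; ext; simp))
    1 (by
      intro A Z
      rw [one_mul]
      refine (ContinuousMap.norm_le _ (by positivity)).2 fun t => ?_
      exact ((A t).le_opNorm _).trans
        (mul_le_mul (A.norm_coe_le_norm t) (Z.norm_coe_le_norm t) (norm_nonneg _) (norm_nonneg A)))

@[simp] theorem pointwiseApply_apply (A : C(K, E →L[ℝ] F)) (Z : C(K, E)) (t : K) :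
    pointwiseApply K E F A Z t = A t (Z t) := rfl

/-- The mean value inequality on balls around `Z t`, with a radius independent of t, bounds the
remainder by ε‖Y - Z‖ in the sup norm. The derivative is pointwise application of h' along Z. -/
theorem hasFDerivAt_superpose {h : E → F} {U : Set E} (hU : IsOpen U) (hh : ContDiffOn ℝ 1 h U)
    {Z : C(K, E)} (hZ : Z ∈ mapsInto K U) :
    HasFDerivAt (superpose K h) (pointwiseApply K E F (superpose K (fderiv ℝ h) Z)) Z := by
  have hd : ContinuousOn (fderiv ℝ h) U := hh.continuousOn_fderiv_of_isOpen hU le_rfl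
  rw [hasFDerivAt_iff_isLittleO, Asymptotics.isLittleO_iff]
  intro ε hε
  obtain ⟨δ, hδ, H⟩ := uniform_near_range hU hd hZ hε
  filter_upwards [Metric.ball_mem_nhds Z hδ] with Y hY
  have hY' : ∀ t, dist (Y t) (Z t) < δ := fun t => (ContinuousMap.dist_apply_le_dist t).trans_lt hY
  refine (ContinuousMap.norm_le _ (by positivity)).2 fun t => ?_
  simp only [ContinuousMap.sub_apply, pointwiseApply_apply, superpose_apply hd hZ,
    superpose_apply hh.continuousOn hZ,
    superpose_apply hh.continuousOn (fun t => (H t _ (hY' t)).1)]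
  refine ((convex_ball (Z t) δ).norm_image_sub_le_of_norm_hasFDerivWithin_le'
    (f' := fderiv ℝ h) (C := ε) (fun w hw => ?_) (fun w hw => ?_) (Metric.mem_ball_self hδ)
    (Metric.mem_ball.2 (hY' t))).trans ?_
  · exact (((hh.contDiffAt (hU.mem_nhds (H t w hw).1)).differentiableAt one_ne_zero)
      ).hasFDerivAt.hasFDerivWithinAt
  · rw [← dist_eq_norm]; exact (H t w hw).2.le
  · gcongr
    exact (Y - Z).norm_coe_le_norm t

end Superposition

/-- The derivative of the superposition by h is the superposition by `fderiv ℝ h` followed by a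
fixed bounded operator, so smoothness climbs by induction. F is quantified inside the induction
because each step replaces it by E →L F. -/
theorem contDiffOn_superpose_nat {K : Type*} [TopologicalSpace K] [CompactSpace K]
    {E : Type} [NormedAddCommGroup E] [NormedSpace ℝ E] {U : Set E} (hU : IsOpen U) (n : ℕ) :
    ∀ {F : Type} [NormedAddCommGroup F] [NormedSpace ℝ F] {h : E → F}, ContDiffOn ℝ n h U →
      ContDiffOn ℝ n (superpose K h) (mapsInto K U) := by
  induction n with
  | zero =>
    intro F _ _ h hh
    exact contDiffOn_zero.2 (continuousOn_superpose hU (contDiffOn_zero.1 hh))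
  | succ n ih =>
    intro F _ _ h hh
    have h1 : ContDiffOn ℝ 1 h U := hh.of_le (by norm_cast; omega)
    push_cast at hh ⊢
    rw [contDiffOn_succ_iff_fderiv_of_isOpen hU] at hh
    rw [contDiffOn_succ_iff_fderiv_of_isOpen (isOpen_mapsInto hU)]
    refine ⟨fun Z hZ => (hasFDerivAt_superpose hU h1 hZ).differentiableAt.differentiableWithinAt,
      by simp, ?_⟩
    refine ContDiffOn.congr (f := fun Z => pointwiseApply K E F (superpose K (fderiv ℝ h) Z)) ?_
      fun Z hZ => (hasFDerivAt_superpose hU h1 hZ).fderiv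
    exact (pointwiseApply K E F).contDiff.comp_contDiffOn (ih hh.2.2)

theorem contDiffOn_superpose {K : Type*} [TopologicalSpace K] [CompactSpace K]
    {E F : Type} [NormedAddCommGroup E] [NormedSpace ℝ E] [NormedAddCommGroup F]
    [NormedSpace ℝ F] {U : Set E} (hU : IsOpen U) {h : E → F} (hh : ContDiffOn ℝ ∞ h U) :
    ContDiffOn ℝ ∞ (superpose K h) (mapsInto K U) :=
  contDiffOn_infty.2 fun n => contDiffOn_superpose_nat hU n (contDiffOn_infty.1 hh n)

/-! ### Volterra operators and linear differential equations on [0, 1] -/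

section Volterra

variable {E : Type*} [NormedAddCommGroup E] [NormedSpace ℝ E] [CompleteSpace E]

theorem hasDerivAt_integral_IccExtend (Y : C(I, E)) (t : ℝ) :
    HasDerivAt (fun t => ∫ τ in (0 : ℝ)..t, IccExtend zero_le_one Y τ)
      (IccExtend zero_le_one Y t) t :=
  (Y.continuous.Icc_extend' (h := zero_le_one)).integral_hasStrictDerivAt 0 t |>.hasDerivAt

/-- Integration from `0`, as an operator on `C([0, 1], E)`. -/
def volterra (E : Type*) [NormedAddCommGroup E] [NormedSpace ℝ E] [CompleteSpace E] :
    C(I, E) →L[ℝ] C(I, E) :=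
  LinearMap.mkContinuous
    { toFun := fun Y => ⟨fun t => ∫ τ in (0 : ℝ)..t, IccExtend zero_le_one Y τ,
        (continuous_iff_continuousAt.2
          fun t => (hasDerivAt_integral_IccExtend Y t).continuousAt).comp continuous_subtype_val⟩
      map_add' := fun Y Z => by
        ext t
        exact intervalIntegral.integral_add (f := IccExtend zero_le_one Y)
          (g := IccExtend zero_le_one Z) ((Y.continuous.Icc_extend' (h := zero_le_one)).intervalIntegrable _ _)
          ((Z.continuous.Icc_extend' (h := zero_le_one)).intervalIntegrable _ _)
      map_smul' := fun c Y => by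
        ext t
        exact intervalIntegral.integral_smul c _ }
    1 (by
      intro Y
      rw [one_mul]
      refine (ContinuousMap.norm_le _ (norm_nonneg _)).2 fun t => ?_
      refine (intervalIntegral.norm_integral_le_of_norm_le_const
        (C := ‖Y‖) fun τ _ => Y.norm_coe_le_norm _).trans ?_
      rw [sub_zero, abs_of_nonneg t.2.1]
      exact mul_le_of_le_one_right (norm_nonneg _) t.2.2)

theorem volterra_apply (Y : C(I, E)) (t : I) :
    volterra E Y t = ∫ τ in (0 : ℝ)..t, IccExtend zero_le_one Y τ := rfl

end Volterra

/-- The geometric sum factors 1 - xⁿ as (1 - x)(1 + x + ⋯ + xⁿ⁻¹), and commuting factors of a unit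
are units. -/
theorem isUnit_one_sub_of_norm_pow_lt_one {R : Type*} [NormedRing R] [HasSummableGeomSeries R]
    {x : R} {n : ℕ} (hx : ‖x ^ n‖ < 1) : IsUnit (1 - x) := by
  have hu : IsUnit (1 - x ^ n) := isUnit_one_sub_of_norm_lt_one hx
  rw [← mul_neg_geom_sum x n] at hu
  refine ((Commute.isUnit_mul_iff ?_).1 hu).1
  exact Commute.sum_right _ _ _ fun i _ =>
    (Commute.one_left _).sub_left ((Commute.refl x).pow_right i)

theorem contDiffOn_ringInverse {R : Type*} [NormedRing R] [NormedAlgebra ℝ R]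
    [HasSummableGeomSeries R] {X : Type*} [NormedAddCommGroup X] [NormedSpace ℝ X] {f : X → R}
    {s : Set X} (hf : ContDiffOn ℝ ∞ f s) (hu : ∀ x ∈ s, IsUnit (f x)) :
    ContDiffOn ℝ ∞ (fun x => Ring.inverse (f x)) s := by
  intro x hx
  obtain ⟨u, hu⟩ := hu x hx
  have := contDiffAt_ringInverse ℝ u (n := ∞)
  rw [hu] at this
  exact this.comp_contDiffWithinAt x (hf x hx)

section FixedPoint

variable {E : Type*} [NormedAddCommGroup E] [NormedSpace ℝ E] [CompleteSpace E]

/-- The operators whose powers are dominated by the exponential series. -/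
def IsVolterraOp (T : E →L[ℝ] E) : Prop :=
  ∃ c : ℝ, 0 ≤ c ∧ ∀ (n : ℕ) (Y : E), ‖(T ^ n) Y‖ ≤ c ^ n / n.factorial * ‖Y‖

/-- Since cⁿ/n! tends to 0, some power of T has norm below 1; T itself need not be small. -/
theorem IsVolterraOp.isUnit {T : E →L[ℝ] E} (hT : IsVolterraOp T) : IsUnit (1 - T) := by
  obtain ⟨c, hc, h⟩ := hT
  obtain ⟨n, hn⟩ := (((FloorSemiring.tendsto_pow_div_factorial_atTop c).eventually
    (gt_mem_nhds one_pos))).exists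
  exact isUnit_one_sub_of_norm_pow_lt_one
    ((ContinuousLinearMap.opNorm_le_bound _ (by positivity) (h n)).trans_lt hn)

/-- The solution `Y` of `Y = v + T Y`. -/
def solveFixed (T : E →L[ℝ] E) (v : E) : E := Ring.inverse (1 - T) v

theorem eq_solveFixed_iff {T : E →L[ℝ] E} (hT : IsVolterraOp T) {v Y : E} :
    Y = solveFixed T v ↔ Y = v + T Y := by
  have hu := hT.isUnit
  constructor
  · rintro rfl
    have := congrArg (fun T : E →L[ℝ] E => T v) (Ring.mul_inverse_cancel _ hu)
    simp only [mul_apply_eq_comp, one_apply_eq_self, sub_apply] at this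
    exact sub_eq_iff_eq_add.1 this
  · intro h
    have h1 : (1 - T) Y = v := by
      simp only [sub_apply, one_apply_eq_self]
      exact sub_eq_iff_eq_add.2 h
    rw [solveFixed, ← h1, ← mul_apply_eq_comp, Ring.inverse_mul_cancel _ hu, one_apply_eq_self]

/-- Inversion in a Banach algebra is smooth at units and the operator depends linearly on x. This is
how linear equations get smooth dependence on their coefficients without differentiating the
equation. -/
theorem contDiff_solveFixed {X : Type*} [NormedAddCommGroup X] [NormedSpace ℝ X]
    (f : X →L[ℝ] E →L[ℝ] E) (hf : ∀ x, IsVolterraOp (f x)) (v : E) :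
    ContDiff ℝ ∞ (fun x => solveFixed (f x) v) := by
  have h := contDiffOn_ringInverse (s := univ)
    (contDiff_const (c := (1 : E →L[ℝ] E)).sub f.contDiff).contDiffOn fun x _ => (hf x).isUnit
  exact (contDiffOn_univ.1 h).clm_apply contDiff_const

end FixedPoint

section LinearODE

variable {𝔸 : Type*} [NormedRing 𝔸] [NormedAlgebra ℝ 𝔸] [CompleteSpace 𝔸]

/-- The operator `Y ↦ ∫ a Y`. -/
def volterraMul (𝔸 : Type*) [NormedRing 𝔸] [NormedAlgebra ℝ 𝔸] [CompleteSpace 𝔸] :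
    C(I, 𝔸) →L[ℝ] C(I, 𝔸) →L[ℝ] C(I, 𝔸) :=
  (ContinuousLinearMap.compL ℝ C(I, 𝔸) C(I, 𝔸) C(I, 𝔸) (volterra 𝔸)).comp
    (ContinuousLinearMap.mul ℝ C(I, 𝔸))

theorem volterraMul_apply (a Y : C(I, 𝔸)) : volterraMul 𝔸 a Y = volterra 𝔸 (a * Y) := rfl

/-- The bound is kept pointwise in t: integrating tⁿ supplies the factor 1/(n + 1) that builds the
factorial, which the sup norm alone would lose. -/
theorem norm_volterraMul_pow_apply_le (a Y : C(I, 𝔸)) (n : ℕ) (t : I) :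
    ‖(volterraMul 𝔸 a ^ n) Y t‖ ≤ (‖a‖ * t) ^ n / n.factorial * ‖Y‖ := by
  induction n generalizing t with
  | zero => simpa using Y.norm_coe_le_norm t
  | succ n ih =>
    rw [pow_succ', mul_apply_eq_comp, volterraMul_apply, volterra_apply]
    have hb : ∀ τ ∈ Ioc (0 : ℝ) t, ‖IccExtend zero_le_one (a * (volterraMul 𝔸 a ^ n) Y) τ‖ ≤
        ‖a‖ * ((‖a‖ * τ) ^ n / n.factorial * ‖Y‖) := by
      intro τ hτ
      have hτ' : τ ∈ Icc (0 : ℝ) 1 := ⟨hτ.1.le, hτ.2.trans t.2.2⟩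
      rw [IccExtend_of_mem _ _ hτ', ContinuousMap.mul_apply]
      exact (norm_mul_le _ _).trans (mul_le_mul (a.norm_coe_le_norm _) (ih ⟨τ, hτ'⟩)
        (norm_nonneg _) (norm_nonneg _))
    refine (intervalIntegral.norm_integral_le_of_norm_le t.2.1
      (Eventually.of_forall hb) (Continuous.intervalIntegrable (by fun_prop) _ _)).trans ?_
    have : ∀ τ : ℝ, ‖a‖ * ((‖a‖ * τ) ^ n / n.factorial * ‖Y‖) =
        (‖a‖ ^ (n + 1) / n.factorial * ‖Y‖) * τ ^ n := by intro τ; ring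
    simp only [this, intervalIntegral.integral_const_mul, integral_pow]
    apply le_of_eq
    rw [Nat.factorial_succ]
    push_cast
    have : (n.factorial : ℝ) ≠ 0 := by positivity
    field_simp
    ring

theorem isVolterraOp_volterraMul (a : C(I, 𝔸)) : IsVolterraOp (volterraMul 𝔸 a) := by
  refine ⟨‖a‖, norm_nonneg a, fun n Y => (ContinuousMap.norm_le _ (by positivity)).2 fun t => ?_⟩
  refine (norm_volterraMul_pow_apply_le a Y n t).trans ?_
  have : ‖a‖ * t ≤ ‖a‖ := mul_le_of_le_one_right (norm_nonneg a) t.2.2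
  have : 0 ≤ ‖a‖ * t := mul_nonneg (norm_nonneg a) t.2.1
  gcongr

/-- The fundamental solution `Y` of the linear equation `Y' = a Y`, `Y 0 = 1`, on `[0, 1]`. -/
def evolution (a : C(I, 𝔸)) : C(I, 𝔸) := solveFixed (volterraMul 𝔸 a) 1

theorem eq_evolution_iff {a Y : C(I, 𝔸)} :
    Y = evolution a ↔ Y = 1 + volterra 𝔸 (a * Y) :=
  eq_solveFixed_iff (isVolterraOp_volterraMul a)

theorem contDiff_evolution : ContDiff ℝ ∞ (evolution : C(I, 𝔸) → C(I, 𝔸)) :=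
  contDiff_solveFixed (volterraMul 𝔸) isVolterraOp_volterraMul 1

end LinearODE

/-! ### Local inversion and unique continuation -/

/-- The inverse function theorem for maps that are smooth near a point. -/
theorem exists_smooth_local_inverse {E F : Type*} [NormedAddCommGroup E] [NormedSpace ℝ E]
    [CompleteSpace E] [NormedAddCommGroup F] [NormedSpace ℝ F] {f : E → F} {U : Set E}
    (hU : IsOpen U) (hf : ContDiffOn ℝ ∞ f U) {a : E} (ha : a ∈ U) {f' : E ≃L[ℝ] F}
    (hf' : HasFDerivAt f (f' : E →L[ℝ] F) a) :
    ∃ Θ : OpenPartialHomeomorph E F, a ∈ Θ.source ∧ Θ.source ⊆ U ∧ ⇑Θ = f ∧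
      ContDiffOn ℝ ∞ Θ.symm Θ.target := by
  have hfa : ContDiffAt ℝ ∞ f a := hf.contDiffAt (hU.mem_nhds ha)
  set Θ₀ := hfa.toOpenPartialHomeomorph f hf' (by simp) with hΘ₀
  have hcoe : (Θ₀ : E → F) = f := rfl
  have hd : ContinuousOn (fderiv ℝ f) U := hf.continuousOn_fderiv_of_isOpen hU (by simp)
  -- Invertibility of the derivative is an open condition. Shrinking the source to where it holds
  -- makes the inverse smooth on the whole target, not only at the image of a.
  have hinv : ∀ᶠ x in 𝓝 a, ∃ g : E ≃L[ℝ] F, (g : E →L[ℝ] F) = fderiv ℝ f x := by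
    have := hd.continuousAt (hU.mem_nhds ha)
    rw [ContinuousAt, hf'.fderiv] at this
    exact this.eventually (ContinuousLinearEquiv.nhds f')
  obtain ⟨V, hVsub, hV, haV⟩ := eventually_nhds_iff.1 (hinv.and (hU.mem_nhds ha))
  refine ⟨Θ₀.restrOpen V hV, ?_, ?_, rfl, ?_⟩
  · exact ⟨hfa.mem_toOpenPartialHomeomorph_source hf' (by simp), haV⟩
  · exact fun x hx => (hVsub x hx.2).2
  · intro y hy
    set x := (Θ₀.restrOpen V hV).symm y
    have hx : x ∈ (Θ₀.restrOpen V hV).source := (Θ₀.restrOpen V hV).map_target hy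
    have hxV : x ∈ V := hx.2
    obtain ⟨g, hg⟩ := (hVsub x hxV).1
    have hcx : ContDiffAt ℝ ∞ f x := hf.contDiffAt (hU.mem_nhds (hVsub x hxV).2)
    refine (OpenPartialHomeomorph.contDiffAt_symm (f₀' := g) _ hy ?_ hcx).contDiffWithinAt
    rw [hg]
    exact (hcx.differentiableAt (by simp)).hasFDerivAt

/-- A solution of a linear differential inequality on a connected open set that vanishes at
one point vanishes. -/
theorem eq_zero_of_norm_fderiv_le {W E : Type*} [NormedAddCommGroup W] [NormedSpace ℝ W]
    [NormedAddCommGroup E] [NormedSpace ℝ E] {D : Set W} (hD : IsOpen D)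
    (hDc : IsPreconnected D) {k : W → E} (hk : DifferentiableOn ℝ k D)
    (hb : ∀ x ∈ D, ∃ C : ℝ, ∀ᶠ y in 𝓝 x, ‖fderiv ℝ k y‖ ≤ C * ‖k y‖)
    {x₀ : W} (hx₀ : x₀ ∈ D) (h0 : k x₀ = 0) : ∀ x ∈ D, k x = 0 := by
  -- S collects the points near which k vanishes identically. It is open by definition; `key` shows
  -- that every zero of k in D lies in S, so S is also closed in D by continuity of k.
  set S : Set W := {x | k =ᶠ[𝓝 x] 0}
  have hS : IsOpen S := isOpen_setOfPred_eventually_nhds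
  have key : ∀ x ∈ D, k x = 0 → x ∈ S := by
    intro x hx hkx
    obtain ⟨C, hC⟩ := hb x hx
    obtain ⟨r, hr, hball⟩ := Metric.eventually_nhds_iff_ball.1 (hC.and (hD.mem_nhds hx))
    refine Metric.eventually_nhds_iff_ball.2 ⟨r, hr, fun y hy => ?_⟩
    have hseg : ∀ t ∈ Icc (0 : ℝ) 1, x + t • (y - x) ∈ Metric.ball x r := by
      intro t ht
      rw [mem_ball_iff_norm] at hy ⊢
      rw [add_sub_cancel_left, norm_smul, Real.norm_of_nonneg ht.1]
      exact (mul_le_of_le_one_left (norm_nonneg _) ht.2).trans_lt hy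
    -- Grönwall's inequality along the segment from x to y, which stays in a ball where one constant
    -- C works.
    have hder : ∀ t ∈ Icc (0 : ℝ) 1, HasDerivAt (fun t : ℝ => k (x + t • (y - x)))
        (fderiv ℝ k (x + t • (y - x)) (y - x)) t := by
      intro t ht
      have h1 := (hk.differentiableAt (hD.mem_nhds (hball _ (hseg t ht)).2)).hasFDerivAt
      have h2 : HasDerivAt (fun t : ℝ => x + t • (y - x)) (y - x) t := by
        simpa using ((hasDerivAt_id t).smul_const (y - x)).const_add x
      exact h1.comp_hasDerivAt t h2
    have := eq_zero_of_abs_deriv_le_mul_abs_self_of_eq_zero_right (a := 0) (b := 1)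
      (f := fun t : ℝ => k (x + t • (y - x))) (K := C * ‖y - x‖)
      (fun t ht => (hder t ht).continuousAt.continuousWithinAt)
      (fun t ht => (hder t ⟨ht.1, ht.2.le⟩).hasDerivWithinAt) (by simpa using hkx)
      (fun t ht => by
        refine (ContinuousLinearMap.le_opNorm _ _).trans ?_
        have := (hball _ (hseg t ⟨ht.1, ht.2.le⟩)).1
        calc _ ≤ C * ‖k (x + t • (y - x))‖ * ‖y - x‖ := by gcongr
          _ = _ := by ring)
      1 ⟨zero_le_one, le_rfl⟩
    simpa using this
  have hsub : D ⊆ S := by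
    refine hDc.subset_of_closure_inter_subset hS ⟨x₀, hx₀, key x₀ hx₀ h0⟩ ?_
    rintro x ⟨hxc, hxD⟩
    refine key x hxD ?_
    have hcl : ∃ᶠ y in 𝓝 x, k y = 0 :=
      (mem_closure_iff_frequently.1 hxc).mono fun y hy => hy.self_of_nhds
    have hcont := (hk.differentiableAt (hD.mem_nhds hxD)).continuousAt
    by_contra hne
    exact hcl ((hcont.eventually_ne hne).mono fun y hy => hy)
  exact fun x hx => (hsub hx).self_of_nhds

/-! ### Flat linear systems on balls, solved along rays -/

/-- The embedding of constant maps. -/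
def constMap (E : Type*) [NormedAddCommGroup E] [NormedSpace ℝ E] : E →L[ℝ] C(I, E) :=
  LinearMap.mkContinuous ⟨⟨fun x => ContinuousMap.const I x, fun _ _ => rfl⟩, fun _ _ => rfl⟩ 1
    fun x => by
      rw [one_mul]
      exact (ContinuousMap.norm_le _ (norm_nonneg x)).2 fun _ => le_rfl

@[simp] theorem constMap_apply {E : Type*} [NormedAddCommGroup E] [NormedSpace ℝ E] (x : E)
    (t : I) : constMap E x t = x := rfl

/-- The family of evaluations `x ↦ (t ↦ T t x)`. -/
def evalFamily {E F : Type*} [NormedAddCommGroup E] [NormedSpace ℝ E] [NormedAddCommGroup F]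
    [NormedSpace ℝ F] (T : C(I, E →L[ℝ] F)) : E →L[ℝ] C(I, F) :=
  (pointwiseApply I E F T).comp (constMap E)

@[simp] theorem evalFamily_apply {E F : Type*} [NormedAddCommGroup E] [NormedSpace ℝ E]
    [NormedAddCommGroup F] [NormedSpace ℝ F] (T : C(I, E →L[ℝ] F)) (x : E) (t : I) :
    evalFamily T x t = T t x := rfl

theorem hasDerivAt_comp_smul {W G : Type*} [NormedAddCommGroup W] [NormedSpace ℝ W]
    [NormedAddCommGroup G] [NormedSpace ℝ G] {f : W → G} {f' : W →L[ℝ] G} {x : W} {t : ℝ}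
    (hf : HasFDerivAt f f' (t • x)) : HasDerivAt (fun t : ℝ => f (t • x)) (f' x) t := by
  have : HasDerivAt (fun t : ℝ => t • x) x t := by simpa using (hasDerivAt_id t).smul_const x
  exact hf.comp_hasDerivAt t this

theorem hasDerivAt_clm_comp_smul {W G : Type*} [NormedAddCommGroup W] [NormedSpace ℝ W]
    [NormedAddCommGroup G] [NormedSpace ℝ G] {A : W → W →L[ℝ] G} {A' : W →L[ℝ] W →L[ℝ] G}
    {x : W} (h : W) {t : ℝ} (hA : HasFDerivAt A A' (t • x)) :
    HasDerivAt (fun t : ℝ => A (t • x) (t • h)) (A' x (t • h) + A (t • x) h) t := by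
  have : HasDerivAt (fun t : ℝ => t • h) h t := by simpa using (hasDerivAt_id t).smul_const h
  exact (hasDerivAt_comp_smul hA).clm_apply this

theorem contDiffOn_eval {X G : Type*} [NormedAddCommGroup X] [NormedSpace ℝ X]
    [NormedAddCommGroup G] [NormedSpace ℝ G] {f : X → C(I, G)} {s : Set X}
    (hf : ContDiffOn ℝ ∞ f s) (t : I) : ContDiffOn ℝ ∞ (fun x => f x t) s :=
  (ContinuousMap.evalCLM (M := G) ℝ t).contDiff.comp_contDiffOn hf

section Radial

variable {W Λ 𝔸 : Type} [NormedAddCommGroup W] [NormedSpace ℝ W] [NormedAddCommGroup Λ]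
  [NormedSpace ℝ Λ] [NormedRing 𝔸] [NormedAlgebra ℝ 𝔸] [CompleteSpace 𝔸]

/-- The integrability condition of the linear total differential equation `dF = A F`. -/
def IsFlatOn (A : W → W →L[ℝ] 𝔸) (D : Set W) : Prop :=
  ∀ x ∈ D, ∀ h k, fderiv ℝ A x h k + A x k * A x h = fderiv ℝ A x k h + A x h * A x k

/-- The algebra behind `fderiv_eq_of_radial`. At the point tx the letters stand for a = A x, b = A
h, α = dA(h) x, β = dA(x) h, p = dF x, q = dF h, c = d²F(h) x, d = d²F(x) h. The hypotheses are the
radial equation differentiated in the direction h, the symmetry of d²F, flatness, and the radial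
equation itself. -/
theorem radial_derivative_identity {R : Type*} [Ring R] [Algebra ℝ R] (t : ℝ)
    {F a b α β p q c d : R} (e1 : t • c + q = (t • α + b) * F + (t • a) * q) (e2 : c = d)
    (e3 : t • α + (t • a) * b = t • β + b * (t • a)) (e4 : t • p = (t • a) * F) :
    t • d + q - ((t • β + b) * F + (t • b) * p) = a * (t • q - (t • b) * F) := by
  subst e2
  have e5 : (t • b) * p = b * (t • p) := by simp
  have e6 := congrArg (· * F) e3
  rw [e5, e4, e1]
  simp only [add_mul, mul_sub, smul_mul_assoc, mul_smul_comm, mul_assoc] at e6 ⊢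
  linear_combination (norm := module) e6

omit [CompleteSpace 𝔸] in
/-- A smooth function that satisfies a flat linear system in the radial direction satisfies it
in all directions. -/
theorem fderiv_eq_of_radial {A : W → W →L[ℝ] 𝔸} {F : W → 𝔸} {B : Set W} (hB : IsOpen B)
    (hstar : ∀ x ∈ B, ∀ t ∈ Icc (0 : ℝ) 1, t • x ∈ B) (hA : ContDiffOn ℝ ∞ A B)
    (hF : ContDiffOn ℝ ∞ F B) (hrad : ∀ x ∈ B, fderiv ℝ F x x = A x x * F x)
    (hflat : IsFlatOn A B) : ∀ x ∈ B, ∀ h, fderiv ℝ F x h = A x h * F x := by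
  intro x hx h
  have hdA : ∀ y ∈ B, HasFDerivAt A (fderiv ℝ A y) y := fun y hy =>
    ((hA.contDiffAt (hB.mem_nhds hy)).differentiableAt (by simp)).hasFDerivAt
  have hdF : ∀ y ∈ B, HasFDerivAt F (fderiv ℝ F y) y := fun y hy =>
    ((hF.contDiffAt (hB.mem_nhds hy)).differentiableAt (by simp)).hasFDerivAt
  have hF' : ContDiffOn ℝ ∞ (fderiv ℝ F) B := hF.fderiv_of_isOpen hB (by simp)
  have hddF : ∀ y ∈ B, HasFDerivAt (fderiv ℝ F) (fderiv ℝ (fderiv ℝ F) y) y := fun y hy =>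
    ((hF'.contDiffAt (hB.mem_nhds hy)).differentiableAt (by simp)).hasFDerivAt
  have hsymm : ∀ y ∈ B, ∀ h k, fderiv ℝ (fderiv ℝ F) y h k = fderiv ℝ (fderiv ℝ F) y k h :=
    fun y hy h k => ((hF.contDiffAt (hB.mem_nhds hy)).isSymmSndFDerivAt (by simp; norm_cast)).eq h k
  have hrad' : ∀ y ∈ B, fderiv ℝ (fderiv ℝ F) y h y + fderiv ℝ F y h =
      (fderiv ℝ A y h y + A y h) * F y + A y y * fderiv ℝ F y h := by
    intro y hy
    have h1 := (hddF y hy).clm_apply (hasFDerivAt_id y)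
    have h2 := ((hdA y hy).clm_apply (hasFDerivAt_id y)).mul' (hdF y hy)
    have h3 := h1.unique (h2.congr_of_eventuallyEq
      (by filter_upwards [hB.mem_nhds hy] with z hz using hrad z hz))
    have := congrArg (fun T : W →L[ℝ] 𝔸 => T h) h3
    simp at this
    rw [add_comm, this, add_mul]; abel
  -- The defect δ(t) = dF(th) - A(th)F at the point tx solves δ' = A(tx)(x) δ, and the factor t
  -- makes it vanish at t = 0; hence it vanishes at t = 1.
  have hder : ∀ t ∈ Icc (0 : ℝ) 1, HasDerivAt
      (fun t : ℝ => fderiv ℝ F (t • x) (t • h) - A (t • x) (t • h) * F (t • x))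
      (A (t • x) x * (fderiv ℝ F (t • x) (t • h) - A (t • x) (t • h) * F (t • x))) t := by
    intro t ht
    have hy := hstar x hx t ht
    have h1 := hasDerivAt_clm_comp_smul h (hddF _ hy)
    have h2 := hasDerivAt_clm_comp_smul h (hdA _ hy)
    have h3 := hasDerivAt_comp_smul (hdF _ hy)
    refine (h1.fun_sub (h2.fun_mul h3)).congr_deriv ?_
    have e1 := hrad' _ hy
    have e3 := hflat _ hy h (t • x)
    have e4 := hrad _ hy
    simp only [map_smul, smul_apply] at e1 e3 e4
    simp only [map_smul]
    exact radial_derivative_identity t e1 (hsymm _ hy h x) e3 e4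
  have hcont : ContinuousOn (fun t : ℝ => A (t • x) x) (Icc 0 1) :=
    (hA.continuousOn.comp (by fun_prop) fun t ht => hstar x hx t ht).clm_apply continuousOn_const
  obtain ⟨C, hC⟩ := isCompact_Icc.exists_bound_of_continuousOn hcont
  have := eq_zero_of_abs_deriv_le_mul_abs_self_of_eq_zero_right (K := C)
    (fun t ht => (hder t ht).continuousAt.continuousWithinAt)
    (fun t ht => (hder t ⟨ht.1, ht.2.le⟩).hasDerivWithinAt) (by simp)
    (fun t ht => (norm_mul_le _ _).trans
      (mul_le_mul_of_nonneg_right (hC t ⟨ht.1, ht.2.le⟩) (norm_nonneg _))) 1 ⟨zero_le_one, le_rfl⟩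
  simpa [sub_eq_zero] using this

/-- The radial paths `t ↦ ((t x, l), x)`. -/
def radialPath (W Λ : Type) [NormedAddCommGroup W] [NormedSpace ℝ W] [NormedAddCommGroup Λ]
    [NormedSpace ℝ Λ] : W × Λ →L[ℝ] C(I, (W × Λ) × W) :=
  evalFamily ⟨fun t =>
    ((0 : W × Λ →L[ℝ] W).prod (ContinuousLinearMap.snd ℝ W Λ)).prod (ContinuousLinearMap.fst ℝ W Λ)
    + (t : ℝ) • ((ContinuousLinearMap.fst ℝ W Λ).prod (0 : W × Λ →L[ℝ] Λ)).prod
      (0 : W × Λ →L[ℝ] W), by fun_prop⟩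

omit [NormedRing 𝔸] [NormedAlgebra ℝ 𝔸] [CompleteSpace 𝔸] in
theorem radialPath_apply (p : W × Λ) (t : I) :
    radialPath W Λ p t = (((t : ℝ) • p.1, p.2), p.1) := by
  simp [radialPath]

/-- The solution of a linear system along the rays from the origin. -/
def radialSolution (A : W × Λ → W →L[ℝ] 𝔸) (p : W × Λ) : C(I, 𝔸) :=
  evolution (superpose I (fun q : (W × Λ) × W => A q.1 q.2) (radialPath W Λ p))

section

variable {A : W × Λ → W →L[ℝ] 𝔸} {B : Set W} {L : Set Λ}

theorem contDiffOn_radialSolution (hB : IsOpen B) (hL : IsOpen L)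
    (hstar : ∀ x ∈ B, ∀ t ∈ Icc (0 : ℝ) 1, t • x ∈ B) (hA : ContDiffOn ℝ ∞ A (B ×ˢ L)) :
    ContDiffOn ℝ ∞ (radialSolution A) (B ×ˢ L) := by
  have h : ContDiffOn ℝ ∞ (fun q : (W × Λ) × W => A q.1 q.2) ((B ×ˢ L) ×ˢ univ) :=
    (hA.comp contDiffOn_fst fun q hq => hq.1).clm_apply contDiffOn_snd
  have h2 := contDiffOn_superpose (K := I) ((hB.prod hL).prod isOpen_univ) h
  refine contDiff_evolution.comp_contDiffOn (h2.comp (radialPath W Λ).contDiff.contDiffOn ?_)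
  intro p hp t
  rw [radialPath_apply]
  exact ⟨⟨hstar _ hp.1 t t.2, hp.2⟩, mem_univ _⟩

omit [CompleteSpace 𝔸] in
theorem radialCoeff_apply (hstar : ∀ x ∈ B, ∀ t ∈ Icc (0 : ℝ) 1, t • x ∈ B)
    (hA : ContDiffOn ℝ ∞ A (B ×ˢ L)) {p : W × Λ} (hp : p ∈ B ×ˢ L) (t : I) :
    superpose I (fun q : (W × Λ) × W => A q.1 q.2) (radialPath W Λ p) t =
      A ((t : ℝ) • p.1, p.2) p.1 := by
  have h : ContinuousOn (fun q : (W × Λ) × W => A q.1 q.2) ((B ×ˢ L) ×ˢ univ) :=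
    (hA.continuousOn.comp continuousOn_fst fun q hq => hq.1).clm_apply continuousOn_snd
  rw [superpose_apply h, radialPath_apply]
  intro t
  rw [radialPath_apply]
  exact ⟨⟨hstar _ hp.1 t t.2, hp.2⟩, mem_univ _⟩

/-- The ray to sx is the initial piece of the ray to x, run at speed s. The rescaled solution
satisfies the integral equation of the shorter ray, so uniqueness identifies the two. -/
theorem radialSolution_smul (hstar : ∀ x ∈ B, ∀ t ∈ Icc (0 : ℝ) 1, t • x ∈ B)
    (hA : ContDiffOn ℝ ∞ A (B ×ˢ L)) {x : W} {l : Λ} (hx : x ∈ B) (hl : l ∈ L) (s : I) :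
    radialSolution A ((s : ℝ) • x, l) 1 = radialSolution A (x, l) s := by
  have hY := eq_evolution_iff.1 (rfl : radialSolution A (x, l) = _)
  set Y := radialSolution A (x, l)
  set a := superpose I (fun q : (W × Λ) × W => A q.1 q.2) (radialPath W Λ (x, l))
  let scale : C(I, I) := ⟨fun t => s * t, by fun_prop⟩
  have hscale : Y.comp scale = radialSolution A ((s : ℝ) • x, l) := by
    refine eq_evolution_iff.2 ?_
    ext t
    have h1 := DFunLike.congr_fun hY (s * t)
    simp only [ContinuousMap.add_apply, ContinuousMap.one_apply, volterra_apply] at h1 ⊢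
    refine Eq.trans h1 (congrArg (1 + ·) ?_)
    rw [show ((s * t : I) : ℝ) = (s : ℝ) * t from rfl]
    have h2 := intervalIntegral.smul_integral_comp_mul_left (a := 0) (b := t)
      (fun τ => IccExtend zero_le_one (a * Y) τ) (s : ℝ)
    rw [mul_zero] at h2
    rw [← h2, ← intervalIntegral.integral_smul]
    refine intervalIntegral.integral_congr fun τ hτ => ?_
    rw [uIcc_of_le t.2.1] at hτ
    have hτ' : τ ∈ Icc (0 : ℝ) 1 := ⟨hτ.1, hτ.2.trans t.2.2⟩
    have hsτ : (s : ℝ) * τ ∈ Icc (0 : ℝ) 1 :=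
      ⟨mul_nonneg s.2.1 hτ.1, mul_le_one₀ s.2.2 hτ'.1 hτ'.2⟩
    simp only [IccExtend_of_mem _ _ hτ', IccExtend_of_mem _ _ hsτ, ContinuousMap.mul_apply]
    rw [radialCoeff_apply hstar hA (p := (x, l)) ⟨hx, hl⟩,
      radialCoeff_apply hstar hA (p := ((s : ℝ) • x, l)) ⟨hstar x hx s s.2, hl⟩]
    simp only [map_smul, smul_mul_assoc, smul_smul, mul_comm τ]
    rfl
  rw [← hscale]
  change Y (s * 1) = Y s
  rw [mul_one]

theorem fderiv_radialSolution (hB : IsOpen B) (hL : IsOpen L)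
    (hstar : ∀ x ∈ B, ∀ t ∈ Icc (0 : ℝ) 1, t • x ∈ B) (hA : ContDiffOn ℝ ∞ A (B ×ˢ L))
    {x : W} {l : Λ} (hx : x ∈ B) (hl : l ∈ L) :
    fderiv ℝ (fun x => radialSolution A (x, l) 1) x x = A (x, l) x * radialSolution A (x, l) 1 := by
  have hsm : ContDiffOn ℝ ∞ (fun x => radialSolution A (x, l) 1) B :=
    contDiffOn_eval (G := 𝔸) (f := fun x => radialSolution A (x, l))
      ((contDiffOn_radialSolution hB hL hstar hA).comp (by fun_prop) fun x hx => ⟨hx, hl⟩) 1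
  have h1 : HasDerivAt (fun t : ℝ => radialSolution A (t • x, l) 1)
      (fderiv ℝ (fun x => radialSolution A (x, l) 1) x x) 1 := by
    refine hasDerivAt_comp_smul (f := fun x => radialSolution A (x, l) 1) ?_
    rw [one_smul]
    exact ((hsm.contDiffAt (hB.mem_nhds hx)).differentiableAt (by simp)).hasFDerivAt
  have hY := eq_evolution_iff.1 (rfl : radialSolution A (x, l) = _)
  set Y := radialSolution A (x, l) with hYdef
  set a := superpose I (fun q : (W × Λ) × W => A q.1 q.2) (radialPath W Λ (x, l))
  have h2 := ((hasDerivAt_integral_IccExtend (a * Y) 1).const_add (1 : 𝔸)).hasDerivWithinAt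
    (s := Icc (0 : ℝ) 1)
  -- The path solution is available only for t ≤ 1, so the derivatives at the endpoint 1 are
  -- compared within [0, 1].
  have h3 : HasDerivWithinAt (fun t : ℝ => radialSolution A (t • x, l) 1)
      (IccExtend zero_le_one (a * Y) 1) (Icc 0 1) 1 := by
    refine h2.congr_of_mem (fun t ht => ?_) ⟨zero_le_one, le_rfl⟩
    rw [radialSolution_smul hstar hA hx hl ⟨t, ht⟩]
    exact DFunLike.congr_fun hY ⟨t, ht⟩
  have hu : UniqueDiffWithinAt ℝ (Icc (0 : ℝ) 1) 1 :=
    uniqueDiffOn_Icc zero_lt_one 1 ⟨zero_le_one, le_rfl⟩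
  have h4 := (h1.hasDerivWithinAt.derivWithin hu).symm.trans (h3.derivWithin hu)
  rw [h4, IccExtend_right, ContinuousMap.mul_apply]
  rw [radialCoeff_apply hstar hA (p := (x, l)) ⟨hx, hl⟩]
  simp [Y]

theorem radialSolution_zero (hstar : ∀ x ∈ B, ∀ t ∈ Icc (0 : ℝ) 1, t • x ∈ B)
    (hA : ContDiffOn ℝ ∞ A (B ×ˢ L)) {l : Λ} (h0 : (0 : W) ∈ B) (hl : l ∈ L) :
    radialSolution A (0, l) = 1 := by
  have h : superpose I (fun q : (W × Λ) × W => A q.1 q.2) (radialPath W Λ (0, l)) = 0 := by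
    ext t
    rw [radialCoeff_apply hstar hA (p := (0, l)) ⟨h0, hl⟩]
    simp
  rw [radialSolution, h]
  exact (eq_evolution_iff.2 (by simp)).symm

end

/-- Local existence of fundamental solutions of flat linear systems, smooth in a parameter. -/
theorem exists_fundamental_ball {A : W × Λ → W →L[ℝ] 𝔸} {c : W} {r : ℝ} (hr : 0 < r)
    {L : Set Λ} (hL : IsOpen L) (hA : ContDiffOn ℝ ∞ A (Metric.ball c r ×ˢ L))
    (hflat : ∀ l ∈ L, IsFlatOn (fun x => A (x, l)) (Metric.ball c r)) :
    ∃ F : W × Λ → 𝔸, ContDiffOn ℝ ∞ F (Metric.ball c r ×ˢ L) ∧ (∀ l ∈ L, F (c, l) = 1) ∧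
      ∀ x ∈ Metric.ball c r, ∀ l ∈ L, ∀ h,
        fderiv ℝ (fun x => F (x, l)) x h = A (x, l) h * F (x, l) := by
  set B := Metric.ball (0 : W) r
  have hB : IsOpen B := Metric.isOpen_ball
  have hstar : ∀ x ∈ B, ∀ t ∈ Icc (0 : ℝ) 1, t • x ∈ B := fun x hx t ht =>
    (convex_ball (0 : W) r).starConvex (Metric.mem_ball_self hr) |>.smul_mem hx ht.1 ht.2
  have hmem : ∀ x ∈ B, x + c ∈ Metric.ball c r := fun x hx => by
    simpa [B] using hx
  have hmem' : ∀ x ∈ Metric.ball c r, x - c ∈ B := fun x hx => by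
    simpa [B, dist_eq_norm] using hx
  have hA' : ContDiffOn ℝ ∞ (fun p : W × Λ => A (p.1 + c, p.2)) (B ×ˢ L) :=
    hA.comp (by fun_prop) fun p hp => ⟨hmem _ hp.1, hp.2⟩
  have hflat' : ∀ l ∈ L, IsFlatOn (fun x => A (x + c, l)) B := by
    intro l hl x hx h k
    have := hflat l hl _ (hmem x hx) h k
    rw [← fderiv_comp_add_right c] at this
    exact this
  have hsm := contDiffOn_radialSolution hB hL hstar hA'
  have hsm1 : ContDiffOn ℝ ∞ (fun p => radialSolution (fun p : W × Λ => A (p.1 + c, p.2)) p 1)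
      (B ×ˢ L) := contDiffOn_eval hsm 1
  refine ⟨fun p => radialSolution (fun p : W × Λ => A (p.1 + c, p.2)) (p.1 - c, p.2) 1,
    hsm1.comp (by fun_prop) fun p hp => ⟨hmem' _ hp.1, hp.2⟩, fun l hl => ?_,
    fun x hx l hl h => ?_⟩
  · simp only [sub_self]
    rw [radialSolution_zero hstar hA' (Metric.mem_ball_self hr) hl, ContinuousMap.one_apply]
  · have := fderiv_eq_of_radial hB hstar
      (hA'.comp (by fun_prop : ContDiffOn ℝ ∞ (fun x : W => (x, l)) B) fun x hx => ⟨hx, hl⟩)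
      (hsm1.comp (by fun_prop : ContDiffOn ℝ ∞ (fun x : W => (x, l)) B) fun x hx => ⟨hx, hl⟩)
      (fun x hx => fderiv_radialSolution hB hL hstar hA' hx hl) (hflat' l hl) _ (hmem' x hx) h
    simp only [Function.comp_def, sub_add_cancel] at this
    rw [← this]
    exact congrArg (· h) (fderiv_comp_sub (𝕜 := ℝ)
      (f := fun x => radialSolution (fun p : W × Λ => A (p.1 + c, p.2)) (x, l) 1) c)

end Radial

/-! ### Gluing local solutions over a simply connected domain -/

/-- A locally constant cocycle on a simply connected space has a global section. -/
theorem exists_section_of_cocycle {X G : Type*} [TopologicalSpace X] [SimplyConnectedSpace X]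
    [LocallyPathConnectedSpace X] {B : X → Set X} (hB : ∀ i, IsOpen (B i)) (hmem : ∀ i, i ∈ B i)
    {T : X → X → X → G → G} (hself : ∀ i, ∀ x ∈ B i, ∀ g, T i i x g = g)
    (hcomp : ∀ i j k, ∀ x ∈ B i ∩ B j ∩ B k, ∀ g, T j k x (T i j x g) = T i k x g)
    (hloc : ∀ i j, ∀ x ∈ B i ∩ B j, ∀ᶠ y in 𝓝 x, T i j y = T i j x) (x₀ : X) (g₀ : G) :
    ∃ sec : X → X → G, sec x₀ x₀ = g₀ ∧ (∀ i, ∀ x ∈ B i, ∀ᶠ y in 𝓝 x, sec i y = sec i x) ∧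
      ∀ i j, ∀ x ∈ B i ∩ B j, T i j x (sec i x) = sec j x := by
  -- With the discrete topology on G, local constancy of the cocycle is continuity of the coordinate
  -- changes, and the resulting fibre bundle is a covering. Over a simply connected base the
  -- identity lifts to it, which is a global section.
  let _ : TopologicalSpace G := ⊥
  have : DiscreteTopology G := ⟨rfl⟩
  let Z : FiberBundleCore X X G :=
    { baseSet := B
      isOpen_baseSet := hB
      indexAt := id
      mem_baseSet_at := hmem
      coordChange := T
      coordChange_self := hself
      continuousOn_coordChange := fun i j => by
        rintro ⟨x, g⟩ ⟨hx, -⟩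
        refine ContinuousAt.continuousWithinAt ?_
        have h1 : ∀ᶠ p : X × G in 𝓝 (x, g), T i j p.1 = T i j x ∧ p.2 = g := by
          rw [nhds_prod_eq, nhds_discrete G, prod_pure, eventually_map]
          filter_upwards [hloc i j x hx] with y hy using ⟨hy, rfl⟩
        refine (continuousAt_const (y := T i j x g)).congr ?_
        filter_upwards [h1] with p hp
        rw [hp.1, hp.2]
      coordChange_comp := hcomp }
  have hcov : IsCoveringMap (Bundle.TotalSpace.proj : Bundle.TotalSpace G Z.Fiber → X) :=
    FiberBundle.isCoveringMap
  obtain ⟨s, ⟨hs0, hs⟩, -⟩ := hcov.existsUnique_continuousMap_lifts (ContinuousMap.id X) x₀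
    ⟨x₀, g₀⟩ rfl
  have hs' : ∀ x, (s x).proj = x := fun x => congrFun hs x
  have hloctriv : ∀ i x, (Z.localTriv i (s x)).2 = T x i x (s x).2 := by
    intro i x
    rw [Z.localTriv_apply]
    change T (s x).proj i (s x).proj (s x).2 = _
    rw [hs']
  refine ⟨fun i x => (Z.localTriv i (s x)).2, ?_, fun i x hx => ?_, fun i j x hx => ?_⟩
  · change (Z.localTriv x₀ (s x₀)).2 = g₀
    rw [hs0, Z.localTriv_apply]
    exact hself x₀ x₀ (hmem x₀) g₀
  · have hsrc : s x ∈ (Z.localTriv i).source := by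
      rw [Z.mem_localTriv_source, ← Z.baseSet_at, hs']
      exact hx
    have h1 : ContinuousAt (fun y => (Z.localTriv i (s y)).2) x :=
      continuousAt_snd.comp (((Z.localTriv i).toOpenPartialHomeomorph.continuousAt hsrc).comp
        s.continuous.continuousAt)
    have h2 := h1.tendsto
    rw [nhds_discrete G, tendsto_pure] at h2
    exact h2
  · simp only [hloctriv]
    exact hcomp x i j x ⟨⟨hmem x, hx.1⟩, hx.2⟩ _

section LinearSystem

variable {W Λ E : Type} [NormedAddCommGroup W] [NormedSpace ℝ W] [NormedAddCommGroup Λ]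
  [NormedSpace ℝ Λ] [NormedAddCommGroup E] [NormedSpace ℝ E]

theorem eq_zero_of_linear_system {A : W → W →L[ℝ] E →L[ℝ] E} {D : Set W} (hD : IsOpen D)
    (hDc : IsPreconnected D) (hA : ContinuousOn A D) {k : W → E} (hk : DifferentiableOn ℝ k D)
    (hk' : ∀ x ∈ D, ∀ h, fderiv ℝ k x h = A x h (k x)) {x₀ : W} (hx₀ : x₀ ∈ D)
    (h0 : k x₀ = 0) : ∀ x ∈ D, k x = 0 := by
  refine eq_zero_of_norm_fderiv_le hD hDc hk (fun x hx => ⟨‖A x‖ + 1, ?_⟩) hx₀ h0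
  have hAn : ContinuousOn (fun x => ‖A x‖) D :=
    (continuous_norm (E := W →L[ℝ] E →L[ℝ] E)).comp_continuousOn hA
  have h1 : ∀ᶠ y in 𝓝 x, ‖A y‖ ≤ ‖A x‖ + 1 :=
    (hAn.continuousAt (hD.mem_nhds hx)).eventually_le_const (lt_add_one _)
  filter_upwards [h1, hD.mem_nhds hx] with y hy hyD
  refine ContinuousLinearMap.opNorm_le_bound _ (by positivity) fun h => ?_
  rw [hk' y hyD]
  calc ‖A y h (k y)‖ ≤ ‖A y‖ * ‖h‖ * ‖k y‖ := (A y).le_opNorm₂ h (k y)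
    _ ≤ (‖A x‖ + 1) * ‖h‖ * ‖k y‖ := by gcongr
    _ = _ := by ring

theorem eqOn_of_linear_system {A : W → W →L[ℝ] E →L[ℝ] E} {D : Set W} (hD : IsOpen D)
    (hDc : IsPreconnected D) (hA : ContinuousOn A D) {k m : W → E} (hk : DifferentiableOn ℝ k D)
    (hk' : ∀ x ∈ D, ∀ h, fderiv ℝ k x h = A x h (k x)) (hm : DifferentiableOn ℝ m D)
    (hm' : ∀ x ∈ D, ∀ h, fderiv ℝ m x h = A x h (m x)) {x₀ : W} (hx₀ : x₀ ∈ D)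
    (h0 : k x₀ = m x₀) : ∀ x ∈ D, k x = m x := by
  intro x hx
  refine sub_eq_zero.1 (eq_zero_of_linear_system hD hDc hA (hk.fun_sub hm) (fun y hy h => ?_) hx₀
    (sub_eq_zero.2 h0) x hx)
  rw [fderiv_fun_sub (hk.differentiableAt (hD.mem_nhds hy))
    (hm.differentiableAt (hD.mem_nhds hy)), sub_apply, hk' y hy, hm' y hy, map_sub]

/-- If F x kills v, then the solution F · v vanishes at x, hence everywhere by uniqueness, and its
value at c is v. Finite dimension upgrades injectivity to invertibility. -/
theorem isUnit_fundamental [FiniteDimensional ℝ E] {A : W → W →L[ℝ] E →L[ℝ] E} {D : Set W}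
    (hD : IsOpen D) (hDc : IsPreconnected D) (hA : ContinuousOn A D) {F : W → E →L[ℝ] E}
    (hF : DifferentiableOn ℝ F D) (hF' : ∀ x ∈ D, ∀ h, fderiv ℝ F x h = A x h * F x) {c : W}
    (hc : c ∈ D) (hFc : F c = 1) : ∀ x ∈ D, IsUnit (F x) := by
  intro x hx
  have hinj : Function.Injective (F x) := by
    refine (injective_iff_map_eq_zero _).2 fun v hv => ?_
    have hd : ∀ y ∈ D, HasFDerivAt (fun y => F y v) ((fderiv ℝ F y).flip v) y := fun y hy => by
      simpa using (hF.differentiableAt (hD.mem_nhds hy)).hasFDerivAt.clm_apply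
        (hasFDerivAt_const v y)
    have := eq_zero_of_linear_system (k := fun y => F y v) hD hDc hA
      (fun y hy => (hd y hy).differentiableAt.differentiableWithinAt)
      (fun y hy h => by
        rw [(hd y hy).fderiv, ContinuousLinearMap.flip_apply, hF' y hy, mul_apply_eq_comp])
      hx hv c hc
    simpa [hFc] using this
  have hsurj : Function.Surjective (F x) :=
    LinearMap.surjective_of_injective (f := (F x : E →ₗ[ℝ] E)) hinj
  let e := (LinearEquiv.ofBijective (F x : E →ₗ[ℝ] E) ⟨hinj, hsurj⟩).toContinuousLinearEquiv
  exact ⟨ContinuousLinearEquiv.toUnit e, ContinuousLinearMap.ext fun v => rfl⟩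

/-- Flat linear systems on simply connected domains have global solutions, which depend smoothly
on parameters. -/
theorem exists_solution_of_flat [FiniteDimensional ℝ E] {D : Set W} (hD : IsOpen D)
    (hDs : IsSimplyConnected D) {L : Set Λ} (hL : IsOpen L) {A : W × Λ → W →L[ℝ] E →L[ℝ] E}
    (hA : ContDiffOn ℝ ∞ A (D ×ˢ L)) (hflat : ∀ l ∈ L, IsFlatOn (fun x => A (x, l)) D)
    {x₀ : W} (hx₀ : x₀ ∈ D) (y₀ : E) :
    ∃ y : W × Λ → E, ContDiffOn ℝ ∞ y (D ×ˢ L) ∧ (∀ l ∈ L, y (x₀, l) = y₀) ∧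
      ∀ x ∈ D, ∀ l ∈ L, ∀ h, fderiv ℝ (fun x => y (x, l)) x h = A (x, l) h (y (x, l)) := by
  have : SimplyConnectedSpace D := hDs.simplyConnectedSpace
  have : LocallyPathConnectedSpace D := hD.locallyPathConnectedSpace
  have : ∀ c : D, ∃ r > 0, Metric.ball (c : W) r ⊆ D := fun c => Metric.isOpen_iff.1 hD c c.2
  choose r hr hrD using this
  have hloc : ∀ c : D, _ := fun c => exists_fundamental_ball (c := (c : W)) (hr c) hL
    (hA.mono (prod_mono_left (hrD c))) (fun l hl x hx => hflat l hl x (hrD c hx))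
  choose F hFs hFc hFd using hloc
  have hAc : ∀ l ∈ L, ContinuousOn (fun x => A (x, l)) D := fun l hl =>
    hA.continuousOn.comp (by fun_prop) fun x hx => ⟨hx, hl⟩
  have hFl : ∀ c : D, ∀ l ∈ L, DifferentiableOn ℝ (fun x => F c (x, l)) (Metric.ball c (r c)) :=
    fun c l hl => ((hFs c).comp (by fun_prop : ContDiffOn ℝ ∞ (fun x : W => (x, l)) _)
      fun x hx => ⟨hx, hl⟩).differentiableOn (by simp)
  have hunit : ∀ c : D, ∀ x ∈ Metric.ball (c : W) (r c), ∀ l ∈ L, IsUnit (F c (x, l)) :=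
    fun c x hx l hl => isUnit_fundamental Metric.isOpen_ball (convex_ball _ _).isPreconnected
      ((hAc l hl).mono (hrD c)) (hFl c l hl) (fun x hx h => hFd c x hx l hl h)
      (Metric.mem_ball_self (hr c)) (hFc c l hl) x hx
  have hsol : ∀ c : D, ∀ x ∈ Metric.ball (c : W) (r c), ∀ l ∈ L, ∀ v,
      HasFDerivAt (fun x => F c (x, l) v) ((A (x, l)).flip (F c (x, l) v)) x := by
    intro c x hx l hl v
    have := ((hFl c l hl).differentiableAt (Metric.isOpen_ball.mem_nhds hx)).hasFDerivAt.clm_apply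
      (hasFDerivAt_const v x)
    refine this.congr_fderiv (ContinuousLinearMap.ext fun h => ?_)
    simp [hFd c x hx l hl h]
  let B : D → Set D := fun c => {x | (x : W) ∈ Metric.ball (c : W) (r c)}
  have hB : ∀ c, IsOpen (B c) := fun c => Metric.isOpen_ball.preimage continuous_subtype_val
  -- The transition map turns the value at the centre i of a solution into its value at the centre
  -- j. The fibre consists of all functions L → E, without regularity, so that one lift treats all
  -- parameters at once.
  let T : D → D → D → (L → E) → (L → E) := fun i j x g l =>
    Ring.inverse (F j (x, l)) (F i (x, l) (g l))
  have hcancel : ∀ (c : D) (x : D), x ∈ B c → ∀ (l : L) v,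
      Ring.inverse (F c (x, l)) (F c (x, l) v) = v := fun c x hx l v => by
    rw [← mul_apply_eq_comp, Ring.inverse_mul_cancel _ (hunit c x hx l l.2), one_apply_eq_self]
  have hcancel' : ∀ (c : D) (x : D), x ∈ B c → ∀ (l : L) v,
      F c (x, l) (Ring.inverse (F c (x, l)) v) = v := fun c x hx l v => by
    rw [← mul_apply_eq_comp, Ring.mul_inverse_cancel _ (hunit c x hx l l.2), one_apply_eq_self]
  obtain ⟨sec, hsec0, hsecloc, hsecT⟩ := exists_section_of_cocycle (T := T) hB
    (fun c => Metric.mem_ball_self (hr c))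
    (fun i x hx g => funext fun l => hcancel i x hx l _)
    (fun i j k x hx g => funext fun l => by simp only [T, hcancel' j x hx.1.2])
    -- Two solutions that agree at x agree on the intersection of the two balls, which is convex and
    -- so connected; hence the transition is locally constant, simultaneously for all parameters.
    (fun i j x hx => by
      filter_upwards [((hB i).inter (hB j)).mem_nhds hx] with y hy
      funext g l
      have hconv := (convex_ball (i : W) (r i)).inter (convex_ball (j : W) (r j))
      have := eqOn_of_linear_system (A := fun x => A (x, (l : Λ)))
        (k := fun z => F j (z, (l : Λ)) (T i j x g l))
        (m := fun z => F i (z, (l : Λ)) (g l))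
        (Metric.isOpen_ball.inter Metric.isOpen_ball) hconv.isPreconnected
        ((hAc l l.2).mono fun z hz => hrD i hz.1)
        (fun z hz => (hsol j z hz.2 l l.2 _).differentiableAt.differentiableWithinAt)
        (fun z hz h => by rw [(hsol j z hz.2 l l.2 _).fderiv]; rfl)
        (fun z hz => (hsol i z hz.1 l l.2 _).differentiableAt.differentiableWithinAt)
        (fun z hz h => by rw [(hsol i z hz.1 l l.2 _).fderiv]; rfl) hx
        (hcancel' j x hx.2 l _) y hy
      simp only [T] at this ⊢
      rw [← this, hcancel j y hy.2])
    ⟨x₀, hx₀⟩ (fun _ => y₀)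
  classical
  -- Because `F x` equals 1 at its own centre, the component of the section in the trivialization
  -- centred at x is the value of the solution at x.
  let y : W × Λ → E := fun p =>
    if h : p.1 ∈ D ∧ p.2 ∈ L then sec ⟨p.1, h.1⟩ ⟨p.1, h.1⟩ ⟨p.2, h.2⟩ else 0
  have hy : ∀ (x : D) (l : L), y (x, l) = sec x x l := fun x l => by simp [y, x.2, l.2]
  have hrep : ∀ x : D, ∀ᶠ x' : W in 𝓝 (x : W), x' ∈ Metric.ball (x : W) (r x) ∧
      ∀ l ∈ L, y (x', l) = F x (x', l) (y (x, l)) := by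
    intro x
    have h1 := hsecloc x x (Metric.mem_ball_self (hr x))
    rw [nhds_subtype_eq_comap, eventually_comap] at h1
    filter_upwards [h1, Metric.ball_mem_nhds (x : W) (hr x)] with x' hx' hxb
    refine ⟨hxb, fun l hl => ?_⟩
    have hxD : x' ∈ D := hrD x hxb
    have h2 := hx' ⟨x', hxD⟩ rfl
    have h3 := congrFun (hsecT x ⟨x', hxD⟩ ⟨x', hxD⟩ ⟨hxb, Metric.mem_ball_self (hr _)⟩) ⟨l, hl⟩
    rw [hy ⟨x', hxD⟩ ⟨l, hl⟩, hy x ⟨l, hl⟩, ← h3, ← h2]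
    simp only [T, hFc ⟨x', hxD⟩ l hl, Ring.inverse_one, one_apply_eq_self]
  -- The gluing forgot smoothness in the parameter. It is recovered by connectedness: nearby values
  -- differ by an invertible factor smooth in l, so smoothness in l is a locally constant property
  -- of x, and at x₀ the value does not depend on l.
  have hsmooth : ∀ x : D, ContDiffOn ℝ ∞ (fun l => y (x, l)) L := by
    have hlc : IsLocallyConstant fun x : D => ContDiffOn ℝ ∞ (fun l => y (x, l)) L := by
      refine IsLocallyConstant.iff_eventually_eq _ |>.2 fun x => ?_
      have h1 := hrep x
      rw [nhds_subtype_eq_comap]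
      filter_upwards [preimage_mem_comap h1] with x' hx'
      have hF : ContDiffOn ℝ ∞ (fun l => F x ((x' : W), l)) L :=
        (hFs x).comp (by fun_prop) fun l hl => ⟨hx'.1, hl⟩
      refine propext ⟨fun h => ?_, fun h => ?_⟩
      · refine ((contDiffOn_ringInverse hF fun l hl => hunit x x' hx'.1 l hl).clm_apply h).congr
          fun l hl => ?_
        rw [hx'.2 l hl, hcancel x x' hx'.1 ⟨l, hl⟩]
      · exact (hF.clm_apply h).congr fun l hl => hx'.2 l hl
    intro x
    have := hlc.apply_eq_of_isPreconnected isPreconnected_univ (mem_univ x)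
      (mem_univ (⟨x₀, hx₀⟩ : D))
    rw [this]
    refine contDiffOn_const (c := y₀) |>.congr fun l hl => ?_
    rw [hy ⟨x₀, hx₀⟩ ⟨l, hl⟩, hsec0]
  refine ⟨y, ?_, fun l hl => by rw [hy ⟨x₀, hx₀⟩ ⟨l, hl⟩, hsec0], fun x hx l hl h => ?_⟩
  · rintro ⟨x, l⟩ ⟨hx, hl⟩
    have h1 := hrep ⟨x, hx⟩
    have h2 : ContDiffOn ℝ ∞ (fun p : W × Λ => F ⟨x, hx⟩ p (y (x, p.2)))
        (Metric.ball x (r ⟨x, hx⟩) ×ˢ L) :=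
      (hFs ⟨x, hx⟩).clm_apply ((hsmooth ⟨x, hx⟩).comp contDiffOn_snd fun p hp => hp.2)
    have h3 := h2.contDiffAt ((Metric.isOpen_ball.prod hL).mem_nhds
      (⟨Metric.mem_ball_self (hr _), hl⟩ : (x, l) ∈ Metric.ball x (r ⟨x, hx⟩) ×ˢ L))
    refine (h3.congr_of_eventuallyEq ?_).contDiffWithinAt
    filter_upwards [(h1.prod_inl_nhds l), (show ∀ᶠ l' in 𝓝 l, l' ∈ L from hL.mem_nhds hl).prod_inr_nhds x] with p hp hpl
    exact hp.2 p.2 hpl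
  · have h1 : (fun x' => y (x', l)) =ᶠ[𝓝 x] fun x' => F ⟨x, hx⟩ (x', l) (y (x, l)) := by
      filter_upwards [hrep ⟨x, hx⟩] with x' hx' using hx'.2 l hl
    rw [h1.fderiv_eq, (hsol ⟨x, hx⟩ x (Metric.mem_ball_self (hr _)) l hl _).fderiv,
      ContinuousLinearMap.flip_apply, hFc ⟨x, hx⟩ l hl, one_apply_eq_self]

end LinearSystem

/-! ### First integrals of plane vector fields -/

section FirstIntegral

/-- The path `t ↦ (x (1 - t), Z t)`. -/
def backwardPath : (ℝ × ℝ) × C(I, ℝ) →L[ℝ] C(I, ℝ × ℝ) :=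
  ((ContinuousLinearMap.fst ℝ ℝ ℝ).comp (ContinuousLinearMap.fst ℝ (ℝ × ℝ) C(I, ℝ))).smulRight
    (⟨fun t => (1 - (t : ℝ), 0), by fun_prop⟩ : C(I, ℝ × ℝ)) +
  (ContinuousLinearMap.compLeftContinuous ℝ I (ContinuousLinearMap.inr ℝ ℝ ℝ)).comp
    (ContinuousLinearMap.snd ℝ (ℝ × ℝ) C(I, ℝ))

theorem backwardPath_apply (q : (ℝ × ℝ) × C(I, ℝ)) (t : I) :
    backwardPath q t = (q.1.1 * (1 - t), q.2 t) := by
  simp [backwardPath]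

/-- The zeros of this map in `Z`, for fixed `(x, y)`, are the solutions of
`Z' t = -x s (x (1 - t), Z t)`, `Z 0 = y`. -/
def flowDefect (s : ℝ × ℝ → ℝ) (q : (ℝ × ℝ) × C(I, ℝ)) : C(I, ℝ) :=
  q.2 - constMap ℝ q.1.2 + q.1.1 • volterra ℝ (superpose I s (backwardPath q))

/-- The shear `(p, Z) ↦ (p, Z - p.2 + p.1 v)`. -/
def shearEquiv (v : C(I, ℝ)) : ((ℝ × ℝ) × C(I, ℝ)) ≃L[ℝ] (ℝ × ℝ) × C(I, ℝ) :=
  ContinuousLinearEquiv.equivOfInverse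
    ((ContinuousLinearMap.fst ℝ (ℝ × ℝ) C(I, ℝ)).prod
      (ContinuousLinearMap.snd ℝ (ℝ × ℝ) C(I, ℝ)
        - (constMap ℝ).comp ((ContinuousLinearMap.snd ℝ ℝ ℝ).comp
            (ContinuousLinearMap.fst ℝ (ℝ × ℝ) C(I, ℝ)))
        + ((ContinuousLinearMap.fst ℝ ℝ ℝ).comp
            (ContinuousLinearMap.fst ℝ (ℝ × ℝ) C(I, ℝ))).smulRight v))
    ((ContinuousLinearMap.fst ℝ (ℝ × ℝ) C(I, ℝ)).prod
      (ContinuousLinearMap.snd ℝ (ℝ × ℝ) C(I, ℝ)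
        + (constMap ℝ).comp ((ContinuousLinearMap.snd ℝ ℝ ℝ).comp
            (ContinuousLinearMap.fst ℝ (ℝ × ℝ) C(I, ℝ)))
        - ((ContinuousLinearMap.fst ℝ ℝ ℝ).comp
            (ContinuousLinearMap.fst ℝ (ℝ × ℝ) C(I, ℝ))).smulRight v))
    (fun q => by ext <;> simp; ring) (fun q => by ext <;> simp; ring)

variable {s : ℝ × ℝ → ℝ} {U : Set (ℝ × ℝ)}

theorem contDiffOn_flowDefect (hU : IsOpen U) (hs : ContDiffOn ℝ ∞ s U) :
    ContDiffOn ℝ ∞ (flowDefect s) (backwardPath ⁻¹' mapsInto I U) := by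
  have h1 : ContDiffOn ℝ ∞ (fun q => superpose I s (backwardPath q))
      (backwardPath ⁻¹' mapsInto I U) :=
    (contDiffOn_superpose hU hs).comp backwardPath.contDiff.contDiffOn fun _ h => h
  have h2 := (volterra ℝ).contDiff.comp_contDiffOn h1
  have h3 : ContDiff ℝ ∞ fun q : (ℝ × ℝ) × C(I, ℝ) => q.2 - constMap ℝ q.1.2 := by fun_prop
  exact h3.contDiffOn.add ((contDiff_fst.comp contDiff_fst).contDiffOn.smul h2)

/-- At the origin the nonlinear term carries the factor x = 0, so only its value contributes to the
derivative, and the derivative is a shear. Time is rescaled by x, so that small x replaces a short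
time interval. -/
theorem hasFDerivAt_flowDefect (hU : IsOpen U) (h0 : (0, 0) ∈ U) (hs : ContDiffOn ℝ ∞ s U) :
    HasFDerivAt (fun q : (ℝ × ℝ) × C(I, ℝ) => (q.1, flowDefect s q))
      (shearEquiv (volterra ℝ (superpose I s 0)) : _ →L[ℝ] _) 0 := by
  have hmem : (0 : (ℝ × ℝ) × C(I, ℝ)) ∈ backwardPath ⁻¹' mapsInto I U := fun t => by
    rw [map_zero]; exact h0
  have h1 : ContDiffOn ℝ ∞ (fun q => volterra ℝ (superpose I s (backwardPath q)))
      (backwardPath ⁻¹' mapsInto I U) :=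
    (volterra ℝ).contDiff.comp_contDiffOn
      ((contDiffOn_superpose hU hs).comp backwardPath.contDiff.contDiffOn fun _ h => h)
  have ho : IsOpen (backwardPath ⁻¹' mapsInto I U) :=
    (isOpen_mapsInto hU).preimage backwardPath.continuous
  have h2 := ((h1.contDiffAt (ho.mem_nhds hmem)).differentiableAt (by simp)).hasFDerivAt
  have h3 : HasFDerivAt (fun q : (ℝ × ℝ) × C(I, ℝ) => q.1.1) ((ContinuousLinearMap.fst ℝ ℝ ℝ).comp
      (ContinuousLinearMap.fst ℝ (ℝ × ℝ) C(I, ℝ))) 0 :=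
    ((ContinuousLinearMap.fst ℝ ℝ ℝ).comp
      (ContinuousLinearMap.fst ℝ (ℝ × ℝ) C(I, ℝ))).hasFDerivAt
  have h4 : HasFDerivAt (fun q : (ℝ × ℝ) × C(I, ℝ) => q.2 - constMap ℝ q.1.2)
      (ContinuousLinearMap.snd ℝ (ℝ × ℝ) C(I, ℝ)
        - (constMap ℝ).comp ((ContinuousLinearMap.snd ℝ ℝ ℝ).comp
            (ContinuousLinearMap.fst ℝ (ℝ × ℝ) C(I, ℝ)))) 0 :=
    (ContinuousLinearMap.snd ℝ (ℝ × ℝ) C(I, ℝ)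
        - (constMap ℝ).comp ((ContinuousLinearMap.snd ℝ ℝ ℝ).comp
            (ContinuousLinearMap.fst ℝ (ℝ × ℝ) C(I, ℝ)))).hasFDerivAt
  have h5 := hasFDerivAt_fst.prodMk (h4.add (h3.smul h2))
  refine h5.congr_fderiv ?_
  ext <;> simp [shearEquiv]

/-- A smooth vector field `∂ₓ + s ∂_y` in the plane has, near the origin, a smooth first integral
whose derivative in the direction `y` does not vanish. -/
theorem exists_first_integral (hU : IsOpen U) (h0 : (0, 0) ∈ U) (hs : ContDiffOn ℝ ∞ s U) :
    ∃ (f : ℝ × ℝ → ℝ) (V : Set (ℝ × ℝ)), IsOpen V ∧ (0, 0) ∈ V ∧ V ⊆ U ∧ ContDiffOn ℝ ∞ f V ∧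
      (∀ p ∈ V, fderiv ℝ f p (1, s p) = 0) ∧ fderiv ℝ f (0, 0) (0, 1) = 1 := by
  have ho : IsOpen (backwardPath ⁻¹' mapsInto I U) :=
    (isOpen_mapsInto hU).preimage backwardPath.continuous
  have hmem : (0 : (ℝ × ℝ) × C(I, ℝ)) ∈ backwardPath ⁻¹' mapsInto I U := fun t => by
    rw [map_zero]; exact h0
  obtain ⟨Θ, hΘ0, hΘs, hΘ, hΘi⟩ := exists_smooth_local_inverse ho
    (contDiffOn_fst.prodMk (contDiffOn_flowDefect hU hs)) hmem (hasFDerivAt_flowDefect hU h0 hs)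
  have hΘ' : ∀ q, Θ q = (q.1, flowDefect s q) := fun q => congrFun hΘ q
  obtain ⟨δ, hδ, hball⟩ := Metric.isOpen_iff.1 Θ.open_source 0 hΘ0
  -- The path `sol p` follows the integral curve from p back to the axis x = 0; its endpoint, the
  -- height of the crossing, is the first integral.
  obtain ⟨sol, hsol⟩ : ∃ sol : ℝ × ℝ → C(I, ℝ), ∀ p, sol p = (Θ.symm (p, 0)).2 := ⟨_, fun _ => rfl⟩
  set V₀ : Set (ℝ × ℝ) := (fun p => (p, (0 : C(I, ℝ)))) ⁻¹' Θ.target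
  have hV₀ : IsOpen V₀ := Θ.open_target.preimage (by fun_prop)
  have hsols : ContDiffOn ℝ ∞ sol V₀ := by
    have h1 : ContDiffOn ℝ ∞ (fun p => Θ.symm (p, 0)) V₀ :=
      hΘi.comp (by fun_prop : ContDiffOn ℝ ∞ (fun p : ℝ × ℝ => (p, (0 : C(I, ℝ)))) V₀)
        fun _ h => h
    exact (contDiff_snd.comp_contDiffOn h1).congr fun p _ => hsol p
  have hspec : ∀ p ∈ V₀, (p, sol p) ∈ Θ.source ∧ flowDefect s (p, sol p) = 0 := by
    intro p hp
    have h1 : Θ (Θ.symm (p, 0)) = (p, 0) := Θ.right_inv hp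
    rw [hΘ'] at h1
    have h2 : Θ.symm (p, 0) = (p, sol p) := Prod.ext (Prod.mk.inj h1).1 (hsol p).symm
    rw [h2] at h1
    exact ⟨h2 ▸ Θ.map_target hp, congrArg Prod.snd h1⟩
  have huniq : ∀ p Z, ‖p‖ < δ → ‖Z‖ < δ → flowDefect s (p, Z) = 0 → p ∈ V₀ ∧ sol p = Z := by
    intro p Z hp hZ h
    have h1 : (p, Z) ∈ Θ.source := hball (by
      rw [mem_ball_zero_iff, Prod.norm_def]; exact max_lt hp hZ)
    have h2 : Θ (p, Z) = (p, 0) := by rw [hΘ', h]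
    have h3 : (p, (0 : C(I, ℝ))) ∈ Θ.target := h2 ▸ Θ.map_source h1
    exact ⟨h3, by rw [hsol, ← h2, Θ.left_inv h1]⟩
  -- The norm bounds keep every tail of the path inside the ball on which zeros of the defect are
  -- unique, whether or not the starting point of the tail lies in V.
  set V : Set (ℝ × ℝ) := (V₀ ∩ {p | ‖sol p‖ < δ}) ∩ {p | ‖p‖ < δ}
  have hV : IsOpen V :=
    (hsols.continuousOn.norm.isOpen_inter_preimage hV₀ isOpen_Iio).inter
      (isOpen_lt continuous_norm continuous_const)
  have hvert : ∀ y : ℝ, |y| < δ → (0, y) ∈ V ∧ sol (0, y) = constMap ℝ y := by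
    intro y hy
    have h1 : ‖constMap ℝ y‖ < δ :=
      (ContinuousMap.norm_lt_iff _ hδ).2 fun t => by simpa using hy
    have h2 : ‖((0 : ℝ), y)‖ < δ := by simpa [Prod.norm_def, hδ] using hy
    have h3 := huniq (0, y) (constMap ℝ y) h2 h1 (by simp [flowDefect])
    exact ⟨⟨⟨h3.1, by rw [mem_ofPred_eq, h3.2]; exact h1⟩, h2⟩, h3.2⟩
  have h0V : ((0 : ℝ), (0 : ℝ)) ∈ V := (hvert 0 (by simpa using hδ)).1
  have hfs : ContDiffOn ℝ ∞ (fun p => sol p 1) V :=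
    (contDiffOn_eval hsols 1).mono fun p hp => hp.1.1
  have hint : ∀ p ∈ V, ∀ t : I, sol p t = p.2 - p.1 * volterra ℝ
      (superpose I s (backwardPath (p, sol p))) t := by
    intro p hp t
    have := DFunLike.congr_fun (hspec p hp.1.1).2 t
    simp only [flowDefect, ContinuousMap.add_apply, ContinuousMap.sub_apply, constMap_apply,
      ContinuousMap.smul_apply, smul_eq_mul, ContinuousMap.zero_apply] at this
    linarith
  have hpath : ∀ p ∈ V, ∀ t : I, (p.1 * (1 - t), sol p t) ∈ U := by
    intro p hp t
    have := hΘs (hspec p hp.1.1).1 t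
    rwa [backwardPath_apply] at this
  have hpath0 : ∀ p ∈ V, sol p 0 = p.2 := fun p hp => by
    rw [hint p hp, volterra_apply]; simp
  have hVU : V ⊆ U := fun p hp => by
    have := hpath p hp 0
    rwa [hpath0 p hp, show (p.1 * (1 - ((0 : I) : ℝ)), p.2) = p by simp] at this
  have hsup : ∀ p ∈ V, ∀ t : I, superpose I s (backwardPath (p, sol p)) t =
      s (p.1 * (1 - t), sol p t) := by
    intro p hp t
    rw [superpose_apply hs.continuousOn (hΘs (hspec p hp.1.1).1), backwardPath_apply]
  -- The tail of the path from time r on, reparametrized by r + (1 - r)t, solves the equation of its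
  -- own starting point, so uniqueness gives it the same endpoint.
  have hconst : ∀ p ∈ V, ∀ r : I, sol (p.1 * (1 - r), sol p r) 1 = sol p 1 := by
    intro p hp r
    have hr : ∀ t : I, (r : ℝ) + (1 - r) * t ∈ I := fun t =>
      ⟨by nlinarith [r.2.1, r.2.2, t.2.1], by nlinarith [r.2.1, r.2.2, t.2.2]⟩
    let scale : C(I, I) := ⟨fun t => ⟨r + (1 - r) * t, hr t⟩, by fun_prop⟩
    have hnorm : ‖(sol p).comp scale‖ < δ :=
      ((ContinuousMap.norm_le _ (norm_nonneg (sol p))).2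
        fun t => (sol p).norm_coe_le_norm (scale t)).trans_lt hp.1.2
    have hnorm' : ‖(p.1 * (1 - (r : ℝ)), sol p r)‖ < δ := by
      have e1 : ‖p.1 * (1 - (r : ℝ))‖ ≤ ‖p.1‖ := by
        rw [norm_mul]
        refine mul_le_of_le_one_right (norm_nonneg _) ?_
        rw [Real.norm_of_nonneg (by linarith [r.2.2])]
        linarith [r.2.1]
      have e2 : ‖p.1‖ < δ := (norm_fst_le p).trans_lt hp.2
      have e3 : ‖sol p r‖ < δ := ((sol p).norm_coe_le_norm r).trans_lt hp.1.2
      exact Prod.norm_def _ |>.trans_lt (max_lt (e1.trans_lt e2) e3)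
    have hdef : flowDefect s ((p.1 * (1 - (r : ℝ)), sol p r), (sol p).comp scale) = 0 := by
      ext t
      have e1 := hint p hp r
      have e2 : (sol p).comp scale t = _ := hint p hp (scale t)
      simp only [flowDefect, ContinuousMap.add_apply, ContinuousMap.sub_apply, constMap_apply,
        ContinuousMap.smul_apply, smul_eq_mul, ContinuousMap.zero_apply, e2]
      simp only [volterra_apply] at e1 ⊢
      set g := IccExtend zero_le_one (superpose I s (backwardPath (p, sol p)))
      have hg : Continuous g := (ContinuousMap.continuous _).Icc_extend' (h := zero_le_one)
      have e3 := intervalIntegral.integral_add_adjacent_intervals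
        (hg.intervalIntegrable 0 r) (hg.intervalIntegrable r (r + (1 - r) * t))
        (μ := MeasureTheory.volume)
      have e4 := intervalIntegral.smul_integral_comp_add_mul (a := 0) (b := t) g (1 - (r : ℝ)) r
      rw [mul_zero, add_zero] at e4
      have e5 : ∫ τ in (0 : ℝ)..t, IccExtend zero_le_one (superpose I s
          (backwardPath ((p.1 * (1 - (r : ℝ)), sol p r), (sol p).comp scale))) τ =
          ∫ τ in (0 : ℝ)..t, g (r + (1 - r) * τ) := by
        refine intervalIntegral.integral_congr fun τ hτ => ?_
        rw [uIcc_of_le t.2.1] at hτ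
        have hτ' : τ ∈ Icc (0 : ℝ) 1 := ⟨hτ.1, hτ.2.trans t.2.2⟩
        have e6 : g (r + (1 - r) * τ) = s (p.1 * (1 - (r + (1 - r) * τ)),
            (sol p).comp scale ⟨τ, hτ'⟩) := by
          simp only [g]
          rw [IccExtend_of_mem _ _ (hr ⟨τ, hτ'⟩), hsup p hp]
          rfl
        have e7 : ∀ t : I, backwardPath ((p.1 * (1 - (r : ℝ)), sol p r), (sol p).comp scale) t =
            (p.1 * (1 - (r + (1 - r) * t)), (sol p).comp scale t) := fun t => by
          rw [backwardPath_apply]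
          exact Prod.ext (by simp only; ring) rfl
        have e8 : backwardPath ((p.1 * (1 - (r : ℝ)), sol p r), (sol p).comp scale) ∈
            mapsInto I U := fun t => by rw [e7]; exact hpath p hp (scale t)
        rw [e6, IccExtend_of_mem _ _ hτ', superpose_apply hs.continuousOn e8, e7]
      rw [e5, e1, show ((scale t : I) : ℝ) = r + (1 - r) * t from rfl, ← e3, ← e4, smul_eq_mul]
      ring
    rw [(huniq _ _ hnorm' hnorm hdef).2]
    change sol p (scale 1) = _
    congr 1
    exact Subtype.ext (by simp [scale])
  -- Differentiating the constancy at r = 0 yields -x df(1, s) = 0. The factor x is cancelled here;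
  -- the axis x = 0 is reached afterwards by continuity.
  have hoff : ∀ p ∈ V, p.1 ≠ 0 → fderiv ℝ (fun p => sol p 1) p (1, s p) = 0 := by
    intro p hp hp1
    set g := IccExtend zero_le_one (superpose I s (backwardPath (p, sol p)))
    have hζ : HasDerivAt (fun r : ℝ => (p.1 * (1 - r), p.2 - p.1 * ∫ τ in (0 : ℝ)..r, g τ))
        (p.1 * (-1), -(p.1 * g 0)) 0 :=
      (((hasDerivAt_id (0 : ℝ)).const_sub 1).const_mul p.1).prodMk
        (((hasDerivAt_integral_IccExtend _ 0).const_mul p.1).const_sub p.2)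
    have hg0 : g 0 = s p := by
      simp only [g, IccExtend_left]
      rw [show (⟨0, left_mem_Icc.2 zero_le_one⟩ : Icc (0 : ℝ) 1) = (0 : I) from rfl, hsup p hp,
        hpath0 p hp]
      simp
    have hdf : HasFDerivAt (fun p => sol p 1) (fderiv ℝ (fun p => sol p 1) p)
        (p.1 * (1 - (0 : ℝ)), p.2 - p.1 * ∫ τ in (0 : ℝ)..0, g τ) := by
      have : (p.1 * (1 - (0 : ℝ)), p.2 - p.1 * ∫ τ in (0 : ℝ)..0, g τ) = p := by simp
      rw [this]
      exact ((hfs.contDiffAt (hV.mem_nhds hp)).differentiableAt (by simp)).hasFDerivAt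
    have h1 := (hdf.comp_hasDerivAt (0 : ℝ) hζ).hasDerivWithinAt (s := Icc 0 1)
    have h2 : HasDerivWithinAt (fun _ : ℝ => sol p 1) 0 (Icc 0 1) 0 :=
      hasDerivWithinAt_const _ _ _
    have h3 : HasDerivWithinAt ((fun p => sol p 1) ∘
        fun r : ℝ => (p.1 * (1 - r), p.2 - p.1 * ∫ τ in (0 : ℝ)..r, g τ)) 0 (Icc 0 1) 0 := by
      refine h2.congr_of_mem (fun r hr => ?_) ⟨le_rfl, zero_le_one⟩
      rw [← hconst p hp ⟨r, hr⟩, hint p hp ⟨r, hr⟩]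
      rfl
    have hu : UniqueDiffWithinAt ℝ (Icc (0 : ℝ) 1) 0 :=
      uniqueDiffOn_Icc zero_lt_one 0 ⟨le_rfl, zero_le_one⟩
    have h4 := (h1.derivWithin hu).symm.trans (h3.derivWithin hu)
    have h5 : (p.1 * (-1), -(p.1 * g 0)) = (-p.1) • ((1 : ℝ), s p) := by
      rw [hg0]; simp
    rw [h5, map_smul, smul_eq_zero] at h4
    exact h4.resolve_left (neg_ne_zero.2 hp1)
  refine ⟨fun p => sol p 1, V, hV, h0V, hVU, hfs, fun p hp => ?_, ?_⟩
  · by_cases hp1 : p.1 = 0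
    · have hc : ContinuousOn (fun p => fderiv ℝ (fun p => sol p 1) p (1, s p)) V :=
        (hfs.continuousOn_fderiv_of_isOpen hV (by simp)).clm_apply
          (continuousOn_const.prodMk (hs.continuousOn.mono hVU))
      have hline : ContinuousAt (fun x : ℝ => (x, p.2)) 0 := by fun_prop
      have hp' : ((0 : ℝ), p.2) = p := by rw [← hp1]
      have hc' : ContinuousAt (fun x : ℝ => fderiv ℝ (fun p => sol p 1) (x, p.2)
          (1, s (x, p.2))) 0 :=
        ContinuousAt.comp (g := fun p => fderiv ℝ (fun p => sol p 1) p (1, s p))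
          (hc.continuousAt (by rw [hp']; exact hV.mem_nhds hp)) hline
      have hev : ∀ᶠ x : ℝ in 𝓝[≠] 0, fderiv ℝ (fun p => sol p 1) (x, p.2) (1, s (x, p.2)) = 0 := by
        have h1 : ∀ᶠ x : ℝ in 𝓝 0, (x, p.2) ∈ V :=
          hline.eventually (hV.mem_nhds (by change ((0 : ℝ), p.2) ∈ V; rwa [hp']))
        filter_upwards [h1.filter_mono nhdsWithin_le_nhds, self_mem_nhdsWithin] with x hx hx0
        exact hoff _ hx hx0
      have h2 := tendsto_nhds_unique (hc'.tendsto.mono_left nhdsWithin_le_nhds)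
        ((tendsto_const_nhds (x := (0 : ℝ))).congr' (hev.mono fun x hx => hx.symm))
      rwa [hp'] at h2
    · exact hoff p hp hp1
  · have hdf := ((hfs.contDiffAt (hV.mem_nhds h0V)).differentiableAt (by simp)).hasFDerivAt
    have h1 : HasDerivAt (fun y : ℝ => ((0 : ℝ), y)) (0, 1) 0 :=
      (hasDerivAt_const _ _).prodMk (hasDerivAt_id _)
    have h2 := hdf.comp_hasDerivAt (0 : ℝ) h1
    -- On the axis x = 0 the path is constant, so f(0, y) = y.
    refine h2.unique ((hasDerivAt_id (0 : ℝ)).congr_of_eventuallyEq ?_)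
    filter_upwards [Metric.ball_mem_nhds (0 : ℝ) hδ] with y hy
    have := (hvert y (by simpa using hy)).2
    simp [this]

end FirstIntegral

/-! ### Null coordinates in a parameter plane -/

/-- The scalar product of Minkowski space as a continuous bilinear form. -/
def lorBilin : E31 →L[ℝ] E31 →L[ℝ] ℝ :=
  let P : Fin 3 → E31 →L[ℝ] ℝ := fun i => ContinuousLinearMap.proj i
  (P 1).smulRight (P 1) + (P 2).smulRight (P 2) - (P 0).smulRight (P 0)

theorem lorBilin_apply (x y : E31) : lorBilin x y = lor x y := by
  simp [lorBilin, lor]; ring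

theorem lor_comm (x y : E31) : lor x y = lor y x := by simp only [lor]; ring

theorem lor_add_left (x y z : E31) : lor (x + y) z = lor x z + lor y z := by
  simp only [lor, Pi.add_apply]; ring

theorem lor_add_right (x y z : E31) : lor x (y + z) = lor x y + lor x z := by
  simp only [lor, Pi.add_apply]; ring

theorem lor_smul_left (c : ℝ) (x y : E31) : lor (c • x) y = c * lor x y := by
  simp only [lor, Pi.smul_apply, smul_eq_mul]; ring

theorem lor_smul_right (c : ℝ) (x y : E31) : lor x (c • y) = c * lor x y := by
  simp only [lor, Pi.smul_apply, smul_eq_mul]; ring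

theorem contDiffOn_lor {W : Type*} [NormedAddCommGroup W] [NormedSpace ℝ W] {f g : W → E31}
    {s : Set W} {n : WithTop ℕ∞} (hf : ContDiffOn ℝ n f s) (hg : ContDiffOn ℝ n g s) :
    ContDiffOn ℝ n (fun x => lor (f x) (g x)) s := by
  simp only [← lorBilin_apply]
  exact (lorBilin.contDiff.comp_contDiffOn hf).clm_apply hg

theorem lor_null_direction {E F G s : ℝ} {x y : E31} (hE : lor x x = E) (hF : lor x y = F)
    (hG : lor y y = G) (hG0 : G ≠ 0) (hs : (G * s + F) ^ 2 = F ^ 2 - E * G) :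
    lor (x + s • y) (x + s • y) = 0 := by
  have : lor (x + s • y) (x + s • y) = E + 2 * s * F + s ^ 2 * G := by
    rw [← hE, ← hF, ← hG]; simp only [lor, Pi.add_apply, Pi.smul_apply, smul_eq_mul]; ring
  rw [this]
  have h2 : G * (E + 2 * s * F + s ^ 2 * G) = 0 := by linear_combination hs
  exact (mul_eq_zero.1 h2).resolve_left hG0

/-- Expansion of w in the basis (1, s), (0, 1): a functional that kills (1, s) and not (0, 1)
vanishes on w only if w is a multiple of (1, s). -/
theorem fderiv_pair_apply {V : Type*} [NormedAddCommGroup V] [NormedSpace ℝ V]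
    (T : ℝ × ℝ →L[ℝ] V) (s : ℝ) (w : ℝ × ℝ) :
    T w = w.1 • T (1, s) + (w.2 - s * w.1) • T (0, 1) := by
  rw [← map_smul, ← map_smul, ← map_add]
  congr 1
  ext <;> simp
  ring

/-- Null coordinates for a Lorentzian metric near a point of a parameter plane. -/
theorem exists_null_coordinates {ψ : ℝ × ℝ → E31} {D : Set (ℝ × ℝ)} (hD : IsOpen D)
    (h0 : (0, 0) ∈ D) (hψ : ContDiffOn ℝ ∞ ψ D)
    (hE0 : lor (fderiv ℝ ψ (0, 0) (1, 0)) (fderiv ℝ ψ (0, 0) (1, 0)) = -1)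
    (hF0 : lor (fderiv ℝ ψ (0, 0) (1, 0)) (fderiv ℝ ψ (0, 0) (0, 1)) = 0)
    (hG0 : lor (fderiv ℝ ψ (0, 0) (0, 1)) (fderiv ℝ ψ (0, 0) (0, 1)) = 1) :
    ∃ Θ : OpenPartialHomeomorph (ℝ × ℝ) (ℝ × ℝ), (0, 0) ∈ Θ.source ∧ Θ.source ⊆ D ∧
      ContDiffOn ℝ ∞ Θ Θ.source ∧ ContDiffOn ℝ ∞ Θ.symm Θ.target ∧ Convex ℝ Θ.target ∧
      ∀ z ∈ Θ.target,
        lor (fderiv ℝ (ψ ∘ Θ.symm) z (1, 0)) (fderiv ℝ (ψ ∘ Θ.symm) z (1, 0)) = 0 ∧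
        lor (fderiv ℝ (ψ ∘ Θ.symm) z (0, 1)) (fderiv ℝ (ψ ∘ Θ.symm) z (0, 1)) = 0 ∧
        0 < lor (fderiv ℝ (ψ ∘ Θ.symm) z (1, 0)) (fderiv ℝ (ψ ∘ Θ.symm) z (0, 1)) := by
  have hdψ : ContDiffOn ℝ ∞ (fderiv ℝ ψ) D := hψ.fderiv_of_isOpen hD (by simp)
  have hcol : ∀ w : ℝ × ℝ, ContDiffOn ℝ ∞ (fun p => fderiv ℝ ψ p w) D := fun w =>
    hdψ.clm_apply contDiffOn_const
  obtain ⟨E, hE⟩ : ∃ E : ℝ × ℝ → ℝ, ∀ p,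
      lor (fderiv ℝ ψ p (1, 0)) (fderiv ℝ ψ p (1, 0)) = E p := ⟨_, fun _ => rfl⟩
  obtain ⟨F, hF⟩ : ∃ F : ℝ × ℝ → ℝ, ∀ p,
      lor (fderiv ℝ ψ p (1, 0)) (fderiv ℝ ψ p (0, 1)) = F p := ⟨_, fun _ => rfl⟩
  obtain ⟨G, hG⟩ : ∃ G : ℝ × ℝ → ℝ, ∀ p,
      lor (fderiv ℝ ψ p (0, 1)) (fderiv ℝ ψ p (0, 1)) = G p := ⟨_, fun _ => rfl⟩
  have hEs : ContDiffOn ℝ ∞ E D := (contDiffOn_lor (hcol _) (hcol _)).congr fun p _ => (hE p).symm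
  have hFs : ContDiffOn ℝ ∞ F D := (contDiffOn_lor (hcol _) (hcol _)).congr fun p _ => (hF p).symm
  have hGs : ContDiffOn ℝ ∞ G D := (contDiffOn_lor (hcol _) (hcol _)).congr fun p _ => (hG p).symm
  rw [hE] at hE0
  rw [hF] at hF0
  rw [hG] at hG0
  -- E < 0 < G makes the discriminant F² - EG positive, so both roots are real, distinct and smooth.
  set U : Set (ℝ × ℝ) := (D ∩ E ⁻¹' Iio 0) ∩ (D ∩ G ⁻¹' Ioi 0)
  have hU : IsOpen U := (hEs.continuousOn.isOpen_inter_preimage hD isOpen_Iio).inter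
    (hGs.continuousOn.isOpen_inter_preimage hD isOpen_Ioi)
  have h0U : ((0 : ℝ), (0 : ℝ)) ∈ U :=
    ⟨⟨h0, by simp [hE0]⟩, ⟨h0, by simp [hG0]⟩⟩
  have hUD : U ⊆ D := fun p hp => hp.1.1
  have hdisc : ∀ p ∈ U, 0 < F p ^ 2 - E p * G p := fun p hp => by
    have h1 : E p < 0 := hp.1.2
    have h2 : 0 < G p := hp.2.2
    nlinarith [sq_nonneg (F p), mul_pos (neg_pos.2 h1) h2]
  have hGne : ∀ p ∈ U, G p ≠ 0 := fun p hp => ne_of_gt hp.2.2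
  -- The roots of E + 2Fs + Gs² for ε = ±1; at the origin they are ±1.
  obtain ⟨s, hs⟩ : ∃ s : ℝ → ℝ × ℝ → ℝ, ∀ ε p,
      s ε p = (-F p + ε * Real.sqrt (F p ^ 2 - E p * G p)) / G p := ⟨_, fun _ _ => rfl⟩
  have hss : ∀ ε, ContDiffOn ℝ ∞ (s ε) U := by
    intro ε
    have h1 : ContDiffOn ℝ ∞ (fun p => Real.sqrt (F p ^ 2 - E p * G p)) U :=
      (((hFs.pow 2).sub (hEs.mul hGs)).mono hUD).sqrt fun p hp => (hdisc p hp).ne'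
    exact ((((hFs.mono hUD).neg.add (contDiffOn_const.mul h1)).div (hGs.mono hUD) hGne)).congr
      fun p _ => hs ε p
  have hnull : ∀ ε : ℝ, ε ^ 2 = 1 → ∀ p ∈ U,
      lor (fderiv ℝ ψ p (1, s ε p)) (fderiv ℝ ψ p (1, s ε p)) = 0 := by
    intro ε hε p hp
    have h1 : fderiv ℝ ψ p (1, s ε p) = fderiv ℝ ψ p (1, 0) + s ε p • fderiv ℝ ψ p (0, 1) := by
      rw [fderiv_pair_apply _ 0]; simp
    rw [h1]
    refine lor_null_direction (hE p) (hF p) (hG p) (hGne p hp) ?_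
    have h2 : G p * s ε p + F p = ε * Real.sqrt (F p ^ 2 - E p * G p) := by
      rw [hs]; field_simp [hGne p hp]; ring
    rw [h2, mul_pow, hε, Real.sq_sqrt (hdisc p hp).le, one_mul]
  have hs0 : ∀ ε, s ε (0, 0) = ε := fun ε => by rw [hs, hE0, hF0, hG0]; simp
  -- The new coordinates are u = f and v = g. The vector ∂_u is killed by dg, hence is a multiple of
  -- the null vector (1, s 1); likewise ∂_v is a multiple of (1, s (-1)).
  obtain ⟨f, Vf, hVf, h0f, hVfU, hfs, hfint, hf0⟩ := exists_first_integral hU h0U (hss (-1))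
  obtain ⟨g, Vg, hVg, h0g, hVgU, hgs, hgint, hg0⟩ := exists_first_integral hU h0U (hss 1)
  have hfy : ContinuousOn (fun p => fderiv ℝ f p (0, 1)) Vf :=
    (hfs.continuousOn_fderiv_of_isOpen hVf (by simp)).clm_apply continuousOn_const
  have hgy : ContinuousOn (fun p => fderiv ℝ g p (0, 1)) Vg :=
    (hgs.continuousOn_fderiv_of_isOpen hVg (by simp)).clm_apply continuousOn_const
  set V : Set (ℝ × ℝ) := (Vf ∩ (fun p => fderiv ℝ f p (0, 1)) ⁻¹' {0}ᶜ) ∩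
    (Vg ∩ (fun p => fderiv ℝ g p (0, 1)) ⁻¹' {0}ᶜ)
  have hV : IsOpen V := (hfy.isOpen_inter_preimage hVf isOpen_compl_singleton).inter
    (hgy.isOpen_inter_preimage hVg isOpen_compl_singleton)
  have h0V : ((0 : ℝ), (0 : ℝ)) ∈ V := ⟨⟨h0f, by simp [hf0]⟩, ⟨h0g, by simp [hg0]⟩⟩
  have hdf : ∀ p ∈ V, HasFDerivAt f (fderiv ℝ f p) p := fun p hp =>
    ((hfs.contDiffAt (hVf.mem_nhds hp.1.1)).differentiableAt (by simp)).hasFDerivAt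
  have hdg : ∀ p ∈ V, HasFDerivAt g (fderiv ℝ g p) p := fun p hp =>
    ((hgs.contDiffAt (hVg.mem_nhds hp.2.1)).differentiableAt (by simp)).hasFDerivAt
  have hf0' : ∀ w, fderiv ℝ f (0, 0) w = w.1 + w.2 := fun w => by
    have := hfint _ h0f
    rw [fderiv_pair_apply _ (s (-1) (0, 0)), this, hf0, hs0]
    simp [add_comm]
  have hg0' : ∀ w, fderiv ℝ g (0, 0) w = w.2 - w.1 := fun w => by
    have := hgint _ h0g
    rw [fderiv_pair_apply _ (s 1 (0, 0)), this, hg0, hs0]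
    simp
  let e : (ℝ × ℝ) ≃L[ℝ] (ℝ × ℝ) := ContinuousLinearEquiv.equivOfInverse
    ((fderiv ℝ f (0, 0)).prod (fderiv ℝ g (0, 0)))
    (((1 / 2 : ℝ) • (ContinuousLinearMap.fst ℝ ℝ ℝ - ContinuousLinearMap.snd ℝ ℝ ℝ)).prod
      ((1 / 2 : ℝ) • (ContinuousLinearMap.fst ℝ ℝ ℝ + ContinuousLinearMap.snd ℝ ℝ ℝ)))
    (fun w => by ext <;> simp [hf0', hg0'] <;> ring) (fun w => by ext <;> simp [hf0', hg0'] <;> ring)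
  have hfgs : ContDiffOn ℝ ∞ (fun p => (f p, g p)) V :=
    (hfs.mono fun p hp => hp.1.1).prodMk (hgs.mono fun p hp => hp.2.1)
  obtain ⟨Θ, h0Θ, hΘV, hΘ, hΘi⟩ := exists_smooth_local_inverse (f' := e) hV hfgs h0V
    ((hdf _ h0V).prodMk (hdg _ h0V))
  have hΘsymm : ∀ z ∈ Θ.target, HasFDerivAt Θ.symm (fderiv ℝ Θ.symm z) z := fun z hz =>
    ((hΘi.contDiffAt (Θ.open_target.mem_nhds hz)).differentiableAt (by simp)).hasFDerivAt
  have hinv : ∀ z ∈ Θ.target, ∀ w, fderiv ℝ f (Θ.symm z) (fderiv ℝ Θ.symm z w) = w.1 ∧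
      fderiv ℝ g (Θ.symm z) (fderiv ℝ Θ.symm z w) = w.2 := by
    intro z hz w
    have hzV := hΘV (Θ.map_target hz)
    have h1 : HasFDerivAt (fun z => (f (Θ.symm z), g (Θ.symm z))) _ z :=
      ((hdf _ hzV).comp z (hΘsymm z hz)).prodMk ((hdg _ hzV).comp z (hΘsymm z hz))
    have h2 : HasFDerivAt (fun z => (f (Θ.symm z), g (Θ.symm z))) (.id ℝ (ℝ × ℝ)) z := by
      refine (hasFDerivAt_id z).congr_of_eventuallyEq ?_
      filter_upwards [Θ.open_target.mem_nhds hz] with y hy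
      have := Θ.right_inv hy
      rw [hΘ] at this
      exact this
    have h3 := DFunLike.congr_fun (h1.unique h2) w
    exact ⟨congrArg Prod.fst h3, congrArg Prod.snd h3⟩
  have hψΘ : ∀ z ∈ Θ.target, ∀ w, fderiv ℝ (ψ ∘ Θ.symm) z w =
      fderiv ℝ ψ (Θ.symm z) (fderiv ℝ Θ.symm z w) := by
    intro z hz w
    have hzD : Θ.symm z ∈ D := hUD (hVfU (hΘV (Θ.map_target hz)).1.1)
    have h1 := ((hψ.contDiffAt (hD.mem_nhds hzD)).differentiableAt (by simp)).hasFDerivAt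
    rw [(h1.comp z (hΘsymm z hz)).fderiv]
    rfl
  have hnull' : ∀ z ∈ Θ.target,
      lor (fderiv ℝ (ψ ∘ Θ.symm) z (1, 0)) (fderiv ℝ (ψ ∘ Θ.symm) z (1, 0)) = 0 ∧
      lor (fderiv ℝ (ψ ∘ Θ.symm) z (0, 1)) (fderiv ℝ (ψ ∘ Θ.symm) z (0, 1)) = 0 := by
    intro z hz
    have hzV := hΘV (Θ.map_target hz)
    have hzU := hVfU hzV.1.1
    constructor
    · rw [hψΘ z hz]
      have h1 := (hinv z hz (1, 0)).2
      generalize fderiv ℝ Θ.symm z (1, 0) = w at h1 ⊢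
      rw [fderiv_pair_apply _ (s 1 (Θ.symm z)), hgint _ hzV.2.1, smul_zero, zero_add,
        smul_eq_mul] at h1
      have h2 := (mul_eq_zero.1 h1).resolve_right hzV.2.2
      rw [fderiv_pair_apply _ (s 1 (Θ.symm z)), h2, zero_smul, add_zero, lor_smul_left,
        lor_smul_right, hnull 1 (by norm_num) _ hzU, mul_zero, mul_zero]
    · rw [hψΘ z hz]
      have h1 := (hinv z hz (0, 1)).1
      generalize fderiv ℝ Θ.symm z (0, 1) = w at h1 ⊢
      rw [fderiv_pair_apply _ (s (-1) (Θ.symm z)), hfint _ hzV.1.1, smul_zero, zero_add,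
        smul_eq_mul] at h1
      have h2 := (mul_eq_zero.1 h1).resolve_right hzV.1.2
      rw [fderiv_pair_apply _ (s (-1) (Θ.symm z)), h2, zero_smul, add_zero, lor_smul_left,
        lor_smul_right, hnull (-1) (by norm_num) _ hzU, mul_zero, mul_zero]
  set z₀ := Θ (0, 0) with hz₀
  have hz₀t : z₀ ∈ Θ.target := Θ.map_source h0Θ
  have hz₀i : Θ.symm z₀ = (0, 0) := Θ.left_inv h0Θ
  -- At the origin f_y = g_y = 1 fixes ∂_u = (1/2, 1/2) and ∂_v = (-1/2, 1/2), with product 1/2.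
  have hpos0 : 0 < lor (fderiv ℝ (ψ ∘ Θ.symm) z₀ (1, 0)) (fderiv ℝ (ψ ∘ Θ.symm) z₀ (0, 1)) := by
    have hw : ∀ w, fderiv ℝ Θ.symm z₀ w = ((w.1 - w.2) / 2, (w.1 + w.2) / 2) := by
      intro w
      have h1 := hinv z₀ hz₀t w
      rw [hz₀i, hf0', hg0'] at h1
      ext
      · simp only; linarith [h1.1, h1.2]
      · simp only; linarith [h1.1, h1.2]
    rw [hψΘ _ hz₀t, hψΘ _ hz₀t, hz₀i, hw, hw, fderiv_pair_apply _ 0,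
      fderiv_pair_apply (fderiv ℝ ψ (0, 0)) 0 ((((0, 1) : ℝ × ℝ).1 - _) / 2, _)]
    simp only [lor_add_left, lor_add_right, lor_smul_left, lor_smul_right, hE, hF, hG, hE0, hF0,
      hG0, lor_comm (fderiv ℝ ψ (0, 0) (0, 1)) (fderiv ℝ ψ (0, 0) (1, 0))]
    norm_num
  have hψΘs : ContDiffOn ℝ ∞ (ψ ∘ Θ.symm) Θ.target :=
    hψ.comp hΘi fun z hz => hUD (hVfU (hΘV (Θ.map_target hz)).1.1)
  have hcont : ContinuousOn (fun z => lor (fderiv ℝ (ψ ∘ Θ.symm) z (1, 0))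
      (fderiv ℝ (ψ ∘ Θ.symm) z (0, 1))) Θ.target := by
    have h1 : ContDiffOn ℝ ∞ (fderiv ℝ (ψ ∘ Θ.symm)) Θ.target :=
      hψΘs.fderiv_of_isOpen Θ.open_target (by simp)
    exact (contDiffOn_lor (h1.clm_apply contDiffOn_const)
      (h1.clm_apply contDiffOn_const)).continuousOn
  obtain ⟨r, hr, hball⟩ := Metric.isOpen_iff.1
    (hcont.isOpen_inter_preimage Θ.open_target isOpen_Ioi) z₀ ⟨hz₀t, hpos0⟩
  have hsub : Metric.ball z₀ r ⊆ Θ.target := fun z hz => (hball hz).1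
  -- The image is cut down to a ball on which the product stays positive; its convexity later gives
  -- simple connectedness.
  refine ⟨(Θ.symm.restrOpen (Metric.ball z₀ r) Metric.isOpen_ball).symm, ?_, ?_, ?_, ?_, ?_, ?_⟩
  · simp [h0Θ, hr, ← hz₀]
  · exact fun p hp => hUD (hVfU (hΘV hp.1).1.1)
  · have h1 := hfgs.mono hΘV
    rw [← hΘ] at h1
    exact h1.mono fun p hp => hp.1
  · exact hΘi.mono fun z hz => hz.1
  · have : Θ.target ∩ Metric.ball z₀ r = Metric.ball z₀ r := inter_eq_self_of_subset_right hsub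
    exact (congrArg (Convex ℝ) this).mpr (convex_ball z₀ r)
  · intro z hz
    exact ⟨(hnull' z hz.1).1, (hnull' z hz.1).2, (hball hz.2).2⟩

/-! ### Null charts on the manifold -/

theorem isSimplyConnected_source_iff {X Y : Type*} [TopologicalSpace X] [TopologicalSpace Y]
    (e : OpenPartialHomeomorph X Y) :
    IsSimplyConnected e.source ↔ IsSimplyConnected e.target :=
  e.toHomeomorphSourceTarget.toHomotopyEquiv.simplyConnectedSpace_iff

theorem isSimplyConnected_of_convex {E : Type*} [NormedAddCommGroup E] [NormedSpace ℝ E]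
    {s : Set E} (hs : Convex ℝ s) (hne : s.Nonempty) : IsSimplyConnected s := by
  have := hs.contractibleSpace hne
  exact SimplyConnectedSpace.ofContractible s

section Charts

variable {M : Type*} [TopologicalSpace M] [ChartedSpace Plane M]
  {e : OpenPartialHomeomorph M Plane} (he : e ∈ IsManifold.maximalAtlas (𝓡 2) ∞ M)
  {E : Type*} [NormedAddCommGroup E] [NormedSpace ℝ E]

include he

theorem contDiffOn_comp_chart_symm {f : M → E} (hf : ContMDiffOn (𝓡 2) 𝓘(ℝ, E) ∞ f e.source) :
    ContDiffOn ℝ ∞ (f ∘ e.symm) e.target := by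
  rw [← contMDiffOn_iff_contDiffOn]
  exact hf.comp (contMDiffOn_symm_of_mem_maximalAtlas he) fun x hx => e.map_target hx

theorem contMDiffOn_comp_chart {g : Plane → E} (hg : ContDiffOn ℝ ∞ g e.target) :
    ContMDiffOn (𝓡 2) 𝓘(ℝ, E) ∞ (g ∘ e) e.source :=
  (contMDiffOn_iff_contDiffOn.2 hg).comp (contMDiffOn_of_mem_maximalAtlas he)
    fun _ hx => e.map_source hx

theorem chart_mdifferentiable : e.MDifferentiable (𝓡 2) (𝓡 2) :=
  ⟨(contMDiffOn_of_mem_maximalAtlas he).mdifferentiableOn (by simp),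
    (contMDiffOn_symm_of_mem_maximalAtlas he).mdifferentiableOn (by simp)⟩

theorem diff_eq_fderiv_chart {f : M → E31} {q : M} (hq : q ∈ e.source)
    (hf : DifferentiableAt ℝ (f ∘ e.symm) (e q)) (X : TangentSpace (𝓡 2) q) :
    diff f q X = fderiv ℝ (f ∘ e.symm) (e q) (mfderiv (𝓡 2) (𝓡 2) e q X) := by
  have h1 : f =ᶠ[𝓝 q] (f ∘ e.symm) ∘ e := by
    filter_upwards [e.open_source.mem_nhds hq] with y hy
    simp [e.left_inv hy]
  rw [diff, h1.mfderiv_eq, mfderiv_comp q hf.mdifferentiableAt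
    ((chart_mdifferentiable he).mdifferentiableAt hq), mfderiv_eq_fderiv]
  rfl

theorem trans_mem_maximalAtlas [IsManifold (𝓡 2) ∞ M] {S : OpenPartialHomeomorph Plane Plane}
    (hS : ContDiffOn ℝ ∞ S S.source) (hS' : ContDiffOn ℝ ∞ S.symm S.target) :
    e.trans S ∈ IsManifold.maximalAtlas (𝓡 2) ∞ M := by
  refine OpenPartialHomeomorph.mem_maximalAtlas_of_contMDiffOn _ ?_ ?_
  · exact (contMDiffOn_iff_contDiffOn.2 hS).comp
      ((contMDiffOn_of_mem_maximalAtlas he).mono fun x hx => hx.1) fun x hx => hx.2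
  · exact (contMDiffOn_symm_of_mem_maximalAtlas he).comp
      ((contMDiffOn_iff_contDiffOn.2 hS').mono fun x hx => hx.1) fun x hx => hx.2

end Charts

/-- The identification of `ℝ × ℝ` with the model plane. -/
def planeEquiv : (ℝ × ℝ) ≃L[ℝ] Plane :=
  ((EuclideanSpace.equiv (Fin 2) ℝ).trans (ContinuousLinearEquiv.finTwoArrow ℝ ℝ)).symm

theorem planeEquiv_symm_zero : planeEquiv.symm (stdVec 0) = (1, 0) := by
  ext <;> simp [planeEquiv, stdVec]

theorem planeEquiv_symm_one : planeEquiv.symm (stdVec 1) = (0, 1) := by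
  ext <;> simp [planeEquiv, stdVec]

/-- The affine parametrization `(a, b) ↦ c + a X + b Y` by a basis, inverted. -/
def affineCoord (c : Plane) (L : (ℝ × ℝ) ≃L[ℝ] Plane) : Plane ≃ₜ ℝ × ℝ :=
  (Homeomorph.addRight (-c)).trans L.symm.toHomeomorph

/-- The Gram matrix diag(-1, 1) is nondegenerate, so X and Y are independent, hence a basis. -/
theorem exists_equiv_of_lorentz_pair (T : Plane →L[ℝ] E31) {X Y : Plane}
    (hX : lor (T X) (T X) = -1) (hY : lor (T Y) (T Y) = 1) (hXY : lor (T X) (T Y) = 0) :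
    ∃ L : (ℝ × ℝ) ≃L[ℝ] Plane, ∀ w, L w = w.1 • X + w.2 • Y := by
  let L₀ : ℝ × ℝ →ₗ[ℝ] Plane :=
    (LinearMap.fst ℝ ℝ ℝ).smulRight X + (LinearMap.snd ℝ ℝ ℝ).smulRight Y
  have hL₀ : ∀ w, L₀ w = w.1 • X + w.2 • Y := fun w => rfl
  have hinj : Function.Injective L₀ := by
    refine (injective_iff_map_eq_zero L₀).2 fun w hw => ?_
    rw [hL₀] at hw
    have h1 : w.1 • T X + w.2 • T Y = 0 := by rw [← map_smul, ← map_smul, ← map_add, hw, map_zero]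
    have h2 : lor (T X) (w.1 • T X + w.2 • T Y) = 0 := by rw [h1]; simp [lor]
    have h3 : lor (T Y) (w.1 • T X + w.2 • T Y) = 0 := by rw [h1]; simp [lor]
    rw [lor_add_right, lor_smul_right, lor_smul_right, hX, hXY] at h2
    rw [lor_add_right, lor_smul_right, lor_smul_right, lor_comm, hXY, hY] at h3
    ext
    · simp only [Prod.fst_zero]; linarith
    · simp only [Prod.snd_zero]; linarith
  have hdim : Module.finrank ℝ (ℝ × ℝ) = Module.finrank ℝ Plane := by simp
  exact ⟨(LinearEquiv.ofInjectiveOfFinrankEq L₀ hinj hdim).toContinuousLinearEquiv, fun w => rfl⟩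

/-- Every point of a timelike surface lies in a simply connected null coordinate region. -/
theorem exists_nullChart {M : Type*} [TopologicalSpace M] [ChartedSpace Plane M]
    [IsManifold (𝓡 2) ∞ M] {φ N : M → E31} (hφ : IsTimelikeOn φ N univ) (p : M) :
    ∃ e : OpenPartialHomeomorph M Plane,
      p ∈ e.source ∧ IsNullChart φ e ∧ IsSimplyConnected e.source := by
  set c := chartAt Plane p
  have hc : c ∈ IsManifold.maximalAtlas (𝓡 2) ∞ M := IsManifold.chart_mem_maximalAtlas p
  have hpc : p ∈ c.source := mem_chart_source Plane p
  have hψ₀ : ContDiffOn ℝ ∞ (φ ∘ c.symm) c.target :=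
    contDiffOn_comp_chart_symm hc (hφ.smooth.mono (subset_univ _))
  have hd₀ : DifferentiableAt ℝ (φ ∘ c.symm) (c p) :=
    (hψ₀.contDiffAt (c.open_target.mem_nhds (c.map_source hpc))).differentiableAt (by simp)
  obtain ⟨X, Y, hX, hY, hXY⟩ := hφ.lorentzian p (mem_univ p)
  simp only [firstForm, diff_eq_fderiv_chart hc hpc hd₀] at hX hY hXY
  obtain ⟨X', hX'⟩ : ∃ X' : Plane, X' = mfderiv (𝓡 2) (𝓡 2) c p X := ⟨_, rfl⟩
  obtain ⟨Y', hY'⟩ : ∃ Y' : Plane, Y' = mfderiv (𝓡 2) (𝓡 2) c p Y := ⟨_, rfl⟩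
  rw [← hX'] at hX hXY
  rw [← hY'] at hY hXY
  -- Affine coordinates adapted to an orthonormal pair at p bring the metric at the origin to
  -- diag(-1, 1), the normalization required by `exists_null_coordinates`.
  obtain ⟨L, hL⟩ := exists_equiv_of_lorentz_pair (fderiv ℝ (φ ∘ c.symm) (c p)) hX hY hXY
  have hℓ : ∀ w, (affineCoord (c p) L).symm w = L w + c p := fun w => by
    change L w + -(-c p) = _
    rw [neg_neg]
  have hℓ' : ∀ x, affineCoord (c p) L x = L.symm (x - c p) := fun x => by
    simp [affineCoord, sub_eq_add_neg]
  have hℓ0 : (affineCoord (c p) L).symm (0, 0) = c p := by rw [hℓ, hL]; simp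
  have hℓs : ContDiff ℝ ∞ (affineCoord (c p) L).symm := by
    rw [show ⇑(affineCoord (c p) L).symm = fun w => L w + c p from funext hℓ]; fun_prop
  have hℓs' : ContDiff ℝ ∞ (affineCoord (c p) L) := by
    rw [show ⇑(affineCoord (c p) L) = fun w => L.symm (w - c p) from funext hℓ']; fun_prop
  set ψ : ℝ × ℝ → E31 := (φ ∘ c.symm) ∘ (affineCoord (c p) L).symm with hψ
  set D : Set (ℝ × ℝ) := (affineCoord (c p) L).symm ⁻¹' c.target
  have hD : IsOpen D := c.open_target.preimage (affineCoord (c p) L).symm.continuous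
  have h0D : (0, 0) ∈ D := by
    change (affineCoord (c p) L).symm (0, 0) ∈ c.target
    rw [hℓ0]; exact c.map_source hpc
  have hψs : ContDiffOn ℝ ∞ ψ D := hψ₀.comp hℓs.contDiffOn fun _ h => h
  have hdψ : ∀ w, fderiv ℝ ψ (0, 0) w = fderiv ℝ (φ ∘ c.symm) (c p) (w.1 • X' + w.2 • Y') := by
    intro w
    have h1 : HasFDerivAt (affineCoord (c p) L).symm (L : ℝ × ℝ →L[ℝ] Plane) (0, 0) := by
      rw [show ⇑(affineCoord (c p) L).symm = fun w => L w + c p from funext hℓ]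
      exact L.hasFDerivAt.add_const _
    have h2 : HasFDerivAt (φ ∘ c.symm) (fderiv ℝ (φ ∘ c.symm) (c p))
        ((affineCoord (c p) L).symm (0, 0)) := by rw [hℓ0]; exact hd₀.hasFDerivAt
    rw [hψ, (h2.comp _ h1).fderiv, ← hL, ContinuousLinearMap.comp_apply]
    rfl
  obtain ⟨Θ, h0Θ, hΘD, hΘs, hΘs', hconv, hnull⟩ := exists_null_coordinates hD h0D hψs
    (by simpa [hdψ] using hX) (by simpa [hdψ] using hXY) (by simpa [hdψ] using hY)
  let S : OpenPartialHomeomorph Plane Plane :=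
    ((affineCoord (c p) L).toOpenPartialHomeomorph.trans Θ).trans
      planeEquiv.toHomeomorph.toOpenPartialHomeomorph
  have hSs : ContDiffOn ℝ ∞ S S.source :=
    planeEquiv.contDiff.comp_contDiffOn (hΘs.comp hℓs'.contDiffOn fun x hx => hx.1.2)
  have hSs' : ContDiffOn ℝ ∞ S.symm S.target :=
    hℓs.comp_contDiffOn (hΘs'.comp planeEquiv.symm.contDiff.contDiffOn fun x hx => hx.2.1)
  have htarget : ∀ x ∈ (c.trans S).target, planeEquiv.symm x ∈ Θ.target := fun x hx => hx.1.2.1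
  have hcomp : φ ∘ (c.trans S).symm = (ψ ∘ Θ.symm) ∘ planeEquiv.symm := rfl
  have hcd : ∀ q i, coordDeriv (c.trans S) i φ q =
      fderiv ℝ (ψ ∘ Θ.symm) (planeEquiv.symm ((c.trans S) q)) (planeEquiv.symm (stdVec i)) := by
    intro q i
    rw [coordDeriv, hcomp, ContinuousLinearEquiv.comp_right_fderiv]
    rfl
  have hmt : ∀ q ∈ (c.trans S).source, planeEquiv.symm ((c.trans S) q) ∈ Θ.target :=
    fun q hq => htarget _ ((c.trans S).map_source hq)
  have hp : p ∈ (c.trans S).source := by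
    refine ⟨hpc, ⟨⟨mem_univ _, ?_⟩, mem_univ _⟩⟩
    change affineCoord (c p) L (c p) ∈ Θ.source
    rw [hℓ', sub_self, map_zero]
    exact h0Θ
  refine ⟨c.trans S, hp, ⟨trans_mem_maximalAtlas hc hSs hSs', ?_, ?_, ?_⟩, ?_⟩
  · intro q hq
    rw [hcd, planeEquiv_symm_zero]
    exact (hnull _ (hmt q hq)).1
  · intro q hq
    rw [hcd, planeEquiv_symm_one]
    exact (hnull _ (hmt q hq)).2.1
  · intro q hq
    rw [hcd, hcd, planeEquiv_symm_zero, planeEquiv_symm_one]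
    exact (hnull _ (hmt q hq)).2.2
  · rw [isSimplyConnected_source_iff]
    have : (c.trans S).target = planeEquiv.symm ⁻¹' Θ.target := by
      refine Subset.antisymm htarget fun x hx => ?_
      exact ⟨⟨mem_univ _, ⟨hx, mem_univ _⟩⟩, hΘD (Θ.map_target hx)⟩
    rw [this]
    refine isSimplyConnected_of_convex
      (hconv.is_linear_preimage (f := planeEquiv.symm) ⟨map_add _, map_smul _⟩) ?_
    exact ⟨planeEquiv (Θ (0, 0)), by simpa using Θ.map_source h0Θ⟩

/-! ### Null frames and the equations of Gauss and Codazzi -/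

/-- `X`, `Y` are null vectors with `⟨X, Y⟩ = ρ`, and `N` is a unit normal to their span. -/
structure IsNullFrame (ρ : ℝ) (X Y N : E31) : Prop where
  xx : lor X X = 0
  yy : lor Y Y = 0
  xy : lor X Y = ρ
  xn : lor X N = 0
  yn : lor Y N = 0
  nn : lor N N = 1

/-- The right side is minus the Gram determinant; the sign is the determinant of the Lorentzian
form. -/
theorem vol_sq (X Y N : E31) : vol X Y N ^ 2 =
    lor X X * lor Y N ^ 2 + lor Y Y * lor X N ^ 2 + lor N N * lor X Y ^ 2
      - lor X X * lor Y Y * lor N N - 2 * lor X Y * lor Y N * lor X N := by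
  simp only [vol, lor, Matrix.det_fin_three, Matrix.of_apply, Matrix.cons_val]
  ring

namespace IsNullFrame

variable {ρ : ℝ} {X Y N : E31}

theorem vol_sq_eq (h : IsNullFrame ρ X Y N) : vol X Y N ^ 2 = ρ ^ 2 := by
  rw [vol_sq, h.xx, h.yy, h.xy, h.xn, h.yn, h.nn]; ring

theorem eq_zero_of_orthogonal (h : IsNullFrame ρ X Y N) (hρ : ρ ≠ 0) {V : E31}
    (hX : lor V X = 0) (hY : lor V Y = 0) (hN : lor V N = 0) : V = 0 := by
  have hdet : (Matrix.of ![X, Y, N]).det ≠ 0 := fun h0 => by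
    have h1 := h.vol_sq_eq
    rw [vol, h0] at h1
    exact hρ (pow_eq_zero_iff two_ne_zero |>.1 (by linarith))
  -- Changing the sign of the time component lowers the index, turning Lorentzian orthogonality into
  -- a matrix equation.
  have h1 := Matrix.eq_zero_of_mulVec_eq_zero hdet (v := ![-V 0, V 1, V 2]) (by
    simp only [lor] at hX hY hN
    ext i
    fin_cases i
    · simp [Matrix.mulVec, dotProduct, Fin.sum_univ_three]; linarith
    · simp [Matrix.mulVec, dotProduct, Fin.sum_univ_three]; linarith
    · simp [Matrix.mulVec, dotProduct, Fin.sum_univ_three]; linarith)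
  ext i
  fin_cases i
  · simpa using congrFun h1 0
  · simpa using congrFun h1 1
  · simpa using congrFun h1 2

/-- In a null basis the dual of X is Y/ρ, so the coefficient of X is read off with Y and conversely.
-/
theorem expand (h : IsNullFrame ρ X Y N) (hρ : ρ ≠ 0) (V : E31) :
    V = (lor V Y / ρ) • X + (lor V X / ρ) • Y + lor V N • N := by
  refine sub_eq_zero.1 (h.eq_zero_of_orthogonal hρ ?_ ?_ ?_) <;>
  · rw [sub_eq_add_neg, ← neg_one_smul ℝ]
    simp only [lor_add_left, lor_smul_left, h.xx, h.yy, h.xy, h.xn, h.yn, h.nn, lor_comm Y X,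
      lor_comm N X, lor_comm N Y]
    field_simp
    ring

theorem expand_of_eq (h : IsNullFrame ρ X Y N) (hρ : ρ ≠ 0) {V : E31} {a b c : ℝ}
    (hX : lor V X = a) (hY : lor V Y = b) (hN : lor V N = c) :
    V = (b / ρ) • X + (a / ρ) • Y + c • N := by
  rw [← hX, ← hY, ← hN]; exact h.expand hρ V

end IsNullFrame

/-- Partial derivative on the model plane. -/
def pd {F : Type*} [NormedAddCommGroup F] [NormedSpace ℝ F] (i : Fin 2) (f : Plane → F)
    (x : Plane) : F := fderiv ℝ f x (stdVec i)

theorem plane_eq (h : Plane) : h = h 0 • stdVec 0 + h 1 • stdVec 1 := by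
  ext i; fin_cases i <;> simp [stdVec]

section Calculus

variable {F : Type*} [NormedAddCommGroup F] [NormedSpace ℝ F] {i : Fin 2} {x : Plane} {D : Set Plane}

theorem fderiv_eq_pd (f : Plane → F) (x h : Plane) :
    fderiv ℝ f x h = h 0 • pd 0 f x + h 1 • pd 1 f x := by
  conv_lhs => rw [plane_eq h]
  rw [map_add, map_smul, map_smul]
  rfl

theorem contDiffOn_pd (hD : IsOpen D) {f : Plane → F} (hf : ContDiffOn ℝ ∞ f D) (i : Fin 2) :
    ContDiffOn ℝ ∞ (pd i f) D :=
  (hf.fderiv_of_isOpen hD (by simp)).clm_apply contDiffOn_const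

theorem differentiableAt_of_contDiffOn (hD : IsOpen D) {f : Plane → F}
    (hf : ContDiffOn ℝ ∞ f D) (hx : x ∈ D) : DifferentiableAt ℝ f x :=
  (hf.contDiffAt (hD.mem_nhds hx)).differentiableAt (by simp)

theorem pd_comm (hD : IsOpen D) {f : Plane → F} (hf : ContDiffOn ℝ ∞ f D) (hx : x ∈ D) :
    pd 0 (pd 1 f) x = pd 1 (pd 0 f) x := by
  have h1 : ContDiffAt ℝ ∞ f x := hf.contDiffAt (hD.mem_nhds hx)
  have h2 : DifferentiableAt ℝ (fderiv ℝ f) x :=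
    (h1.fderiv_right (m := ∞) (by simp)).differentiableAt (by simp)
  have h3 : ∀ i j, pd i (pd j f) x = fderiv ℝ (fderiv ℝ f) x (stdVec i) (stdVec j) := by
    intro i j
    change fderiv ℝ (fun y => fderiv ℝ f y (stdVec j)) x (stdVec i) = _
    rw [fderiv_clm_apply h2 (differentiableAt_const _)]
    simp
  rw [h3, h3]
  exact h1.isSymmSndFDerivAt (by simp; norm_cast) _ _

theorem pd_congr (hD : IsOpen D) {f g : Plane → F} (h : EqOn f g D) (hx : x ∈ D) :
    pd i f x = pd i g x := by
  rw [pd, pd, (h.eventuallyEq_of_mem (hD.mem_nhds hx)).fderiv_eq]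

theorem pd_add {f g : Plane → F} (hf : DifferentiableAt ℝ f x) (hg : DifferentiableAt ℝ g x) :
    pd i (fun y => f y + g y) x = pd i f x + pd i g x := by
  simp only [pd, fderiv_fun_add hf hg]; rfl

theorem pd_smul {c : Plane → ℝ} {f : Plane → F} (hc : DifferentiableAt ℝ c x)
    (hf : DifferentiableAt ℝ f x) :
    pd i (fun y => c y • f y) x = c x • pd i f x + pd i c x • f x := by
  simp only [pd, fderiv_fun_smul hc hf]; rfl

theorem pd_const (c : F) : pd i (fun _ => c) x = 0 := by simp [pd]

theorem pd_neg (f : Plane → F) : pd i (fun y => -f y) x = -pd i f x := by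
  simp only [pd, fderiv_fun_neg]; rfl

theorem pd_const_mul {f : Plane → ℝ} (hf : DifferentiableAt ℝ f x) (c : ℝ) :
    pd i (fun y => c * f y) x = c * pd i f x := by
  simp only [pd, fderiv_const_mul hf]; rfl

theorem pd_mul {f g : Plane → ℝ} (hf : DifferentiableAt ℝ f x) (hg : DifferentiableAt ℝ g x) :
    pd i (fun y => f y * g y) x = f x * pd i g x + pd i f x * g x :=
  pd_smul hf hg

theorem pd_div {f g : Plane → ℝ} (hf : DifferentiableAt ℝ f x) (hg : DifferentiableAt ℝ g x)
    (h0 : g x ≠ 0) :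
    pd i (fun y => f y / g y) x = (pd i f x * g x - f x * pd i g x) / g x ^ 2 := by
  have h1 : DifferentiableAt ℝ (fun y => f y / g y) x := by
    simp only [div_eq_mul_inv]
    exact hf.fun_mul (hg.fun_inv h0)
  have h2 : (fun y => f y / g y * g y) =ᶠ[𝓝 x] f := by
    filter_upwards [hg.continuousAt.eventually_ne h0] with y hy
    exact div_mul_cancel₀ _ hy
  have h3 : pd i (fun y => f y / g y * g y) x = pd i f x := by rw [pd, pd, h2.fderiv_eq]
  rw [pd_mul h1 hg] at h3
  field_simp at h3 ⊢
  linarith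

theorem pd_lor {f g : Plane → E31} (hf : DifferentiableAt ℝ f x) (hg : DifferentiableAt ℝ g x) :
    pd i (fun y => lor (f y) (g y)) x = lor (f x) (pd i g x) + lor (pd i f x) (g x) := by
  simp only [← lorBilin_apply, pd]
  have h1 : HasFDerivAt (fun y => lorBilin (f y) (g y)) _ x :=
    (lorBilin.hasFDerivAt.comp x hf.hasFDerivAt).clm_apply hg.hasFDerivAt
  rw [h1.fderiv]
  rfl

theorem pd_pi {ι : Type*} [Fintype ι] {f : Plane → ι → F} (hf : DifferentiableAt ℝ f x) (j : ι) :
    pd i f x j = pd i (fun y => f y j) x := by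
  rw [pd, pd, show (fun y => f y j) = ContinuousLinearMap.proj (R := ℝ) j ∘ f from rfl,
    fderiv_comp x (ContinuousLinearMap.differentiableAt _) hf, ContinuousLinearMap.fderiv]
  rfl

end Calculus

section Structure

variable {D : Set Plane} {X Y N : Plane → E31} {ρ : Plane → ℝ}

/-- Derivatives of a null frame field `X = ψ_u`, `Y = ψ_v`, `N`: the Gauss and Weingarten
equations. -/
theorem IsNullFrame.structure_equations (hD : IsOpen D) (hX : ContDiffOn ℝ ∞ X D)
    (hY : ContDiffOn ℝ ∞ Y D) (hN : ContDiffOn ℝ ∞ N D)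
    (hF : ∀ x ∈ D, IsNullFrame (ρ x) (X x) (Y x) (N x)) (hρ : ∀ x ∈ D, ρ x ≠ 0)
    (hXY : ∀ x ∈ D, pd 0 Y x = pd 1 X x) {x : Plane} (hx : x ∈ D) :
    pd 0 X x = (pd 0 ρ x / ρ x) • X x + lor (pd 0 X x) (N x) • N x ∧
    pd 1 X x = lor (pd 1 X x) (N x) • N x ∧
    pd 1 Y x = (pd 1 ρ x / ρ x) • Y x + lor (pd 1 Y x) (N x) • N x ∧
    pd 0 N x = (-lor (pd 1 X x) (N x) / ρ x) • X x + (-lor (pd 0 X x) (N x) / ρ x) • Y x ∧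
    pd 1 N x = (-lor (pd 1 Y x) (N x) / ρ x) • X x + (-lor (pd 1 X x) (N x) / ρ x) • Y x := by
  have dX := differentiableAt_of_contDiffOn hD hX hx
  have dY := differentiableAt_of_contDiffOn hD hY hx
  have dN := differentiableAt_of_contDiffOn hD hN hx
  have key : ∀ {f g : Plane → E31} {c : Plane → ℝ} (i : Fin 2), DifferentiableAt ℝ f x →
      DifferentiableAt ℝ g x → (∀ y ∈ D, lor (f y) (g y) = c y) →
      lor (f x) (pd i g x) + lor (pd i f x) (g x) = pd i c x := fun i hf hg h => by
    rw [← pd_lor hf hg]; exact pd_congr hD h hx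
  have xx := fun i => key i dX dX fun y hy => (hF y hy).xx
  have yy := fun i => key i dY dY fun y hy => (hF y hy).yy
  have nn := fun i => key i dN dN fun y hy => (hF y hy).nn
  have xy := fun i => key i dX dY fun y hy => (hF y hy).xy
  have xn := fun i => key i dX dN fun y hy => (hF y hy).xn
  have yn := fun i => key i dY dN fun y hy => (hF y hy).yn
  simp only [pd_const] at xx yy nn xn yn
  have eXY := hXY x hx
  have xx' : ∀ i, lor (pd i X x) (X x) = 0 := fun i => by
    have := xx i; rw [lor_comm (X x)] at this; linarith
  have yy' : ∀ i, lor (pd i Y x) (Y x) = 0 := fun i => by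
    have := yy i; rw [lor_comm (Y x)] at this; linarith
  have nn' : ∀ i, lor (pd i N x) (N x) = 0 := fun i => by
    have := nn i; rw [lor_comm (N x)] at this; linarith
  have xn' : ∀ i, lor (pd i N x) (X x) = -lor (pd i X x) (N x) := fun i => by
    have := xn i; rw [lor_comm (X x)] at this; linarith
  have yn' : ∀ i, lor (pd i N x) (Y x) = -lor (pd i Y x) (N x) := fun i => by
    have := yn i; rw [lor_comm (Y x)] at this; linarith
  -- The symmetry Y_u = X_v transfers nullity: ⟨X_v, X⟩ and ⟨X_v, Y⟩ = ⟨Y_u, Y⟩ both vanish, so the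
  -- mixed derivative is purely normal.
  have y0x : lor (X x) (pd 0 Y x) = 0 := by rw [eXY, lor_comm]; exact xx' 1
  have x1y : lor (pd 1 X x) (Y x) = 0 := by rw [← eXY]; exact yy' 0
  have x0y : lor (pd 0 X x) (Y x) = pd 0 ρ x := by have := xy 0; rw [y0x] at this; linarith
  have y1x : lor (pd 1 Y x) (X x) = pd 1 ρ x := by
    have := xy 1; rw [x1y, lor_comm] at this; linarith
  have hfr := hF x hx
  have h0 := hρ x hx
  refine ⟨?_, ?_, ?_, ?_, ?_⟩
  · simpa using hfr.expand_of_eq h0 (xx' 0) x0y rfl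
  · simpa using hfr.expand_of_eq h0 (xx' 1) x1y rfl
  · simpa using hfr.expand_of_eq h0 y1x (yy' 1) rfl
  · have := hfr.expand_of_eq h0 (xn' 0) (yn' 0) (nn' 0)
    rw [eXY] at this
    simpa using this
  · simpa using hfr.expand_of_eq h0 (xn' 1) (yn' 1) (nn' 1)

end Structure

/-- The equations of Gauss and Codazzi for a null frame field whose mean curvature `H` is
constant. -/
theorem gauss_codazzi {D : Set Plane} {ψ N : Plane → E31} {ρ Q R : Plane → ℝ} {H : ℝ}
    (hD : IsOpen D) (hψ : ContDiffOn ℝ ∞ ψ D) (hN : ContDiffOn ℝ ∞ N D)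
    (hρs : ContDiffOn ℝ ∞ ρ D) (hQs : ContDiffOn ℝ ∞ Q D) (hRs : ContDiffOn ℝ ∞ R D)
    (hF : ∀ x ∈ D, IsNullFrame (ρ x) (pd 0 ψ x) (pd 1 ψ x) (N x)) (hρ : ∀ x ∈ D, ρ x ≠ 0)
    (h00 : ∀ x ∈ D, pd 0 (pd 0 ψ) x = (pd 0 ρ x / ρ x) • pd 0 ψ x + Q x • N x)
    (h10 : ∀ x ∈ D, pd 1 (pd 0 ψ) x = (H * ρ x) • N x)
    (h11 : ∀ x ∈ D, pd 1 (pd 1 ψ) x = (pd 1 ρ x / ρ x) • pd 1 ψ x + R x • N x)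
    (h0 : ∀ x ∈ D, pd 0 N x = -H • pd 0 ψ x + (-(Q x / ρ x)) • pd 1 ψ x)
    (h1 : ∀ x ∈ D, pd 1 N x = (-(R x / ρ x)) • pd 0 ψ x + -H • pd 1 ψ x)
    {x : Plane} (hx : x ∈ D) :
    pd 1 (fun y => pd 0 ρ y / ρ y) x = Q x * R x / ρ x - H ^ 2 * ρ x ∧
    pd 0 (fun y => pd 1 ρ y / ρ y) x = Q x * R x / ρ x - H ^ 2 * ρ x ∧
    pd 1 Q x = 0 ∧ pd 0 R x = 0 := by
  have h01 : ∀ x ∈ D, pd 0 (pd 1 ψ) x = (H * ρ x) • N x := fun x hx => by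
    rw [pd_comm hD hψ hx, h10 x hx]
  have hX := contDiffOn_pd hD hψ 0
  have hY := contDiffOn_pd hD hψ 1
  have dX := differentiableAt_of_contDiffOn hD hX hx
  have dY := differentiableAt_of_contDiffOn hD hY hx
  have dN := differentiableAt_of_contDiffOn hD hN hx
  have dρ := differentiableAt_of_contDiffOn hD hρs hx
  have dQ := differentiableAt_of_contDiffOn hD hQs hx
  have dR := differentiableAt_of_contDiffOn hD hRs hx
  have da : ∀ i, DifferentiableAt ℝ (fun y => pd i ρ y / ρ y) x := fun i =>
    differentiableAt_of_contDiffOn hD ((contDiffOn_pd hD hρs i).div hρs hρ) hx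
  have dHρ : DifferentiableAt ℝ (fun y => H * ρ y) x := dρ.const_mul H
  have hfr := hF x hx
  have hne := hρ x hx
  -- The integrability conditions come from ψ_uuv = ψ_uvu and ψ_vuv = ψ_vvu. Pairing the first with
  -- ψ_v and the second with ψ_u gives Gauss; pairing with N gives Codazzi, where constancy of H
  -- leaves no derivative of H.
  have e1 : pd 1 (pd 0 (pd 0 ψ)) x = pd 0 (pd 1 (pd 0 ψ)) x := (pd_comm hD hX hx).symm
  have e2 : pd 1 (pd 0 (pd 1 ψ)) x = pd 0 (pd 1 (pd 1 ψ)) x := (pd_comm hD hY hx).symm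
  rw [pd_congr hD h00 hx, pd_congr hD h10 hx, pd_add (g := fun y => Q y • N y) ((da 0).fun_smul dX) (dQ.fun_smul dN),
    pd_smul (da 0) dX, pd_smul dQ dN, pd_smul dHρ dN, pd_const_mul dρ, h10 x hx, h1 x hx,
    h0 x hx] at e1
  rw [pd_congr hD h01 hx, pd_congr hD h11 hx, pd_add (g := fun y => R y • N y) ((da 1).fun_smul dY) (dR.fun_smul dN),
    pd_smul (da 1) dY, pd_smul dR dN, pd_smul dHρ dN, pd_const_mul dρ, h01 x hx, h1 x hx,
    h0 x hx] at e2
  have e1Y := congrArg (fun V => lor V (pd 1 ψ x)) e1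
  have e1N := congrArg (fun V => lor V (N x)) e1
  have e2X := congrArg (fun V => lor V (pd 0 ψ x)) e2
  have e2N := congrArg (fun V => lor V (N x)) e2
  simp only [lor_add_left, lor_smul_left, hfr.xx, hfr.yy, hfr.xy, hfr.xn, hfr.yn, hfr.nn,
    lor_comm (pd 1 ψ x) (pd 0 ψ x), lor_comm (N x) (pd 0 ψ x), lor_comm (N x) (pd 1 ψ x)]
    at e1Y e1N e2X e2N
  refine ⟨?_, ?_, ?_, ?_⟩
  · refine mul_right_cancel₀ hne ?_
    field_simp at e1Y ⊢
    linarith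
  · refine mul_right_cancel₀ hne ?_
    field_simp at e2X ⊢
    linarith
  · simp only [mul_zero, add_zero, mul_one] at e1N
    field_simp at e1N
    linarith
  · simp only [mul_zero, add_zero, mul_one] at e2N
    field_simp at e2N
    linarith

/-! ### The Gauss–Weingarten system as a flat linear system -/

/-- The action of a coefficient matrix on a tuple of vectors of Minkowski space. -/
def coeffAct : (Fin 4 → Fin 4 → ℝ) →L[ℝ] (Fin 4 → E31) →L[ℝ] (Fin 4 → E31) :=
  LinearMap.toContinuousLinearMap
    { toFun := fun c => ContinuousLinearMap.pi fun i => ∑ j, c i j • ContinuousLinearMap.proj j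
      map_add' := fun c d => by
        ext y i : 2
        simp [add_smul, Finset.sum_add_distrib]
      map_smul' := fun t c => by
        ext y i : 2
        simp [mul_smul, Finset.smul_sum] }

theorem coeffAct_apply (c : Fin 4 → Fin 4 → ℝ) (y : Fin 4 → E31) (i : Fin 4) :
    coeffAct c y i = ∑ j, c i j • y j := by
  simp [coeffAct]

theorem coeffAct_mul (c d : Fin 4 → Fin 4 → ℝ) :
    coeffAct c * coeffAct d = coeffAct fun i k => ∑ j, c i j * d j k := by
  ext y i : 2
  change coeffAct c (coeffAct d y) i = _
  simp only [coeffAct_apply, Finset.smul_sum, Finset.sum_smul, mul_smul]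
  exact Finset.sum_comm

/-- The Lie algebra valued one-form `U du + V dv`. -/
def planeForm {𝔸 : Type*} [NormedAddCommGroup 𝔸] [NormedSpace ℝ 𝔸] (U V : 𝔸) : Plane →L[ℝ] 𝔸 :=
  ContinuousLinearMap.smulRightL ℝ Plane 𝔸 (EuclideanSpace.proj 0) U +
    ContinuousLinearMap.smulRightL ℝ Plane 𝔸 (EuclideanSpace.proj 1) V

theorem planeForm_apply {𝔸 : Type*} [NormedAddCommGroup 𝔸] [NormedSpace ℝ 𝔸] (U V : 𝔸)
    (h : Plane) : planeForm U V h = h 0 • U + h 1 • V := rfl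

theorem ContDiffOn.planeForm {𝔸 W : Type*} [NormedAddCommGroup 𝔸] [NormedSpace ℝ 𝔸]
    [NormedAddCommGroup W] [NormedSpace ℝ W] {U V : W → 𝔸} {s : Set W} {n : WithTop ℕ∞}
    (hU : ContDiffOn ℝ n U s) (hV : ContDiffOn ℝ n V s) :
    ContDiffOn ℝ n (fun x => planeForm (U x) (V x)) s :=
  ((ContinuousLinearMap.contDiff _).comp_contDiffOn hU).add
    ((ContinuousLinearMap.contDiff _).comp_contDiffOn hV)

/-- The zero curvature condition in coordinates. -/
theorem isFlatOn_planeForm {𝔸 : Type} [NormedRing 𝔸] [NormedAlgebra ℝ 𝔸] {D : Set Plane}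
    {U V : Plane → 𝔸} (hU : ∀ x ∈ D, DifferentiableAt ℝ U x)
    (hV : ∀ x ∈ D, DifferentiableAt ℝ V x)
    (h : ∀ x ∈ D, pd 0 V x + V x * U x = pd 1 U x + U x * V x) :
    IsFlatOn (fun x => planeForm (U x) (V x)) D := by
  intro x hx v w
  have h1 : HasFDerivAt (fun x => planeForm (U x) (V x)) _ x :=
    ((ContinuousLinearMap.hasFDerivAt _).comp x (hU x hx).hasFDerivAt).add
    ((ContinuousLinearMap.hasFDerivAt _).comp x (hV x hx).hasFDerivAt)
  have h2 : ∀ v w, fderiv ℝ (fun x => planeForm (U x) (V x)) x v w =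
      w 0 • fderiv ℝ U x v + w 1 • fderiv ℝ V x v := fun v w => by rw [h1.fderiv]; rfl
  rw [h2, h2]
  simp only [planeForm_apply, fderiv_eq_pd, add_mul, mul_add, smul_mul_assoc, mul_smul_comm,
    smul_add, smul_smul, eq_sub_of_add_eq (h x hx)]
  module

/-- The Gram matrix of a moving frame is determined by the coefficients of its derivative and by
one of its values. -/
theorem lor_eq_of_moving_frame {W : Type} [NormedAddCommGroup W] [NormedSpace ℝ W] {m : ℕ}
    {D : Set W} (hD : IsOpen D) (hDc : IsPreconnected D)
    {c : W → W →L[ℝ] Fin m → Fin m → ℝ} (hc : ContinuousOn c D) {y : W → Fin m → E31}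
    (hy : DifferentiableOn ℝ y D)
    (hy' : ∀ x ∈ D, ∀ h i, fderiv ℝ y x h i = ∑ k, c x h i k • y x k)
    {g : W → Fin m → Fin m → ℝ} (hg : DifferentiableOn ℝ g D)
    (hg' : ∀ x ∈ D, ∀ h i j,
      fderiv ℝ g x h i j = ∑ k, (c x h i k * g x k j + c x h j k * g x i k))
    {x₀ : W} (hx₀ : x₀ ∈ D) (h0 : ∀ i j, lor (y x₀ i) (y x₀ j) = g x₀ i j) :
    ∀ x ∈ D, ∀ i j, lor (y x i) (y x j) = g x i j := by
  -- The operation g ↦ cg + gcᵗ: the Gram matrix of the frame and the prescribed g both solve this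
  -- linear system with the same initial value.
  let B : (Fin m → Fin m → ℝ) →L[ℝ] (Fin m → Fin m → ℝ) →L[ℝ] (Fin m → Fin m → ℝ) :=
    LinearMap.toContinuousLinearMap
      (LinearMap.toContinuousLinearMap.toLinearMap ∘ₗ
        LinearMap.mk₂ ℝ (fun c g i j => ∑ k, (c i k * g k j + c j k * g i k))
          (fun a b g => by
            ext i j; simp only [Pi.add_apply, ← Finset.sum_add_distrib]
            exact Finset.sum_congr rfl fun k _ => by ring)
          (fun t a g => by
            ext i j; simp only [Pi.smul_apply, smul_eq_mul, Finset.mul_sum]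
            exact Finset.sum_congr rfl fun k _ => by ring)
          (fun a b g => by
            ext i j; simp only [Pi.add_apply, ← Finset.sum_add_distrib]
            exact Finset.sum_congr rfl fun k _ => by ring)
          (fun t a g => by
            ext i j; simp only [Pi.smul_apply, smul_eq_mul, Finset.mul_sum]
            exact Finset.sum_congr rfl fun k _ => by ring))
  have hB : ∀ a g i j, B a g i j = ∑ k, (a i k * g k j + a j k * g i k) := fun _ _ _ _ => rfl
  have hA : ContinuousOn (fun x => B ∘L c x) D := continuousOn_const.clm_comp hc
  have hyd : ∀ x ∈ D, ∀ i, HasFDerivAt (fun x => y x i)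
      ((ContinuousLinearMap.proj (R := ℝ) i) ∘L fderiv ℝ y x) x := fun x hx i =>
    ((ContinuousLinearMap.proj (R := ℝ) (φ := fun _ : Fin m => E31) i).hasFDerivAt).comp x
      (hy.differentiableAt (hD.mem_nhds hx)).hasFDerivAt
  have hk : ∀ x ∈ D, ∀ i j, HasFDerivAt (fun x => lor (y x i) (y x j)) _ x :=
    fun x hx i j => by
      simp only [← lorBilin_apply]
      exact (lorBilin.hasFDerivAt.comp x (hyd x hx i)).clm_apply (hyd x hx j)
  have hkd : ∀ x ∈ D, HasFDerivAt (fun x i j => lor (y x i) (y x j)) _ x := fun x hx =>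
    hasFDerivAt_pi.2 fun i => hasFDerivAt_pi.2 fun j => hk x hx i j
  have := eqOn_of_linear_system hD hDc hA
    (k := fun x i j => lor (y x i) (y x j)) (m := g)
    (fun x hx => (hkd x hx).differentiableAt.differentiableWithinAt) ?_ hg ?_ hx₀ ?_
  · exact fun x hx i j => congrFun (congrFun (this x hx) i) j
  · intro x hx h
    ext i j
    rw [(hkd x hx).fderiv]
    change lorBilin (y x i) (fderiv ℝ y x h j) + lorBilin (fderiv ℝ y x h i) (y x j) =
      B (c x h) _ i j
    rw [hB, hy' x hx, hy' x hx, map_sum, map_sum, sum_apply, ← Finset.sum_add_distrib]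
    refine Finset.sum_congr rfl fun k _ => ?_
    simp only [map_smul, smul_eq_mul, smul_apply, lorBilin_apply]
    ring
  · intro x hx h
    ext i j
    exact hg' x hx h i j
  · ext i j
    exact h0 i j

/-- Coefficients of the `u`-derivatives of `(ψ, ψ_u, ψ_v, N)`, with `a = ρ_u / ρ`. -/
def gaussU (ρ a q H : ℝ) : Fin 4 → Fin 4 → ℝ :=
  ![![0, 1, 0, 0], ![0, a, 0, q], ![0, 0, 0, H * ρ], ![0, -H, -(q / ρ), 0]]

/-- Coefficients of the `v`-derivatives of `(ψ, ψ_u, ψ_v, N)`, with `b = ρ_v / ρ`. -/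
def gaussV (ρ b r H : ℝ) : Fin 4 → Fin 4 → ℝ :=
  ![![0, 0, 1, 0], ![0, 0, 0, H * ρ], ![0, 0, b, r], ![0, -(r / ρ), -H, 0]]

section

variable {W : Type*} [NormedAddCommGroup W] [NormedSpace ℝ W] {ρ a q : W → ℝ} {H : ℝ}

theorem contDiffOn_gaussU {s : Set W} {n : WithTop ℕ∞} (hρ : ContDiffOn ℝ n ρ s)
    (h0 : ∀ x ∈ s, ρ x ≠ 0) (ha : ContDiffOn ℝ n a s) (hq : ContDiffOn ℝ n q s) :
    ContDiffOn ℝ n (fun x => gaussU (ρ x) (a x) (q x) H) s := by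
  have h1 : ContDiffOn ℝ n (fun x => -(q x / ρ x)) s := (hq.div hρ h0).neg
  have h2 : ContDiffOn ℝ n (fun x => H * ρ x) s := contDiffOn_const.mul hρ
  rw [contDiffOn_pi]; intro i
  rw [contDiffOn_pi]; intro j
  fin_cases i <;> fin_cases j <;>
    first | exact contDiffOn_const | exact ha | exact hq | exact h1 | exact h2

theorem contDiffOn_gaussV {s : Set W} {n : WithTop ℕ∞} (hρ : ContDiffOn ℝ n ρ s)
    (h0 : ∀ x ∈ s, ρ x ≠ 0) (ha : ContDiffOn ℝ n a s) (hq : ContDiffOn ℝ n q s) :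
    ContDiffOn ℝ n (fun x => gaussV (ρ x) (a x) (q x) H) s := by
  have h1 : ContDiffOn ℝ n (fun x => -(q x / ρ x)) s := (hq.div hρ h0).neg
  have h2 : ContDiffOn ℝ n (fun x => H * ρ x) s := contDiffOn_const.mul hρ
  rw [contDiffOn_pi]; intro i
  rw [contDiffOn_pi]; intro j
  fin_cases i <;> fin_cases j <;>
    first | exact contDiffOn_const | exact ha | exact hq | exact h1 | exact h2

end

/-- The equations of Gauss and Codazzi are the integrability conditions of the equations of Gauss
and Weingarten. -/
theorem gauss_integrability {ρ a b q r : Plane → ℝ} {H : ℝ} {x : Plane}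
    (hρ : DifferentiableAt ℝ ρ x) (hρ0 : ρ x ≠ 0) (hq : DifferentiableAt ℝ q x)
    (hr : DifferentiableAt ℝ r x) (hU : DifferentiableAt ℝ (fun y => gaussU (ρ y) (a y) (q y) H) x)
    (hV : DifferentiableAt ℝ (fun y => gaussV (ρ y) (b y) (r y) H) x)
    (ha : a x = pd 0 ρ x / ρ x) (hb : b x = pd 1 ρ x / ρ x)
    (ha' : pd 1 a x = q x * r x / ρ x - H ^ 2 * ρ x)
    (hb' : pd 0 b x = q x * r x / ρ x - H ^ 2 * ρ x) (hq' : pd 1 q x = 0) (hr' : pd 0 r x = 0) :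
    (pd 0 (fun y => gaussV (ρ y) (b y) (r y) H) x + fun i k => ∑ j,
        gaussV (ρ x) (b x) (r x) H i j * gaussU (ρ x) (a x) (q x) H j k) =
      pd 1 (fun y => gaussU (ρ y) (a y) (q y) H) x + fun i k => ∑ j,
        gaussU (ρ x) (a x) (q x) H i j * gaussV (ρ x) (b x) (r x) H j k := by
  have eU : pd 1 (fun y => gaussU (ρ y) (a y) (q y) H) x =
      ![![0, 0, 0, 0], ![0, pd 1 a x, 0, 0], ![0, 0, 0, H * pd 1 ρ x],
        ![0, 0, q x * pd 1 ρ x / ρ x ^ 2, 0]] := by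
    ext i j
    rw [pd_pi hU, pd_pi (differentiableAt_pi.1 hU i)]
    have h1 : pd 1 (fun y => H * ρ y) x = H * pd 1 ρ x := pd_const_mul hρ H
    have h2 : pd 1 (fun y => -(q y / ρ y)) x = q x * pd 1 ρ x / ρ x ^ 2 := by
      rw [pd_neg, pd_div hq hρ hρ0, hq']; ring
    fin_cases i <;> fin_cases j <;>
      first | exact pd_const _ | exact hq' | exact h1 | exact h2 | rfl
  have eV : pd 0 (fun y => gaussV (ρ y) (b y) (r y) H) x =
      ![![0, 0, 0, 0], ![0, 0, 0, H * pd 0 ρ x], ![0, 0, pd 0 b x, 0],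
        ![0, r x * pd 0 ρ x / ρ x ^ 2, 0, 0]] := by
    ext i j
    rw [pd_pi hV, pd_pi (differentiableAt_pi.1 hV i)]
    have h1 : pd 0 (fun y => H * ρ y) x = H * pd 0 ρ x := pd_const_mul hρ H
    have h2 : pd 0 (fun y => -(r y / ρ y)) x = r x * pd 0 ρ x / ρ x ^ 2 := by
      rw [pd_neg, pd_div hr hρ hρ0, hr']; ring
    fin_cases i <;> fin_cases j <;>
      first | exact pd_const _ | exact hr' | exact h1 | exact h2 | rfl
  rw [eU, eV, ha', hb', ha, hb]
  ext i k
  simp only [Pi.add_apply, Fin.sum_univ_four]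
  fin_cases i <;> fin_cases k <;> simp [gaussU, gaussV] <;> field_simp <;> ring

/-- The equations of Gauss and Weingarten for a tuple `y = (ψ, ψ_u, ψ_v, N)` with metric
`2 ρ du dv`, mean curvature `H` and Hopf differential `q du² + r dv²`. -/
def IsGaussFrame (ρ q r : Plane → ℝ) (H : ℝ) (y : Plane → Fin 4 → E31) (D : Set Plane) : Prop :=
  ∀ x ∈ D, ∀ h, fderiv ℝ y x h = coeffAct (planeForm
    (gaussU (ρ x) (pd 0 ρ x / ρ x) (q x) H) (gaussV (ρ x) (pd 1 ρ x / ρ x) (r x) H) h) (y x)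

section

variable {D : Set Plane} {ρ q r : Plane → ℝ} {H : ℝ} {y : Plane → Fin 4 → E31}

theorem IsGaussFrame.pd_zero (h : IsGaussFrame ρ q r H y D) {x : Plane} (hx : x ∈ D) (i : Fin 4) :
    pd 0 y x i = ∑ j, gaussU (ρ x) (pd 0 ρ x / ρ x) (q x) H i j • y x j := by
  rw [pd, h x hx, ← coeffAct_apply, planeForm_apply]
  simp [stdVec]

theorem IsGaussFrame.pd_one (h : IsGaussFrame ρ q r H y D) {x : Plane} (hx : x ∈ D) (i : Fin 4) :
    pd 1 y x i = ∑ j, gaussV (ρ x) (pd 1 ρ x / ρ x) (r x) H i j • y x j := by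
  rw [pd, h x hx, ← coeffAct_apply, planeForm_apply]
  simp [stdVec]

theorem isGaussFrame_of_pd
    (h0 : ∀ x ∈ D, ∀ i, pd 0 y x i = ∑ j, gaussU (ρ x) (pd 0 ρ x / ρ x) (q x) H i j • y x j)
    (h1 : ∀ x ∈ D, ∀ i, pd 1 y x i = ∑ j, gaussV (ρ x) (pd 1 ρ x / ρ x) (r x) H i j • y x j) :
    IsGaussFrame ρ q r H y D := by
  intro x hx h
  ext1 i
  rw [fderiv_eq_pd, planeForm_apply, map_add, map_smul, map_smul]
  change h 0 • pd 0 y x i + h 1 • pd 1 y x i = h 0 • coeffAct _ (y x) i + h 1 • coeffAct _ (y x) i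
  rw [h0 x hx, h1 x hx, coeffAct_apply, coeffAct_apply]

/-- Solutions of the equations of Gauss and Weingarten that start at a null frame consist of null
frames. -/
theorem IsGaussFrame.isNullFrame (hD : IsOpen D) (hDc : IsPreconnected D)
    (hρ : ContDiffOn ℝ ∞ ρ D) (hρ0 : ∀ x ∈ D, ρ x ≠ 0) (hq : ContDiffOn ℝ ∞ q D)
    (hr : ContDiffOn ℝ ∞ r D) (h : IsGaussFrame ρ q r H y D) (hy : DifferentiableOn ℝ y D)
    {x₀ : Plane} (hx₀ : x₀ ∈ D) (h0 : IsNullFrame (ρ x₀) (y x₀ 1) (y x₀ 2) (y x₀ 3)) :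
    ∀ x ∈ D, IsNullFrame (ρ x) (y x 1) (y x 2) (y x 3) := by
  set U := fun x => gaussU (ρ x) (pd 0 ρ x / ρ x) (q x) H with hU
  set V := fun x => gaussV (ρ x) (pd 1 ρ x / ρ x) (r x) H with hV
  have hUs : ContDiffOn ℝ ∞ U D := contDiffOn_gaussU hρ hρ0 ((contDiffOn_pd hD hρ 0).div hρ hρ0) hq
  have hVs : ContDiffOn ℝ ∞ V D := contDiffOn_gaussV hρ hρ0 ((contDiffOn_pd hD hρ 1).div hρ hρ0) hr
  -- The position is dropped from the tuple: the derivatives of the frame vectors do not involve it,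
  -- so the lower 3 × 3 block is a closed system.
  have hsub : ∀ {T : Plane → Fin 4 → Fin 4 → ℝ}, ContDiffOn ℝ ∞ T D →
      ContDiffOn ℝ ∞ (fun x (i k : Fin 3) => T x i.succ k.succ) D := fun hT =>
    contDiffOn_pi.2 fun i => contDiffOn_pi.2 fun k =>
      contDiffOn_pi.1 (contDiffOn_pi.1 hT i.succ) k.succ
  have hys : ∀ x ∈ D, HasFDerivAt (fun x (i : Fin 3) => y x i.succ)
      (.pi fun i => ContinuousLinearMap.proj i.succ ∘L fderiv ℝ y x) x := fun x hx =>
    hasFDerivAt_pi.2 fun i =>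
      ((ContinuousLinearMap.proj (R := ℝ) (φ := fun _ : Fin 4 => E31) i.succ).hasFDerivAt).comp x
        (hy.differentiableAt (hD.mem_nhds hx)).hasFDerivAt
  let g : Plane → Fin 3 → Fin 3 → ℝ := fun x => ![![0, ρ x, 0], ![ρ x, 0, 0], ![0, 0, 1]]
  have hg : ∀ x ∈ D, ∀ i j, DifferentiableAt ℝ (fun x => g x i j) x := by
    intro x hx i j
    have := differentiableAt_of_contDiffOn hD hρ hx
    fin_cases i <;> fin_cases j <;> first | exact differentiableAt_const _ | exact this
  have hgd : ∀ x ∈ D, DifferentiableAt ℝ g x := fun x hx =>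
    differentiableAt_pi.2 fun i => differentiableAt_pi.2 fun j => hg x hx i j
  have hgpd : ∀ x ∈ D, ∀ i, pd i g x = ![![0, pd i ρ x, 0], ![pd i ρ x, 0, 0], ![0, 0, 0]] := by
    intro x hx k
    ext i j
    rw [pd_pi (hgd x hx), pd_pi (differentiableAt_pi.1 (hgd x hx) i)]
    fin_cases i <;> fin_cases j <;> first | exact pd_const _ | rfl
  have hgram := lor_eq_of_moving_frame hD hDc (g := g) (x₀ := x₀)
    ((ContDiffOn.planeForm (hsub hUs) (hsub hVs)).continuousOn)
    (fun x hx => (hys x hx).differentiableAt.differentiableWithinAt) ?_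
    (fun x hx => (hgd x hx).differentiableWithinAt) ?_ hx₀ ?_
  · intro x hx
    exact ⟨hgram x hx 0 0, hgram x hx 1 1, hgram x hx 0 1, hgram x hx 0 2, hgram x hx 1 2,
      hgram x hx 2 2⟩
  · intro x hx v i
    rw [(hys x hx).fderiv]
    change fderiv ℝ y x v i.succ = _
    rw [h x hx, coeffAct_apply, Fin.sum_univ_succ]
    have : planeForm (U x) (V x) v i.succ 0 = 0 := by
      rw [planeForm_apply]
      fin_cases i <;> simp [hU, hV, gaussU, gaussV]
    rw [this, zero_smul, zero_add]
    rfl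
  · intro x hx v i j
    have h0 := hρ0 x hx
    rw [fderiv_eq_pd, hgpd x hx, hgpd x hx]
    simp only [planeForm_apply, Fin.sum_univ_three]
    fin_cases i <;> fin_cases j <;> simp [hU, hV, gaussU, gaussV, g] <;> field_simp <;> ring
  · intro i j
    fin_cases i <;> fin_cases j
    · exact h0.xx
    · exact h0.xy
    · exact h0.xn
    · exact (lor_comm _ _).trans h0.xy
    · exact h0.yy
    · exact h0.yn
    · exact (lor_comm _ _).trans h0.xn
    · exact (lor_comm _ _).trans h0.yn
    · exact h0.nn

end

/-! ### Surfaces in null coordinates and their associated families -/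

/-- `ψ` is a surface in null coordinates on `D`, with unit normal field `N`, metric `2 ρ du dv`,
constant mean curvature `H` and Hopf differential `Q du² + R dv²`. -/
structure IsNullSurface (ψ N : Plane → E31) (ρ Q R : Plane → ℝ) (H : ℝ) (D : Set Plane) :
    Prop where
  smooth : ContDiffOn ℝ ∞ ψ D
  smooth_normal : ContDiffOn ℝ ∞ N D
  frame : ∀ x ∈ D, IsNullFrame (ρ x) (pd 0 ψ x) (pd 1 ψ x) (N x)
  uu : ∀ x ∈ D, lor (pd 0 (pd 0 ψ) x) (N x) = Q x
  uv : ∀ x ∈ D, lor (pd 1 (pd 0 ψ) x) (N x) = H * ρ x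
  vv : ∀ x ∈ D, lor (pd 1 (pd 1 ψ) x) (N x) = R x

/-- The position and the frame of a surface. -/
def gaussTuple (ψ N : Plane → E31) (x : Plane) : Fin 4 → E31 := ![ψ x, pd 0 ψ x, pd 1 ψ x, N x]

variable {D : Set Plane} {ψ N : Plane → E31} {ρ Q R : Plane → ℝ} {H : ℝ}

namespace IsNullSurface

variable (h : IsNullSurface ψ N ρ Q R H D)

include h

theorem contDiffOn_rho (hD : IsOpen D) : ContDiffOn ℝ ∞ ρ D :=
  (contDiffOn_lor (contDiffOn_pd hD h.smooth 0) (contDiffOn_pd hD h.smooth 1)).congr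
    fun x hx => (h.frame x hx).xy.symm

theorem contDiffOn_Q (hD : IsOpen D) : ContDiffOn ℝ ∞ Q D :=
  (contDiffOn_lor (contDiffOn_pd hD (contDiffOn_pd hD h.smooth 0) 0) h.smooth_normal).congr
    fun x hx => (h.uu x hx).symm

theorem contDiffOn_R (hD : IsOpen D) : ContDiffOn ℝ ∞ R D :=
  (contDiffOn_lor (contDiffOn_pd hD (contDiffOn_pd hD h.smooth 1) 1) h.smooth_normal).congr
    fun x hx => (h.vv x hx).symm

theorem contDiffOn_gaussTuple (hD : IsOpen D) : ContDiffOn ℝ ∞ (gaussTuple ψ N) D := by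
  refine contDiffOn_pi.2 fun i => ?_
  fin_cases i
  · exact h.smooth
  · exact contDiffOn_pd hD h.smooth 0
  · exact contDiffOn_pd hD h.smooth 1
  · exact h.smooth_normal

/-- The equations of Gauss and Weingarten. -/
theorem derivatives (hD : IsOpen D) (hρ : ∀ x ∈ D, ρ x ≠ 0) {x : Plane} (hx : x ∈ D) :
    pd 0 (pd 0 ψ) x = (pd 0 ρ x / ρ x) • pd 0 ψ x + Q x • N x ∧
    pd 1 (pd 0 ψ) x = (H * ρ x) • N x ∧
    pd 1 (pd 1 ψ) x = (pd 1 ρ x / ρ x) • pd 1 ψ x + R x • N x ∧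
    pd 0 N x = -H • pd 0 ψ x + (-(Q x / ρ x)) • pd 1 ψ x ∧
    pd 1 N x = (-(R x / ρ x)) • pd 0 ψ x + -H • pd 1 ψ x := by
  have h1 := IsNullFrame.structure_equations hD (contDiffOn_pd hD h.smooth 0)
    (contDiffOn_pd hD h.smooth 1) h.smooth_normal h.frame hρ (fun x hx => pd_comm hD h.smooth hx) hx
  have h2 : -(H * ρ x) / ρ x = -H := by have := hρ x hx; field_simp
  rw [h.uu x hx, h.uv x hx, h.vv x hx, h2, neg_div, neg_div] at h1
  exact h1

theorem isGaussFrame (hD : IsOpen D) (hρ : ∀ x ∈ D, ρ x ≠ 0) :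
    IsGaussFrame ρ Q R H (gaussTuple ψ N) D := by
  have hd : ∀ x ∈ D, DifferentiableAt ℝ (gaussTuple ψ N) x := fun x hx =>
    differentiableAt_of_contDiffOn hD (h.contDiffOn_gaussTuple hD) hx
  refine isGaussFrame_of_pd (fun x hx i => ?_) (fun x hx i => ?_)
  · rw [pd_pi (hd x hx), Fin.sum_univ_four]
    obtain ⟨h1, h2, h3, h4, h5⟩ := h.derivatives hD hρ hx
    fin_cases i
    · change pd 0 ψ x = _
      simp [gaussU, gaussTuple]
    · change pd 0 (pd 0 ψ) x = _
      rw [h1]; simp [gaussU, gaussTuple]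
    · change pd 0 (pd 1 ψ) x = _
      rw [pd_comm hD h.smooth hx, h2]; simp [gaussU, gaussTuple]
    · change pd 0 N x = _
      rw [h4]; simp [gaussU, gaussTuple]
  · rw [pd_pi (hd x hx), Fin.sum_univ_four]
    obtain ⟨h1, h2, h3, h4, h5⟩ := h.derivatives hD hρ hx
    fin_cases i
    · change pd 1 ψ x = _
      simp [gaussV, gaussTuple]
    · change pd 1 (pd 0 ψ) x = _
      rw [h2]; simp [gaussV, gaussTuple]
    · change pd 1 (pd 1 ψ) x = _
      rw [h3]; simp [gaussV, gaussTuple]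
    · change pd 1 N x = _
      rw [h5]; simp [gaussV, gaussTuple]

/-- Scaling the Hopf differential to `l Q du² + l⁻¹ R dv²` preserves the equations of Gauss and
Codazzi. -/
theorem isFlatOn (hD : IsOpen D) (hρ : ∀ x ∈ D, ρ x ≠ 0) {l : ℝ} (hl : l ≠ 0) :
    IsFlatOn (fun x => planeForm (coeffAct (gaussU (ρ x) (pd 0 ρ x / ρ x) (l * Q x) H))
      (coeffAct (gaussV (ρ x) (pd 1 ρ x / ρ x) (l⁻¹ * R x) H))) D := by
  have hρs := h.contDiffOn_rho hD
  have hQs := h.contDiffOn_Q hD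
  have hRs := h.contDiffOn_R hD
  have hU : ∀ x ∈ D, DifferentiableAt ℝ
      (fun x => gaussU (ρ x) (pd 0 ρ x / ρ x) (l * Q x) H) x := fun x hx =>
    differentiableAt_of_contDiffOn hD (contDiffOn_gaussU hρs hρ ((contDiffOn_pd hD hρs 0).div hρs hρ)
      (contDiffOn_const.mul hQs)) hx
  have hV : ∀ x ∈ D, DifferentiableAt ℝ
      (fun x => gaussV (ρ x) (pd 1 ρ x / ρ x) (l⁻¹ * R x) H) x := fun x hx =>
    differentiableAt_of_contDiffOn hD (contDiffOn_gaussV hρs hρ ((contDiffOn_pd hD hρs 1).div hρs hρ)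
      (contDiffOn_const.mul hRs)) hx
  have hpd : ∀ (f : Plane → Fin 4 → Fin 4 → ℝ) x i, DifferentiableAt ℝ f x →
      pd i (fun x => coeffAct (f x)) x = coeffAct (pd i f x) := fun f x i hf => by
    have h1 : HasFDerivAt (fun x => coeffAct (f x)) _ x :=
      coeffAct.hasFDerivAt.comp x hf.hasFDerivAt
    rw [pd, h1.fderiv]
    rfl
  refine isFlatOn_planeForm (fun x hx => coeffAct.differentiableAt.comp x (hU x hx))
    (fun x hx => coeffAct.differentiableAt.comp x (hV x hx)) fun x hx => ?_
  have dQ := differentiableAt_of_contDiffOn hD hQs hx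
  have dR := differentiableAt_of_contDiffOn hD hRs hx
  obtain ⟨g1, g2, g3, g4⟩ := gauss_codazzi hD h.smooth h.smooth_normal hρs hQs hRs h.frame hρ
    (fun x hx => (h.derivatives hD hρ hx).1) (fun x hx => (h.derivatives hD hρ hx).2.1)
    (fun x hx => (h.derivatives hD hρ hx).2.2.1) (fun x hx => (h.derivatives hD hρ hx).2.2.2.1)
    (fun x hx => (h.derivatives hD hρ hx).2.2.2.2) hx
  -- The parameter cancels in the product of the Hopf coefficients, the only way they enter the
  -- Gauss equation.
  have hqr : l * Q x * (l⁻¹ * R x) = Q x * R x := by field_simp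
  have hg := gauss_integrability (a := fun x => pd 0 ρ x / ρ x) (b := fun x => pd 1 ρ x / ρ x)
    (q := fun x => l * Q x) (r := fun x => l⁻¹ * R x) (differentiableAt_of_contDiffOn hD hρs hx)
    (hρ x hx) (dQ.const_mul l) (dR.const_mul l⁻¹) (hU x hx) (hV x hx) rfl rfl (by rw [g1, hqr])
    (by rw [g2, hqr]) (by rw [pd_const_mul dQ, g3, mul_zero])
    (by rw [pd_const_mul dR, g4, mul_zero])
  rw [hpd _ x 0 (hV x hx), hpd _ x 1 (hU x hx), coeffAct_mul, coeffAct_mul, ← map_add, ← map_add,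
    hg]

end IsNullSurface

/-- Solutions of the equations of Gauss and Weingarten are surfaces. -/
theorem IsGaussFrame.isNullSurface {q r : Plane → ℝ} {y : Plane → Fin 4 → E31} (hD : IsOpen D)
    (h : IsGaussFrame ρ q r H y D) (hy : ContDiffOn ℝ ∞ y D)
    (hF : ∀ x ∈ D, IsNullFrame (ρ x) (y x 1) (y x 2) (y x 3)) :
    IsNullSurface (fun x => y x 0) (fun x => y x 3) ρ q r H D ∧
      ∀ x ∈ D, pd 0 (fun x => y x 0) x = y x 1 ∧ pd 1 (fun x => y x 0) x = y x 2 := by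
  have hd : ∀ x ∈ D, DifferentiableAt ℝ y x := fun x hx => differentiableAt_of_contDiffOn hD hy hx
  have h1 : ∀ x ∈ D, pd 0 (fun x => y x 0) x = y x 1 := fun x hx => by
    rw [← pd_pi (hd x hx), h.pd_zero hx]; simp [Fin.sum_univ_four, gaussU]
  have h2 : ∀ x ∈ D, pd 1 (fun x => y x 0) x = y x 2 := fun x hx => by
    rw [← pd_pi (hd x hx), h.pd_one hx]; simp [Fin.sum_univ_four, gaussV]
  refine ⟨⟨contDiffOn_pi.1 hy 0, contDiffOn_pi.1 hy 3, fun x hx => ?_, fun x hx => ?_,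
    fun x hx => ?_, fun x hx => ?_⟩, fun x hx => ⟨h1 x hx, h2 x hx⟩⟩
  · rw [h1 x hx, h2 x hx]; exact hF x hx
  · rw [pd_congr hD h1 hx, ← pd_pi (hd x hx), h.pd_zero hx]
    simp [Fin.sum_univ_four, gaussU, lor_add_left, lor_smul_left, (hF x hx).xn, (hF x hx).nn]
  · rw [pd_congr hD h1 hx, ← pd_pi (hd x hx), h.pd_one hx]
    simp [Fin.sum_univ_four, gaussV, lor_smul_left, (hF x hx).nn]
  · rw [pd_congr hD h2 hx, ← pd_pi (hd x hx), h.pd_one hx]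
    simp [Fin.sum_univ_four, gaussV, lor_add_left, lor_smul_left, (hF x hx).yn, (hF x hx).nn]

theorem continuousOn_vol {X Y Z : Plane → E31} (hX : ContinuousOn X D) (hY : ContinuousOn Y D)
    (hZ : ContinuousOn Z D) : ContinuousOn (fun x => vol (X x) (Y x) (Z x)) D := by
  simp only [vol, Matrix.det_fin_three, Matrix.of_apply, Matrix.cons_val]
  fun_prop

/-- The associated family of a surface of constant mean curvature, in null coordinates on a simply
connected domain. -/
theorem IsNullSurface.exists_associated_family (hD : IsOpen D) (hDs : IsSimplyConnected D)
    (h : IsNullSurface ψ N ρ Q R H D) (hρ : ∀ x ∈ D, ρ x ≠ 0) :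
    ∃ f ν : Plane × ℝ → E31, ContDiffOn ℝ ∞ f (D ×ˢ {0}ᶜ) ∧ ContDiffOn ℝ ∞ ν (D ×ˢ {0}ᶜ) ∧
      (∀ x ∈ D, f (x, 1) = ψ x ∧ ν (x, 1) = N x) ∧
      ∀ l : ℝ, l ≠ 0 →
        IsNullSurface (fun x => f (x, l)) (fun x => ν (x, l)) ρ (fun x => l * Q x)
          (fun x => l⁻¹ * R x) H D ∧
        ∀ x ∈ D, vol (pd 0 (fun x => f (x, l)) x) (pd 1 (fun x => f (x, l)) x) (ν (x, l)) =
          vol (pd 0 ψ x) (pd 1 ψ x) (N x) := by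
  have hρs := h.contDiffOn_rho hD
  have hQs := h.contDiffOn_Q hD
  have hRs := h.contDiffOn_R hD
  have hDc : IsPreconnected D := hDs.isPathConnected.isConnected.isPreconnected
  obtain ⟨x₀, hx₀⟩ := hDs.nonempty
  let A : Plane × ℝ → Plane →L[ℝ] (Fin 4 → E31) →L[ℝ] (Fin 4 → E31) := fun p =>
    planeForm (coeffAct (gaussU (ρ p.1) (pd 0 ρ p.1 / ρ p.1) (p.2 * Q p.1) H))
      (coeffAct (gaussV (ρ p.1) (pd 1 ρ p.1 / ρ p.1) (p.2⁻¹ * R p.1) H))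
  have hfst : ∀ {f : Plane → ℝ}, ContDiffOn ℝ ∞ f D →
      ContDiffOn ℝ ∞ (fun p : Plane × ℝ => f p.1) (D ×ˢ {0}ᶜ) := fun hf =>
    hf.comp contDiffOn_fst fun p hp => hp.1
  have hA : ContDiffOn ℝ ∞ A (D ×ˢ {0}ᶜ) := by
    refine ContDiffOn.planeForm (coeffAct.contDiff.comp_contDiffOn ?_)
      (coeffAct.contDiff.comp_contDiffOn ?_)
    · exact contDiffOn_gaussU (hfst hρs) (fun p hp => hρ _ hp.1)
        (hfst ((contDiffOn_pd hD hρs 0).div hρs hρ)) (contDiffOn_snd.mul (hfst hQs))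
    · exact contDiffOn_gaussV (hfst hρs) (fun p hp => hρ _ hp.1)
        (hfst ((contDiffOn_pd hD hρs 1).div hρs hρ))
        ((contDiffOn_snd.inv fun p hp => hp.2).mul (hfst hRs))
  -- All members of the family share position and frame at the base point. For l = 1 the system is
  -- the one solved by the given surface, so uniqueness returns that surface.
  obtain ⟨y, hys, hy0, hyd⟩ := exists_solution_of_flat hD hDs isOpen_compl_singleton hA
    (fun l hl => h.isFlatOn hD hρ hl) hx₀ (gaussTuple ψ N x₀)
  have hG : ∀ l : ℝ, l ≠ 0 →
      IsGaussFrame ρ (fun x => l * Q x) (fun x => l⁻¹ * R x) H (fun x => y (x, l)) D :=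
    fun l hl x hx v => by
      rw [hyd x hx l hl v]
      simp only [A, planeForm_apply, map_add, map_smul]
  have hyl : ∀ l : ℝ, l ≠ 0 → ContDiffOn ℝ ∞ (fun x => y (x, l)) D := fun l hl =>
    hys.comp (contDiffOn_id.prodMk contDiffOn_const) fun x hx => ⟨hx, hl⟩
  have hF : ∀ l : ℝ, l ≠ 0 →
      ∀ x ∈ D, IsNullFrame (ρ x) (y (x, l) 1) (y (x, l) 2) (y (x, l) 3) := fun l hl =>
    (hG l hl).isNullFrame hD hDc hρs hρ (contDiffOn_const.mul hQs) (contDiffOn_const.mul hRs)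
      ((hyl l hl).differentiableOn (by simp)) hx₀ (by
        rw [hy0 l hl]; exact h.frame x₀ hx₀)
  refine ⟨fun p => y p 0, fun p => y p 3, contDiffOn_pi.1 hys 0, contDiffOn_pi.1 hys 3,
    fun x hx => ?_, fun l hl => ?_⟩
  · have h1 := eqOn_of_linear_system hD hDc (A := fun x => A (x, 1))
      (k := fun x => y (x, 1)) (m := gaussTuple ψ N)
      (hA.continuousOn.comp (by fun_prop) fun x hx => ⟨hx, one_ne_zero⟩)
      ((hyl 1 one_ne_zero).differentiableOn (by simp)) (fun x hx v => hyd x hx 1 one_ne_zero v)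
      ((h.contDiffOn_gaussTuple hD).differentiableOn (by simp))
      (fun x hx v => by
        rw [h.isGaussFrame hD hρ x hx v]
        simp only [A, planeForm_apply, map_add, map_smul, inv_one, one_mul])
      hx₀ (hy0 1 one_ne_zero) x hx
    exact ⟨congrFun h1 0, congrFun h1 3⟩
  · obtain ⟨hS, hpd⟩ := (hG l hl).isNullSurface hD (hyl l hl) (hF l hl)
    refine ⟨hS, fun x hx => ?_⟩
    have hc := fun i => (contDiffOn_pi.1 (hyl l hl) i).continuousOn
    have hv1 := continuousOn_vol (hc 1) (hc 2) (hc 3)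
    have hv2 := continuousOn_vol (contDiffOn_pd hD h.smooth 0).continuousOn
      (contDiffOn_pd hD h.smooth 1).continuousOn h.smooth_normal.continuousOn
    -- Both volumes are continuous with the same nonvanishing square ρ² and agree at x₀; on a
    -- connected domain they cannot differ by a sign.
    have hne : ∀ x ∈ D, vol (pd 0 ψ x) (pd 1 ψ x) (N x) ≠ 0 := fun x hx h0 => by
      have := (h.frame x hx).vol_sq_eq
      rw [h0] at this
      exact hρ x hx (pow_eq_zero_iff two_ne_zero |>.1 (by linarith))
    have hx₀eq : vol (y (x₀, l) 1) (y (x₀, l) 2) (y (x₀, l) 3) =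
        vol (pd 0 ψ x₀) (pd 1 ψ x₀) (N x₀) := by rw [hy0 l hl]; rfl
    rw [(hpd x hx).1, (hpd x hx).2]
    refine hDc.eq_of_sq_eq hv1 hv2 (fun x hx => ?_) (fun {x} hx => hne x hx) hx₀ hx₀eq hx
    simp only [Pi.pow_apply]
    rw [(hF l hl x hx).vol_sq_eq, (h.frame x hx).vol_sq_eq]

theorem IsNullSurface.congr {D : Set Plane} {ψ N ψ' N' : Plane → E31} {ρ Q R : Plane → ℝ} {H : ℝ}
    (h : IsNullSurface ψ N ρ Q R H D) (hD : IsOpen D) (hψ : EqOn ψ' ψ D) (hN : EqOn N' N D) :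
    IsNullSurface ψ' N' ρ Q R H D := by
  have h1 : ∀ i, EqOn (pd i ψ') (pd i ψ) D := fun i x hx => pd_congr hD hψ hx
  have h2 : ∀ i j, EqOn (pd j (pd i ψ')) (pd j (pd i ψ)) D := fun i j x hx => pd_congr hD (h1 i) hx
  refine ⟨h.smooth.congr hψ, h.smooth_normal.congr hN, fun x hx => ?_, fun x hx => ?_,
    fun x hx => ?_, fun x hx => ?_⟩
  · rw [h1 0 hx, h1 1 hx, hN hx]; exact h.frame x hx
  · rw [h2 0 0 hx, hN hx]; exact h.uu x hx
  · rw [h2 0 1 hx, hN hx]; exact h.uv x hx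
  · rw [h2 1 1 hx, hN hx]; exact h.vv x hx

/-! ### Hopf differentials of congruent surfaces -/

/-- Congruent surfaces with the same metric and mean curvature have, up to a common sign, the same
Hopf differential and mean curvature. -/
theorem IsNullSurface.hopf_of_congruent {D : Set Plane} (hD : IsOpen D) {f g n m : Plane → E31}
    {ρ Q R Q' R' : Plane → ℝ} {H : ℝ} (hf : IsNullSurface f n ρ Q R H D)
    (hg : IsNullSurface g m ρ Q' R' H D) {A : E31 →ₗ[ℝ] E31} {b : E31}
    (hA : ∀ x y, lor (A x) (A y) = lor x y) (hAb : ∀ x ∈ D, g x = A (f x) + b) {x : Plane}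
    (hx : x ∈ D) (hρ : ρ x ≠ 0) :
    ∃ c : ℝ, c ^ 2 = 1 ∧ Q' x = c * Q x ∧ R' x = c * R x ∧ H = c * H := by
  let A' : E31 →L[ℝ] E31 := LinearMap.toContinuousLinearMap A
  have hcomp : ∀ {k : Plane → E31}, ContDiffOn ℝ ∞ k D → ∀ i, ∀ y ∈ D,
      pd i (fun z => A (k z)) y = A (pd i k y) := fun {k} hk i y hy => by
    have h1 : HasFDerivAt (fun z => A (k z)) (A' ∘L fderiv ℝ k y) y :=
      A'.hasFDerivAt.comp y (differentiableAt_of_contDiffOn hD hk hy).hasFDerivAt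
    rw [pd, h1.fderiv]
    rfl
  have h1 : ∀ i, ∀ y ∈ D, pd i g y = A (pd i f y) := fun i y hy => by
    have hd : DifferentiableAt ℝ (fun z => A (f z)) y :=
      A'.differentiableAt.comp y (differentiableAt_of_contDiffOn hD hf.smooth hy)
    rw [pd_congr hD hAb hy, pd_add hd (differentiableAt_const b), pd_const, add_zero,
      hcomp hf.smooth i y hy]
  have h2 : ∀ i j, pd j (pd i g) x = A (pd j (pd i f) x) := fun i j => by
    rw [pd_congr hD (h1 i) hx, hcomp (contDiffOn_pd hD hf.smooth i) j x hx]
  have hfr := hf.frame x hx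
  have hgr := hg.frame x hx
  -- The image of the normal is orthogonal to g_u and g_v, so it is a multiple c of the normal of g,
  -- and unit length gives c² = 1.
  have hn : A (n x) = lor (A (n x)) (m x) • m x := by
    have := hgr.expand_of_eq hρ (V := A (n x)) (a := 0) (b := 0) (c := lor (A (n x)) (m x))
      (by rw [h1 0 x hx, hA, lor_comm, hfr.xn]) (by rw [h1 1 x hx, hA, lor_comm, hfr.yn]) rfl
    simpa using this
  generalize lor (A (n x)) (m x) = c at hn
  have hc : c ^ 2 = 1 := by
    have := hA (n x) (n x)
    rw [hfr.nn, hn, lor_smul_left, lor_smul_right, hgr.nn] at this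
    linarith
  have key : ∀ i j, lor (pd j (pd i g) x) (m x) = c * lor (pd j (pd i f) x) (n x) := fun i j => by
    rw [← hA (pd j (pd i f) x), hn, lor_smul_right, ← h2]
    linear_combination (-lor (pd j (pd i g) x) (m x)) * hc
  refine ⟨c, hc, ?_, ?_, ?_⟩
  · rw [← hg.uu x hx, ← hf.uu x hx, key]
  · rw [← hg.vv x hx, ← hf.vv x hx, key]
  · have := key 0 1
    rw [hg.uv x hx, hf.uv x hx, ← mul_assoc] at this
    exact mul_right_cancel₀ hρ this

/-! ### Fundamental forms and mean curvature in a null chart -/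

theorem vol_combination (a b c d : ℝ) (X Y N : E31) :
    vol (a • X + b • Y) (c • X + d • Y) N = (a * d - b * c) * vol X Y N := by
  simp only [vol, Matrix.det_fin_three, Matrix.of_apply, Matrix.cons_val, Pi.add_apply,
    Pi.smul_apply, smul_eq_mul]
  ring

theorem coordDeriv_coordDeriv {M : Type*} [TopologicalSpace M] {e : OpenPartialHomeomorph M Plane}
    {q : M} (hq : q ∈ e.source) (i j : Fin 2) (f : M → E31) :
    coordDeriv e i (coordDeriv e j f) q = pd i (pd j (f ∘ e.symm)) (e q) := by
  refine pd_congr e.open_target (fun x hx => ?_) (e.map_source hq)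
  change fderiv ℝ (f ∘ e.symm) (e (e.symm x)) (stdVec j) = _
  rw [e.right_inv hx]
  rfl

section Charts

variable {M : Type*} [TopologicalSpace M] [ChartedSpace Plane M]
  {e : OpenPartialHomeomorph M Plane} {f n : M → E31} {q : M}

/-- The differential of a chart. -/
def chartDiff (e : OpenPartialHomeomorph M Plane) (q : M) : TangentSpace (𝓡 2) q →L[ℝ] Plane :=
  mfderiv (𝓡 2) (𝓡 2) e q

theorem diff_eq_pd (he : e ∈ IsManifold.maximalAtlas (𝓡 2) ∞ M) (hq : q ∈ e.source)
    (hf : ContDiffOn ℝ ∞ (f ∘ e.symm) e.target) (X : TangentSpace (𝓡 2) q) :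
    diff f q X = chartDiff e q X 0 • pd 0 (f ∘ e.symm) (e q) +
      chartDiff e q X 1 • pd 1 (f ∘ e.symm) (e q) := by
  rw [diff_eq_fderiv_chart he hq
    (differentiableAt_of_contDiffOn e.open_target hf (e.map_source hq))]
  exact fderiv_eq_pd _ _ (chartDiff e q X)

theorem chartDiff_injective (he : e ∈ IsManifold.maximalAtlas (𝓡 2) ∞ M) (hq : q ∈ e.source) :
    Function.Injective (chartDiff e q) :=
  ((chart_mdifferentiable he).mfderiv_bijective hq).1

theorem firstForm_eq (he : e ∈ IsManifold.maximalAtlas (𝓡 2) ∞ M) (hq : q ∈ e.source)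
    (hf : ContDiffOn ℝ ∞ (f ∘ e.symm) e.target) {ρ : ℝ} {N : E31}
    (h : IsNullFrame ρ (pd 0 (f ∘ e.symm) (e q)) (pd 1 (f ∘ e.symm) (e q)) N)
    (X Y : TangentSpace (𝓡 2) q) :
    firstForm f q X Y = ρ *
      (chartDiff e q X 0 * chartDiff e q Y 1 +
        chartDiff e q X 1 * chartDiff e q Y 0) := by
  rw [firstForm, diff_eq_pd he hq hf, diff_eq_pd he hq hf]
  simp only [lor_add_left, lor_add_right, lor_smul_left, lor_smul_right, h.xx, h.yy, h.xy,
    lor_comm (pd 1 (f ∘ e.symm) (e q)) (pd 0 (f ∘ e.symm) (e q))]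
  ring

/-- Differentiating ⟨ψ_i, N⟩ = 0 trades -⟨ψ_i, N_j⟩ for ⟨ψ_ij, N⟩; mixed partials make the cross
terms equal. -/
theorem secondForm_eq (he : e ∈ IsManifold.maximalAtlas (𝓡 2) ∞ M) (hq : q ∈ e.source)
    (hf : ContDiffOn ℝ ∞ (f ∘ e.symm) e.target) (hn : ContDiffOn ℝ ∞ (n ∘ e.symm) e.target)
    (horth : ∀ i, ∀ x ∈ e.target, lor (pd i (f ∘ e.symm) x) ((n ∘ e.symm) x) = 0)
    (X Y : TangentSpace (𝓡 2) q) :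
    secondForm f n q X Y =
      lor (pd 0 (pd 0 (f ∘ e.symm)) (e q)) (n q) *
        (chartDiff e q X 0 * chartDiff e q Y 0) +
      lor (pd 1 (pd 0 (f ∘ e.symm)) (e q)) (n q) *
        (chartDiff e q X 0 * chartDiff e q Y 1 +
          chartDiff e q X 1 * chartDiff e q Y 0) +
      lor (pd 1 (pd 1 (f ∘ e.symm)) (e q)) (n q) *
        (chartDiff e q X 1 * chartDiff e q Y 1) := by
  have hx := e.map_source hq
  have key : ∀ i j, lor (pd i (f ∘ e.symm) (e q)) (pd j (n ∘ e.symm) (e q)) =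
      -lor (pd j (pd i (f ∘ e.symm)) (e q)) (n q) := fun i j => by
    have h1 := pd_congr (i := j) e.open_target (horth i) hx
    rw [pd_const, pd_lor (differentiableAt_of_contDiffOn e.open_target
      (contDiffOn_pd e.open_target hf i) hx) (differentiableAt_of_contDiffOn e.open_target hn hx),
      Function.comp_apply, e.left_inv hq] at h1
    linarith
  rw [secondForm, diff_eq_pd he hq hf, diff_eq_pd he hq hn]
  simp only [lor_add_left, lor_add_right, lor_smul_left, lor_smul_right, key,
    pd_comm e.open_target hf hx]
  ring

/-- The mean curvature in null coordinates. -/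
theorem meanCurvature_eq_div {T : TangentSpace (𝓡 2) q →L[ℝ] Plane} (hT : Function.Injective T)
    {ρ Q h R : ℝ} (hρ : ρ ≠ 0)
    (h1 : ∀ X Y, firstForm f q X Y = ρ * (T X 0 * T Y 1 + T X 1 * T Y 0))
    (h2 : ∀ X Y, secondForm f n q X Y =
      Q * (T X 0 * T Y 0) + h * (T X 0 * T Y 1 + T X 1 * T Y 0) + R * (T X 1 * T Y 1)) :
    meanCurvature f n q = h / ρ := by
  -- T transports the standard basis of the tangent space, in which the trace is defined, to the
  -- null coordinates; injectivity makes its determinant nonzero.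
  have hdet : T (stdVec 0) 0 * T (stdVec 1) 1 - T (stdVec 0) 1 * T (stdVec 1) 0 ≠ 0 := by
    intro h0
    let T' : Plane →ₗ[ℝ] Plane := T.toLinearMap
    have hinj : ∀ v : Plane, T' v = 0 → v = 0 := fun v hv => hT (hv.trans (map_zero T).symm)
    have hz : ∀ a b : ℝ, a * T' (stdVec 0) 0 + b * T' (stdVec 1) 0 = 0 →
        a * T' (stdVec 0) 1 + b * T' (stdVec 1) 1 = 0 → a = 0 ∧ b = 0 := by
      intro a b ha hb
      have h3 : T' (a • stdVec 0 + b • stdVec 1) = 0 := by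
        rw [map_add, map_smul, map_smul]
        ext i
        fin_cases i
        · simpa using ha
        · simpa using hb
      have h4 := hinj _ h3
      have h5 := congrArg (fun v : Plane => v 0) h4
      have h6 := congrArg (fun v : Plane => v 1) h4
      simp [stdVec] at h5 h6
      exact ⟨h5, h6⟩
    change T' (stdVec 0) 0 * T' (stdVec 1) 1 - T' (stdVec 0) 1 * T' (stdVec 1) 0 = 0 at h0
    have h3 := hz (T' (stdVec 1) 1) (-T' (stdVec 0) 1) (by linarith) (by ring)
    have h4 := hz (T' (stdVec 1) 0) (-T' (stdVec 0) 0) (by ring) (by linarith)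
    have h5 := hz 1 0 (by linarith [h4.2]) (by linarith [h3.2])
    exact one_ne_zero h5.1
  have h1' : ∀ i j, firstMatrix f q i j =
      ρ * (T (stdVec i) 0 * T (stdVec j) 1 + T (stdVec i) 1 * T (stdVec j) 0) := fun i j => h1 _ _
  have h2' : ∀ i j, secondMatrix f n q i j = Q * (T (stdVec i) 0 * T (stdVec j) 0) +
      h * (T (stdVec i) 0 * T (stdVec j) 1 + T (stdVec i) 1 * T (stdVec j) 0) +
      R * (T (stdVec i) 1 * T (stdVec j) 1) := fun i j => h2 _ _
  simp only [meanCurvature, Matrix.inv_def, Matrix.trace_fin_two, Matrix.adjugate_fin_two,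
    Matrix.det_fin_two, Ring.inverse_eq_inv', Matrix.mul_apply, Fin.sum_univ_two,
    Matrix.smul_apply, Matrix.of_apply, h1', h2', smul_eq_mul, Matrix.cons_val]
  generalize T (stdVec 0) 0 = a, T (stdVec 0) 1 = b, T (stdVec 1) 0 = c, T (stdVec 1) 1 = d
    at hdet ⊢
  -- The determinant of the first form is -(ρ det T)², hence invertible.
  have h3 : ρ * (a * b + b * a) * (ρ * (c * d + d * c)) -
      ρ * (a * d + b * c) * (ρ * (c * b + d * a)) = -(ρ * (a * d - b * c)) ^ 2 := by ring
  rw [h3]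
  have h4 : -(ρ * (a * d - b * c)) ^ 2 ≠ 0 := neg_ne_zero.2 (pow_ne_zero 2 (mul_ne_zero hρ hdet))
  rw [eq_div_iff hρ, ← mul_left_inj' h4]
  generalize hk : -(ρ * (a * d - b * c)) ^ 2 = k at h4 ⊢
  field_simp
  rw [← hk]
  ring

end Charts

section

variable {M : Type*} [TopologicalSpace M]
  {e : OpenPartialHomeomorph M Plane} {f n φ N : M → E31} {ρ Q R : Plane → ℝ} {H : ℝ}

/-- A surface of constant mean curvature in a null chart. -/
theorem IsTimelikeOn.isNullSurface [ChartedSpace Plane M] (hφ : IsTimelikeOn φ N univ)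
    (hH : ∀ p, meanCurvature φ N p = H) (he : IsNullChart φ e) :
    IsNullSurface (φ ∘ e.symm) (N ∘ e.symm)
      (fun x => lor (pd 0 (φ ∘ e.symm) x) (pd 1 (φ ∘ e.symm) x))
      (fun x => lor (pd 0 (pd 0 (φ ∘ e.symm)) x) (N (e.symm x)))
      (fun x => lor (pd 1 (pd 1 (φ ∘ e.symm)) x) (N (e.symm x))) H e.target := by
  have hs : ContDiffOn ℝ ∞ (φ ∘ e.symm) e.target :=
    contDiffOn_comp_chart_symm he.mem_atlas (hφ.smooth.mono (subset_univ _))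
  have hn : ContDiffOn ℝ ∞ (N ∘ e.symm) e.target :=
    contDiffOn_comp_chart_symm he.mem_atlas (hφ.smooth_normal.mono (subset_univ _))
  have hcd : ∀ x ∈ e.target, ∀ i, coordDeriv e i φ (e.symm x) = pd i (φ ∘ e.symm) x :=
    fun x hx i => by rw [coordDeriv, e.right_inv hx]; rfl
  have horth : ∀ i, ∀ x ∈ e.target, lor (pd i (φ ∘ e.symm) x) ((N ∘ e.symm) x) = 0 := by
    intro i x hx
    have hq := e.map_target hx
    obtain ⟨X, hX⟩ := ((chart_mdifferentiable he.mem_atlas).mfderiv_bijective hq).2 (stdVec i)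
    have h1 := hφ.normal (e.symm x) (mem_univ _) X
    rw [diff_eq_fderiv_chart he.mem_atlas hq (by
      rw [e.right_inv hx]; exact differentiableAt_of_contDiffOn e.open_target hs hx), hX,
      e.right_inv hx] at h1
    exact h1
  have hfr : ∀ x ∈ e.target, IsNullFrame (lor (pd 0 (φ ∘ e.symm) x) (pd 1 (φ ∘ e.symm) x))
      (pd 0 (φ ∘ e.symm) x) (pd 1 (φ ∘ e.symm) x) ((N ∘ e.symm) x) := fun x hx =>
    ⟨by rw [← hcd x hx]; exact he.null_u _ (e.map_target hx),
      by rw [← hcd x hx]; exact he.null_v _ (e.map_target hx), rfl, horth 0 x hx, horth 1 x hx,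
      hφ.unit_normal _ (mem_univ _)⟩
  refine ⟨hs, hn, hfr, fun x hx => rfl, fun x hx => ?_, fun x hx => rfl⟩
  have hq := e.map_target hx
  have hρ : lor (pd 0 (φ ∘ e.symm) x) (pd 1 (φ ∘ e.symm) x) ≠ 0 := by
    rw [← hcd x hx, ← hcd x hx]; exact (he.pos _ hq).ne'
  -- The mean curvature is ⟨ψ_uv, N⟩/ρ; read backwards, this determines the mixed coefficient of the
  -- second form.
  have h1 := meanCurvature_eq_div (chartDiff_injective he.mem_atlas hq)
    (by rw [e.right_inv hx]; exact hρ)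
    (firstForm_eq he.mem_atlas hq hs (hfr _ (e.map_source hq)))
    (secondForm_eq he.mem_atlas hq hs hn horth)
  rw [hH, e.right_inv hx] at h1
  rw [h1, div_mul_cancel₀ _ hρ]
  rfl

namespace IsNullSurface

variable (h : IsNullSurface (f ∘ e.symm) (n ∘ e.symm) ρ Q R H e.target) {q : M}
  (hq : q ∈ e.source)

include h hq

theorem frame_chart :
    IsNullFrame (ρ (e q)) (pd 0 (f ∘ e.symm) (e q)) (pd 1 (f ∘ e.symm) (e q)) (n q) := by
  have := h.frame _ (e.map_source hq)
  rwa [Function.comp_apply, e.left_inv hq] at this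

theorem hopfQ_eq : hopfQ e f n q = Q (e q) := by
  have := h.uu _ (e.map_source hq)
  rwa [Function.comp_apply, e.left_inv hq, ← coordDeriv_coordDeriv hq] at this

theorem hopfR_eq : hopfR e f n q = R (e q) := by
  have := h.vv _ (e.map_source hq)
  rwa [Function.comp_apply, e.left_inv hq, ← coordDeriv_coordDeriv hq] at this

variable [ChartedSpace Plane M] (he : e ∈ IsManifold.maximalAtlas (𝓡 2) ∞ M)

include he

theorem firstForm_chart (X Y : TangentSpace (𝓡 2) q) : firstForm f q X Y = ρ (e q) *
    (chartDiff e q X 0 * chartDiff e q Y 1 + chartDiff e q X 1 * chartDiff e q Y 0) :=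
  firstForm_eq he hq h.smooth (h.frame_chart hq) X Y

theorem secondForm_chart (X Y : TangentSpace (𝓡 2) q) : secondForm f n q X Y =
    Q (e q) * (chartDiff e q X 0 * chartDiff e q Y 0) +
    H * ρ (e q) * (chartDiff e q X 0 * chartDiff e q Y 1 + chartDiff e q X 1 * chartDiff e q Y 0) +
    R (e q) * (chartDiff e q X 1 * chartDiff e q Y 1) := by
  have h2 := h.uv _ (e.map_source hq)
  have h1 := h.uu _ (e.map_source hq)
  have h3 := h.vv _ (e.map_source hq)
  rw [Function.comp_apply, e.left_inv hq] at h1 h2 h3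
  rw [secondForm_eq he hq h.smooth h.smooth_normal, h1, h2, h3]
  intro i x hx
  fin_cases i
  · exact (h.frame x hx).xn
  · exact (h.frame x hx).yn

theorem meanCurvature_chart (hρ : ρ (e q) ≠ 0) : meanCurvature f n q = H := by
  rw [meanCurvature_eq_div (chartDiff_injective he hq) hρ (h.firstForm_chart hq he)
    (h.secondForm_chart hq he), mul_div_cancel_right₀ _ hρ]

/-- Without Q and R the second form is H times the first. Nontriviality uses the contrapositive: at
a non-umbilic point Q and R do not both vanish. -/
theorem isUmbilicAt (hQ : Q (e q) = 0) (hR : R (e q) = 0) : IsUmbilicAt f n q := by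
  refine ⟨H, fun X Y => ?_⟩
  rw [h.secondForm_chart hq he, h.firstForm_chart hq he, hQ, hR]
  ring

theorem vol_diff (X Y : TangentSpace (𝓡 2) q) : vol (diff f q X) (diff f q Y) (n q) =
    (chartDiff e q X 0 * chartDiff e q Y 1 - chartDiff e q X 1 * chartDiff e q Y 0) *
      vol (pd 0 (f ∘ e.symm) (e q)) (pd 1 (f ∘ e.symm) (e q)) (n q) := by
  rw [diff_eq_pd he hq h.smooth, diff_eq_pd he hq h.smooth, vol_combination]

theorem injective_diff (hρ : ρ (e q) ≠ 0) : Function.Injective (diff f q) := by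
  refine (injective_iff_map_eq_zero _).2 fun X hX => ?_
  refine chartDiff_injective he hq ?_
  rw [map_zero]
  have hfr := h.frame_chart hq
  rw [diff_eq_pd he hq h.smooth] at hX
  have h1 := congrArg (fun V => lor V (pd 0 (f ∘ e.symm) (e q))) hX
  have h2 := congrArg (fun V => lor V (pd 1 (f ∘ e.symm) (e q))) hX
  have h0 : ∀ V, lor 0 V = 0 := fun V => by simp [lor]
  simp only [lor_add_left, lor_smul_left, hfr.xx, hfr.yy, hfr.xy, h0,
    lor_comm (pd 1 (f ∘ e.symm) (e q)) (pd 0 (f ∘ e.symm) (e q)), mul_zero, zero_add, add_zero,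
    mul_eq_zero, hρ, or_false] at h1 h2
  ext i
  fin_cases i
  · exact h2
  · exact h1

end IsNullSurface

end

/-! ### The associated family on the manifold -/

/-- The associated family of a timelike surface of constant mean curvature. -/
theorem exists_isAssociatedFamily {M : Type*} [TopologicalSpace M] [ChartedSpace Plane M]
    {φ N : M → E31} (hφ : IsTimelikeOn φ N univ) {H : ℝ} (hH : ∀ p, meanCurvature φ N p = H)
    {e : OpenPartialHomeomorph M Plane} (he : IsNullChart φ e) (hs : IsSimplyConnected e.source) :
    ∃ Φ ν : ℝ → M → E31, IsAssociatedFamily φ N e Φ ν ∧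
      ((∃ q ∈ e.source, ¬ IsUmbilicAt φ N q) → ∀ l m : ℝ, l ≠ 0 → m ≠ 0 → l ≠ m →
        CongruentOn (Φ l) (Φ m) e.source → H = 0 ∧ m = -l) := by
  have hS := hφ.isNullSurface hH he
  have hρ : ∀ x ∈ e.target, lor (pd 0 (φ ∘ e.symm) x) (pd 1 (φ ∘ e.symm) x) ≠ 0 := fun x hx => by
    have := he.pos _ (e.map_target hx)
    rw [coordDeriv, coordDeriv, e.right_inv hx] at this
    exact this.ne'
  obtain ⟨f, ν, hfs, hνs, hone, hfam⟩ := hS.exists_associated_family e.open_target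
    ((isSimplyConnected_source_iff e).1 hs) hρ
  have hmem := he.mem_atlas
  have hΦ : ∀ l : ℝ, EqOn ((fun q => f (e q, l)) ∘ e.symm) (fun x => f (x, l)) e.target :=
    fun l x hx => by simp only [Function.comp_apply, e.right_inv hx]
  have hν : ∀ l : ℝ, EqOn ((fun q => ν (e q, l)) ∘ e.symm) (fun x => ν (x, l)) e.target :=
    fun l x hx => by simp only [Function.comp_apply, e.right_inv hx]
  have hSl := fun l hl => (hfam l hl).1.congr e.open_target (hΦ l) (hν l)
  have hsmooth : ∀ {g : Plane × ℝ → E31}, ContDiffOn ℝ ∞ g (e.target ×ˢ {0}ᶜ) →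
      ContMDiffOn (𝓘(ℝ, ℝ).prod (𝓡 2)) 𝓘(ℝ, E31) ∞ (fun x : ℝ × M => g (e x.2, x.1))
        ({0}ᶜ ×ˢ e.source) := fun hg => by
    have h1 : ContMDiffOn (𝓘(ℝ, ℝ).prod (𝓡 2)) (𝓡 2) ∞ (fun x : ℝ × M => e x.2)
        ({0}ᶜ ×ˢ e.source) :=
      (contMDiffOn_of_mem_maximalAtlas hmem).comp contMDiffOn_snd fun x hx => hx.2
    have h2 : ContMDiffOn (𝓘(ℝ, ℝ).prod (𝓡 2)) 𝓘(ℝ, ℝ) ∞ (fun x : ℝ × M => x.1)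
        ({0}ᶜ ×ˢ e.source) := contMDiffOn_fst
    exact (contMDiffOn_iff_contDiffOn.2 hg).comp (h1.prodMk_space h2)
      fun x hx => ⟨e.map_source hx.2, hx.1⟩
  have hiso : ∀ l : ℝ, l ≠ 0 → ∀ q ∈ e.source, ∀ X Y : TangentSpace (𝓡 2) q,
      firstForm (fun q => f (e q, l)) q X Y = firstForm φ q X Y := fun l hl q hq X Y => by
    rw [(hSl l hl).firstForm_chart hq hmem, hS.firstForm_chart hq hmem]
  refine ⟨fun l q => f (e q, l), fun l q => ν (e q, l), ⟨hsmooth hfs, hsmooth hνs, ?_, ?_, ?_,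
    hiso, ?_, ?_, ?_, ?_⟩, ?_⟩
  · intro q hq
    have := (hone _ (e.map_source hq)).1
    rwa [Function.comp_apply, e.left_inv hq] at this
  · intro q hq
    have := (hone _ (e.map_source hq)).2
    rwa [Function.comp_apply, e.left_inv hq] at this
  · intro l hl
    refine ⟨contMDiffOn_comp_chart hmem (hfam l hl).1.smooth,
      fun q hq => (hSl l hl).injective_diff hq hmem (hρ _ (e.map_source hq)), fun q hq => ?_,
      contMDiffOn_comp_chart hmem (hfam l hl).1.smooth_normal,
      fun q hq => ((hSl l hl).frame_chart hq).nn, fun q hq X => ?_⟩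
    · obtain ⟨X, Y, h1, h2, h3⟩ := hφ.lorentzian q (mem_univ q)
      exact ⟨X, Y, by rw [hiso l hl q hq, h1], by rw [hiso l hl q hq, h2],
        by rw [hiso l hl q hq, h3]⟩
    · have hfr := (hSl l hl).frame_chart hq
      rw [diff_eq_pd hmem hq (hSl l hl).smooth, lor_add_left, lor_smul_left, lor_smul_left, hfr.xn,
        hfr.yn]
      simp
  · intro l hl q hq X Y
    have hx := e.map_source hq
    have h1 := (hfam l hl).2 _ hx
    rw [Function.comp_apply, e.left_inv hq] at h1
    rw [(hSl l hl).vol_diff hq hmem, hS.vol_diff hq hmem, pd_congr e.open_target (hΦ l) hx,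
      pd_congr e.open_target (hΦ l) hx, h1]
  · intro l hl q hq
    rw [(hSl l hl).meanCurvature_chart hq hmem (hρ _ (e.map_source hq)), hH]
  · intro l hl q hq
    rw [(hSl l hl).hopfQ_eq hq, hS.hopfQ_eq hq]
  · intro l hl q hq
    rw [(hSl l hl).hopfR_eq hq, hS.hopfR_eq hq]
  · rintro ⟨q, hq, humb⟩ l m hl hm hlm ⟨A, b, hA, hAb⟩
    have hx := e.map_source hq
    obtain ⟨c, hc, hcQ, hcR, hcH⟩ := (hSl l hl).hopf_of_congruent e.open_target (hSl m hm) hA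
      (fun x hx => hAb _ (e.map_target hx)) hx (hρ _ hx)
    have hQR := fun hQ hR => humb (hS.isUmbilicAt hq hmem hQ hR)
    generalize lor (pd 0 (pd 0 (φ ∘ e.symm)) (e q)) (N (e.symm (e q))) = Q at hcQ hQR
    generalize lor (pd 1 (pd 1 (φ ∘ e.symm)) (e q)) (N (e.symm (e q))) = R at hcR hQR
    rw [← mul_assoc] at hcQ hcR
    have hzero : ∀ a b z : ℝ, a ≠ b → a * z = b * z → z = 0 := fun a b z hab h =>
      (mul_eq_mul_right_iff.1 h).resolve_left hab
    -- If c = 1, then m ≠ l forces Q = R = 0, contradicting non-umbilicity. If c = -1, then H = -H,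
    -- and m ≠ -l would again force Q = R = 0.
    rcases sq_eq_one_iff.1 hc with rfl | rfl
    · rw [one_mul] at hcQ hcR
      exact absurd (hzero _ _ _ (inv_injective.ne hlm.symm) hcR)
        (hQR (hzero _ _ _ hlm.symm hcQ))
    · refine ⟨by linarith, ?_⟩
      by_contra hml
      rw [neg_one_mul] at hcQ hcR
      rw [← inv_neg] at hcR
      exact hQR (hzero _ _ _ hml hcQ) (hzero _ _ _ (inv_injective.ne hml) hcR)

end TimelikeSurface

end

theorem proposition4p1 {M : Type*} [TopologicalSpace M] [T2Space M] [SecondCountableTopology M]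
    [ConnectedSpace M] [ChartedSpace TimelikeSurface.Plane M] [IsManifold (𝓡 2) ∞ M]
    (φ N : M → TimelikeSurface.E31) (hφ : TimelikeSurface.IsTimelikeOn φ N Set.univ)
    (H : ℝ) (hH : ∀ p : M, TimelikeSurface.meanCurvature φ N p = H)
    (hnu : ¬ TimelikeSurface.IsTotallyUmbilic φ N) :
    (∀ p : M, ∃ e : OpenPartialHomeomorph M TimelikeSurface.Plane,
      p ∈ e.source ∧ TimelikeSurface.IsNullChart φ e ∧ IsSimplyConnected e.source) ∧
    (∀ e : OpenPartialHomeomorph M TimelikeSurface.Plane,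
      TimelikeSurface.IsNullChart φ e → IsSimplyConnected e.source →
      ∃ Φ ν : ℝ → M → TimelikeSurface.E31,
        TimelikeSurface.IsAssociatedFamily φ N e Φ ν ∧
        ((∃ q ∈ e.source, ¬ TimelikeSurface.IsUmbilicAt φ N q) →
          ∀ l m : ℝ, l ≠ 0 → m ≠ 0 → l ≠ m → TimelikeSurface.CongruentOn (Φ l) (Φ m) e.source →
            H = 0 ∧ m = -l)) :=
  ⟨fun p => TimelikeSurface.exists_nullChart hφ p,
    fun _ he hs => TimelikeSurface.exists_isAssociatedFamily hφ hH he hs⟩
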